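/- Let $N\ge 0$ be an integer and $\alpha>0$ real. For a partition $\kappa=(\kappa_1\ge\dots\ge\kappa_N\ge 0)$ let $P_\kappa=P_\kappa^{(\alpha)}(z_1,\dots,z_N)$ be the symmetric Jack polynomial, i.e. the unique symmetric polynomial with complex coefficients that is an eigenfunction of $$D_2(\alpha)=\sum_{j=1}^N z_j^2\frac{\partial^2}{\partial z_j^2}+\frac{2}{\alpha}\sum_{j\neq k}\frac{z_j^2}{z_j-z_k}\frac{\partial}{\partial z_j}$$ and is of the form $P_\kappa=m_\kappa+\sum_{\mu<\kappa}u_{\kappa\mu}m_\mu$, where $m_\mu$ is the monomial symmetric polynomial in $z_1,\dots,z_N$ and $\mu$ runs over the partitions with at most $N$ parts and $|\mu|=|\kappa|$ that are strictly smaller than $\kappa$ in the dominance order. Write, with $z_j=e^{2\pi i x_j}$ and $z_j^*$ its complex conjugate, $$\mathcal N_\kappa^{(P)}=\int_{[0,1]^N}\prod_{1\le j<k\le N}|z_k-z_j|^{2/\alpha}\,P_\kappa(z_1^*,\dots,z_N^*)\,P_\kappa(z_1,\dots,z_N)\,dx_1\cdots dx_N .$$ For a composition $\eta=(\eta_1,\dots,\eta_N)$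 of non-negative integers let $\eta^+$ be its weakly decreasing rearrangement and $\eta^R=(\eta^+_N,\dots,\eta^+_1)$. For a node $s=(i,j)$, $1\le i\le N$, $1\le j\le\eta_i$, of the diagram of $\eta$ put $a(s)=\eta_i-j$, $a'(s)=j-1$, $$l(s)=\#\{k>i: j\le\eta_k\le\eta_i\}+\#\{k<i: j\le\eta_k+1\le\eta_i\},\qquad l'(s)=\#\{k>i:\eta_k>\eta_i\}+\#\{k<i:\eta_k\ge\eta_i\},$$ and $$d_\eta=\prod_{s\in\eta}(\alpha(a(s)+1)+l(s)+1),\quad d'_\eta=\prod_{s\in\eta}(\alpha(a(s)+1)+l(s)),\quad h_\eta=\prod_{s\in\eta}(\alpha a(s)+l(s)+1),$$ $$e_\eta=\prod_{s\in\eta}(\alpha(a'(s)+1)+N-l'(s)),\quad e'_\eta=\prod_{s\in\eta}(\alpha(a'(s)+1)+N-1-l'(s)),\quad b_\eta=\prod_{s\in\eta}(\alpha a'(s)+N-l'(s)).$$ **Proposition 3.4.** For every composition $\eta$ of length $N$, with $\kappa=\eta^+$, the polynomial $P_\kappa$ exists and is unique, and $$\frac{\mathcal N_\kappa^{(P)}}{\mathcal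 N_0^{(P)}}=\frac{N!}{\prod_{j=0}^{\kappa_1}f_j!}\,\frac{d'_{\eta^+}\,e_{\eta^R}}{d_{\eta^R}\,e'_{\eta^R}}=\frac{b_\kappa\,d'_\kappa}{e'_\kappa\,h_\kappa},$$ where $f_j=\#\{i:\kappa_i=j\}$ is the frequency of the part $j$ in $\kappa$, including $j=0$ (for $N=0$ the product of the $f_j!$ is $1$). -/

import Mathlib

open scoped Nat ComplexConjugate

noncomputable section

namespace JackTorus

variable {N : ℕ}

/-! Compositions of length `N` are functions `Fin N → ℕ`; a partition of length at most `N`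
is an antitone composition. The row index `i` of the mathematics is `i : Fin N` (shifted by one),
the column index `j` runs over `1, …, η i` as usual. -/

/-- The partition `η⁺`: the weakly decreasing rearrangement of `η`. -/
def plus (η : Fin N → ℕ) : Fin N → ℕ := fun i => η (Tuple.sort η i.rev)

/-- The composition `ηᴿ = (η⁺_N, …, η⁺_1)`. -/
def revPlus (η : Fin N → ℕ) : Fin N → ℕ := fun i => plus η i.rev

/-- The strict dominance order `μ < κ` on partitions of the same modulus. -/
def DominatedBy (μ κ : Fin N → ℕ) : Prop :=
  ∑ i, μ i = ∑ i, κ i ∧ (∀ p, ∑ i ∈ Finset.Iic p, μ i ≤ ∑ i ∈ Finset.Iic p, κ i) ∧ μ ≠ κ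

/-- The monomial symmetric polynomial `m_μ` in `N` variables (Mathlib's `msymm`, for the integer
partition whose parts are the nonzero entries of `μ`). -/
def monoSymm (μ : Fin N → ℕ) : MvPolynomial (Fin N) ℂ :=
  MvPolynomial.msymm (Fin N) ℂ
    (Nat.Partition.ofSums (∑ i, μ i) (Finset.univ.val.map μ) rfl)

/-- The operator `D₂(α) = ∑_j z_j² ∂_j² + (2/α) ∑_{j ≠ k} z_j² / (z_j - z_k) ∂_j`, with values in
the field of rational functions in `z_1, …, z_N`. -/
def D₂ (α : ℝ) (P : MvPolynomial (Fin N) ℂ) : FractionRing (MvPolynomial (Fin N) ℂ) :=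
  let ι := algebraMap (MvPolynomial (Fin N) ℂ) (FractionRing (MvPolynomial (Fin N) ℂ))
  (∑ j, ι (.X j) ^ 2 * ι (MvPolynomial.pderiv j (MvPolynomial.pderiv j P))) +
    ι (.C (2 / (α : ℂ))) * ∑ j, ∑ k ∈ Finset.univ.erase j,
      ι (.X j) ^ 2 / (ι (.X j) - ι (.X k)) * ι (MvPolynomial.pderiv j P)

/-- `P` is a symmetric polynomial eigenfunction of `D₂(α)` of the form
`m_κ + ∑_{μ < κ} u_{κμ} m_μ`. -/
structure IsSymmetricJack (α : ℝ) (κ : Fin N → ℕ) (P : MvPolynomial (Fin N) ℂ) : Prop where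
  symmetric : P.IsSymmetric
  triangular : P - monoSymm κ ∈
    Submodule.span ℂ {m | ∃ μ : Fin N → ℕ, Antitone μ ∧ DominatedBy μ κ ∧ m = monoSymm μ}
  eigenfunction : ∃ E : ℂ, D₂ α P = algebraMap _ _ (MvPolynomial.C E * P)

/-- The symmetric Jack polynomial `P_κ^{(α)}`: the polynomial with the property above. -/
def jackP (α : ℝ) (κ : Fin N → ℕ) : MvPolynomial (Fin N) ℂ :=
  Classical.epsilon (IsSymmetricJack α κ)

/-- The point `z_j = exp(2πi x_j)` of the torus. -/
def torusPoint (x : Fin N → ℝ) (j : Fin N) : ℂ :=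
  Complex.exp (2 * Real.pi * Complex.I * x j)

/-- The inner product
`⟨f, g⟩ = ∫_{[0,1]^N} ∏_{j<k} |z_k - z_j|^{2/α} f(z₁*, …, z_N*) g(z₁, …, z_N) dx₁ ⋯ dx_N`. -/
def torusInner (α : ℝ) (f g : MvPolynomial (Fin N) ℂ) : ℂ :=
  ∫ x in Set.Icc (0 : Fin N → ℝ) 1,
    ((∏ j, ∏ k ∈ Finset.Ioi j, ‖torusPoint x k - torusPoint x j‖ ^ (2 / α) : ℝ) : ℂ) *
      (MvPolynomial.eval (fun j => conj (torusPoint x j)) f *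
        MvPolynomial.eval (torusPoint x) g)

/-- The torus norm `𝒩_κ^{(P)} = ⟨P_κ, P_κ⟩`. -/
def normP (α : ℝ) (κ : Fin N → ℕ) : ℂ := torusInner α (jackP α κ) (jackP α κ)

/-- The leg length of the node `(i, j)` of `η`. -/
def leg (η : Fin N → ℕ) (i : Fin N) (j : ℕ) : ℕ :=
  (Finset.univ.filter fun k => i < k ∧ j ≤ η k ∧ η k ≤ η i).card +
    (Finset.univ.filter fun k => k < i ∧ j ≤ η k + 1 ∧ η k + 1 ≤ η i).card

/-- The leg colength of the nodes in row `i` of `η`. -/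
def coleg (η : Fin N → ℕ) (i : Fin N) : ℕ :=
  (Finset.univ.filter fun k => i < k ∧ η i < η k).card +
    (Finset.univ.filter fun k => k < i ∧ η i ≤ η k).card

/-- The arm length of the node `(i, j)` of `η` (only used for `1 ≤ j ≤ η i`). -/
def arm (η : Fin N → ℕ) (i : Fin N) (j : ℕ) : ℝ := (η i : ℝ) - j

/-- The arm colength of a node in column `j`. -/
def coarm (j : ℕ) : ℝ := (j : ℝ) - 1

/-- `d_η = ∏_{s ∈ η} (α (a(s) + 1) + l(s) + 1)`. -/
def d (α : ℝ) (η : Fin N → ℕ) : ℝ :=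
  ∏ i, ∏ j ∈ Finset.Icc 1 (η i), (α * (arm η i j + 1) + leg η i j + 1)

/-- `d'_η = ∏_{s ∈ η} (α (a(s) + 1) + l(s))`. -/
def d' (α : ℝ) (η : Fin N → ℕ) : ℝ :=
  ∏ i, ∏ j ∈ Finset.Icc 1 (η i), (α * (arm η i j + 1) + leg η i j)

/-- `e_η = ∏_{s ∈ η} (α (a'(s) + 1) + N - l'(s))`. -/
def e (α : ℝ) (η : Fin N → ℕ) : ℝ :=
  ∏ i, ∏ j ∈ Finset.Icc 1 (η i), (α * (coarm j + 1) + N - coleg η i)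

/-- `e'_η = ∏_{s ∈ η} (α (a'(s) + 1) + N - 1 - l'(s))`. -/
def e' (α : ℝ) (η : Fin N → ℕ) : ℝ :=
  ∏ i, ∏ j ∈ Finset.Icc 1 (η i), (α * (coarm j + 1) + N - 1 - coleg η i)

/-- `b_η = ∏_{s ∈ η} (α a'(s) + N - l'(s))`. -/
def b (α : ℝ) (η : Fin N → ℕ) : ℝ :=
  ∏ i, ∏ j ∈ Finset.Icc 1 (η i), (α * coarm j + N - coleg η i)

/-- `h_κ = ∏_{s ∈ κ} (α a(s) + l(s) + 1)`. -/
def h (α : ℝ) (κ : Fin N → ℕ) : ℝ :=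
  ∏ i, ∏ j ∈ Finset.Icc 1 (κ i), (α * arm κ i j + leg κ i j + 1)

/-- The frequency `f_j` of the part `j` in `κ`; zero parts are counted too. -/
def freq (κ : Fin N → ℕ) (j : ℕ) : ℕ := (Finset.univ.filter fun i => κ i = j).card

/-- The product of the `f_j !` over `0 ≤ j ≤ κ_1`, where `κ_1` is the largest part of `κ`. -/
def freqFactorial (κ : Fin N → ℕ) : ℕ :=
  ∏ j ∈ Finset.range (Finset.univ.sup κ + 1), (freq κ j)!

end JackTorus

end

noncomputable section

namespace JackTorus

open Finset

variable {N : ℕ}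

/-! ### The ranking of the rows of a composition -/

/-- Row `a` precedes row `b` in the stable decreasing ordering of the rows of `η`. -/
def Beats (η : Fin N → ℕ) (a b : Fin N) : Prop := η b < η a ∨ (η a = η b ∧ a < b)

instance (η : Fin N → ℕ) (a b : Fin N) : Decidable (Beats η a b) := by
  unfold Beats; infer_instance

theorem Beats.trans {η : Fin N → ℕ} {a b c : Fin N} (h₁ : Beats η a b) (h₂ : Beats η b c) :
    Beats η a c := by
  unfold Beats at *; omega

theorem Beats.irrefl {η : Fin N → ℕ} (a : Fin N) : ¬ Beats η a a := by
  unfold Beats; omega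

theorem Beats.total (η : Fin N → ℕ) {a b : Fin N} (hab : a ≠ b) : Beats η a b ∨ Beats η b a := by
  unfold Beats; omega

theorem Beats.asymm {η : Fin N → ℕ} {a b : Fin N} (h₁ : Beats η a b) : ¬ Beats η b a := by
  unfold Beats at *; omega

theorem coleg_eq (η : Fin N → ℕ) (i : Fin N) :
    coleg η i = (univ.filter fun k => Beats η k i).card := by
  unfold coleg
  rw [← card_union_of_disjoint]
  · congr 1
    ext k
    simp only [mem_union, mem_filter, mem_univ, true_and]
    unfold Beats
    rcases eq_or_ne k i with rfl | hk
    · omega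
    · omega
  · rw [disjoint_filter]
    exact fun k _ h₁ h₂ => lt_asymm h₁.1 h₂.1

theorem coleg_lt_of_beats {η : Fin N → ℕ} {a b : Fin N} (hab : Beats η a b) :
    coleg η a < coleg η b := by
  rw [coleg_eq, coleg_eq]
  apply card_lt_card
  rw [ssubset_iff_of_subset]
  · exact ⟨a, by simpa using hab, by simpa using Beats.irrefl a⟩
  · intro k hk
    simp only [mem_filter, mem_univ, true_and] at hk ⊢
    exact hk.trans hab

theorem coleg_comp_of_beats {M : ℕ} {η : Fin N → ℕ} {ν : Fin M → ℕ} (τ : Fin M ≃ Fin N)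
    (h₁ : ∀ a b, Beats ν a b ↔ Beats η (τ a) (τ b)) (i : Fin M) :
    coleg ν i = coleg η (τ i) := by
  rw [coleg_eq, coleg_eq]
  refine card_equiv τ fun k => ?_
  simp [h₁]

/-- The eigenvalue `α η_i - l'(i)` of the `i`-th Cherednik operator. -/
def bar (α : ℝ) (η : Fin N → ℕ) (i : Fin N) : ℝ := α * η i - coleg η i

theorem le_of_beats {η : Fin N → ℕ} {a b : Fin N} (hab : Beats η a b) : η b ≤ η a := by
  unfold Beats at hab; omega

theorem bar_sub_of_beats (α : ℝ) {η : Fin N → ℕ} {a b : Fin N} (hab : Beats η a b) :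
    1 + α * ((η a : ℝ) - η b) ≤ bar α η a - bar α η b := by
  have h₁ : (coleg η a : ℝ) + 1 ≤ coleg η b := by exact_mod_cast coleg_lt_of_beats hab
  unfold bar
  linarith

theorem bar_lt_of_beats {α : ℝ} (hα : 0 < α) {η : Fin N → ℕ} {a b : Fin N} (hab : Beats η a b) :
    bar α η b < bar α η a := by
  have h₁ := bar_sub_of_beats α hab
  have h₂ : (η b : ℝ) ≤ η a := by exact_mod_cast le_of_beats hab
  nlinarith

theorem beats_iff_bar_lt {α : ℝ} (hα : 0 < α) (η : Fin N → ℕ) (a b : Fin N) :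
    Beats η a b ↔ bar α η b < bar α η a := by
  refine ⟨bar_lt_of_beats hα, fun hlt => ?_⟩
  by_contra hn
  by_cases hab : a = b
  · subst hab; exact lt_irrefl _ hlt
  · rcases Beats.total η hab with h₁ | h₁
    · exact hn h₁
    · exact lt_asymm hlt (bar_lt_of_beats hα h₁)

theorem bar_injective {α : ℝ} (hα : 0 < α) (η : Fin N → ℕ) : Function.Injective (bar α η) := by
  intro a b hab
  by_contra hne
  rcases Beats.total η hne with h₁ | h₁
  · exact absurd hab (bar_lt_of_beats hα h₁).ne'
  · exact absurd hab (bar_lt_of_beats hα h₁).ne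

theorem eq_comp_of_bar_eq_comp {α : ℝ} (hα : 0 < α) {η ν : Fin N → ℕ} (τ : Equiv.Perm (Fin N))
    (hb : bar α ν = bar α η ∘ τ) : ν = η ∘ τ := by
  have h₁ : ∀ a b, Beats ν a b ↔ Beats η (τ a) (τ b) := fun a b => by
    rw [beats_iff_bar_lt hα, beats_iff_bar_lt hα, hb]; rfl
  funext i
  have h₂ := coleg_comp_of_beats τ h₁ i
  have h₃ := congrFun hb i
  simp only [bar, Function.comp, h₂, sub_left_inj, mul_eq_mul_left_iff, Nat.cast_inj,
    hα.ne', or_false] at h₃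
  simpa using h₃

theorem eq_of_bar_eq {α : ℝ} (hα : 0 < α) {η ν : Fin N → ℕ} (hb : bar α ν = bar α η) : ν = η :=
  eq_comp_of_bar_eq_comp hα (Equiv.refl _) hb

theorem swap_lt_swap_iff {i j a b : Fin N} (hij : (i : ℕ) + 1 = j)
    (h₁ : ¬ (a = i ∧ b = j)) (h₂ : ¬ (a = j ∧ b = i)) :
    Equiv.swap i j a < Equiv.swap i j b ↔ a < b := by
  simp only [Equiv.swap_apply_def]
  split_ifs <;> simp only [Fin.lt_def, Fin.ext_iff] at * <;> omega

theorem beats_comp_swap {η : Fin N → ℕ} {i j : Fin N} (hij : (i : ℕ) + 1 = j) (hη : η i ≠ η j)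
    (a b : Fin N) :
    Beats (η ∘ Equiv.swap i j) a b ↔ Beats η (Equiv.swap i j a) (Equiv.swap i j b) := by
  unfold Beats
  simp only [Function.comp]
  by_cases hab : a = b
  · subst hab; simp
  by_cases h₁ : a = i ∧ b = j
  · obtain ⟨rfl, rfl⟩ := h₁; simp only [Equiv.swap_apply_left, Equiv.swap_apply_right]; omega
  by_cases h₂ : a = j ∧ b = i
  · obtain ⟨rfl, rfl⟩ := h₂; simp only [Equiv.swap_apply_left, Equiv.swap_apply_right]; omega
  rw [swap_lt_swap_iff hij h₁ h₂]

theorem coleg_comp_swap {η : Fin N → ℕ} {i j : Fin N} (hij : (i : ℕ) + 1 = j) (hη : η i ≠ η j)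
    (a : Fin N) : coleg (η ∘ Equiv.swap i j) a = coleg η (Equiv.swap i j a) :=
  coleg_comp_of_beats _ (beats_comp_swap hij hη) a

theorem bar_comp_swap (α : ℝ) {η : Fin N → ℕ} {i j : Fin N} (hij : (i : ℕ) + 1 = j)
    (hη : η i ≠ η j) : bar α (η ∘ Equiv.swap i j) = bar α η ∘ Equiv.swap i j := by
  funext a
  simp [bar, coleg_comp_swap hij hη]

theorem comp_swap_of_eq {β : Type*} {η : Fin N → β} {i j : Fin N} (hη : η i = η j) :
    η ∘ Equiv.swap i j = η := by
  funext a
  simp only [Function.comp, Equiv.swap_apply_def]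
  split_ifs <;> simp_all

/-- A property that is stable under adjacent transpositions is stable under all permutations. -/
theorem perm_induction {Q : (Fin N → ℕ) → Prop}
    (hs : ∀ η (i j : Fin N), (i : ℕ) + 1 = j → Q η → Q (η ∘ Equiv.swap i j))
    (η : Fin N → ℕ) (hη : Q η) (τ : Equiv.Perm (Fin N)) : Q (η ∘ τ) := by
  cases N with
  | zero => rwa [Subsingleton.elim (η ∘ τ) η]
  | succ n =>
    have hτ : τ ∈ Submonoid.closure
        (Set.range fun i : Fin n => Equiv.swap i.castSucc i.succ) := by
      rw [Equiv.Perm.mclosure_swap_castSucc_succ]; trivial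
    refine Submonoid.closure_induction (motive := fun (τ : Equiv.Perm (Fin (n + 1))) _ => ∀ η, Q η → Q (η ∘ τ))
      ?_ ?_ ?_ hτ η hη
    · rintro _ ⟨i, rfl⟩ η hη
      exact hs η _ _ (by simp) hη
    · intro η hη; exact hη
    · intro x y _ _ hx hy η hη
      exact hy _ (hx _ hη)

@[to_additive]
theorem prod_coleg_comp_perm {M : Type*} [CommMonoid M] (F : ℕ → ℕ → M) (η : Fin N → ℕ)
    (τ : Equiv.Perm (Fin N)) :
    ∏ i, F ((η ∘ τ) i) (coleg (η ∘ τ) i) = ∏ i, F (η i) (coleg η i) := by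
  refine perm_induction
    (Q := fun ν => ∏ i, F (ν i) (coleg ν i) = ∏ i, F (η i) (coleg η i)) ?_ η rfl τ
  intro ν i j hij hν
  by_cases hne : ν i = ν j
  · rwa [comp_swap_of_eq hne]
  · rw [← hν, ← Equiv.prod_comp (Equiv.swap i j)]
    simp [coleg_comp_swap hij hne]

theorem sum_bar_sq_comp_perm (α : ℝ) (η : Fin N → ℕ) (τ : Equiv.Perm (Fin N)) :
    ∑ i, bar α (η ∘ τ) i ^ 2 = ∑ i, bar α η i ^ 2 :=
  sum_coleg_comp_perm (fun a c => (α * a - c : ℝ) ^ 2) η τ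

/-! ### Raising a composition -/

/-- The raised composition `(η_2, …, η_N, η_1 + 1)`. -/
def raise {n : ℕ} (η : Fin (n + 1) → ℕ) : Fin (n + 1) → ℕ :=
  fun i => η (finRotate (n + 1) i) + if i = Fin.last n then 1 else 0

theorem rotate_val {n : ℕ} (i : Fin (n + 1)) :
    ((finRotate (n + 1) i : Fin (n + 1)) : ℕ) = if i = Fin.last n then 0 else (i : ℕ) + 1 :=
  coe_finRotate i

theorem beats_raise {n : ℕ} (η : Fin (n + 1) → ℕ) (a b : Fin (n + 1)) :
    Beats (raise η) a b ↔ Beats η (finRotate (n + 1) a) (finRotate (n + 1) b) := by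
  by_cases hab : a = b
  · subst hab; simp [Beats.irrefl]
  unfold Beats raise
  rw [Fin.lt_def, Fin.lt_def, rotate_val, rotate_val]
  have ha := a.isLt
  have hb := b.isLt
  simp only [Fin.ext_iff, Fin.val_last] at *
  split_ifs <;> omega

theorem bar_raise {n : ℕ} (α : ℝ) (η : Fin (n + 1) → ℕ) (i : Fin (n + 1)) :
    bar α (raise η) i =
      bar α η (finRotate (n + 1) i) + if i = Fin.last n then α else 0 := by
  unfold bar
  rw [coleg_comp_of_beats _ (beats_raise η)]
  unfold raise
  split_ifs <;> push_cast <;> ring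

/-! ### Partitions -/

theorem exists_antitone_perm (η : Fin N → ℕ) :
    ∃ τ : Equiv.Perm (Fin N), plus η = η ∘ τ :=
  ⟨Fin.revPerm.trans (Tuple.sort η), rfl⟩

theorem plus_antitone (η : Fin N → ℕ) : Antitone (plus η) := fun _ _ hab =>
  Tuple.monotone_sort η (Fin.rev_le_rev.mpr hab)

theorem antitone_eq_of_perm {κ μ : Fin N → ℕ} (hκ : Antitone κ) (hμ : Antitone μ)
    (τ : Equiv.Perm (Fin N)) (hp : μ = κ ∘ τ) : μ = κ := by
  have h₁ : Monotone (κ ∘ Fin.revPerm) := fun a b hab => hκ (Fin.rev_le_rev.mpr hab)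
  have h₂ : Monotone (κ ∘ (Fin.revPerm.trans τ)) := fun a b hab => by
    have := hμ (Fin.rev_le_rev.mpr hab)
    rw [hp] at this
    exact this
  have h₃ := Tuple.unique_monotone h₁ h₂
  funext i
  have h₄ := congrFun h₃ (Fin.rev i)
  simp at h₄
  rw [hp, h₄]; simp

theorem beats_antitone {κ : Fin N → ℕ} (hκ : Antitone κ) (a b : Fin N) : Beats κ a b ↔ a < b := by
  unfold Beats
  constructor
  · rintro (h₁ | h₁)
    · by_contra hn
      exact absurd (hκ (not_lt.mp hn)) (not_le.mpr h₁)
    · exact h₁.2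
  · intro hab
    have := hκ hab.le
    omega

theorem coleg_antitone {κ : Fin N → ℕ} (hκ : Antitone κ) (i : Fin N) : coleg κ i = i := by
  rw [coleg_eq]
  simp_rw [beats_antitone hκ]
  have : (univ.filter fun k : Fin N => k < i) = Iio i := by ext; simp
  rw [this, Fin.card_Iio]

/-! ### Majorization -/

/-- `ν⁺ ≤ μ⁺` in the dominance order, in terms of the sums of the truncations `(ν_i - t)₊`. -/
def Maj (ν μ : Fin N → ℕ) : Prop :=
  ∑ i, ν i = ∑ i, μ i ∧ ∀ t, ∑ i, (ν i - t) ≤ ∑ i, (μ i - t)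

theorem Maj.trans {ν μ κ : Fin N → ℕ} (h₁ : Maj ν μ) (h₂ : Maj μ κ) : Maj ν κ :=
  ⟨h₁.1.trans h₂.1, fun t => (h₁.2 t).trans (h₂.2 t)⟩

theorem Maj.comp_perm (ν : Fin N → ℕ) (τ : Equiv.Perm (Fin N)) : Maj (ν ∘ τ) ν :=
  ⟨Equiv.sum_comp τ ν, fun t => (Equiv.sum_comp τ fun i => ν i - t).le⟩

/-- The rank of a composition: it decreases under squeezing two parts and under moving a larger part
to a later row. -/
def rank (ν : Fin N → ℕ) : ℕ ×ₗ ℕ := toLex (∑ i, ν i ^ 2, ∑ i, (i.rev : ℕ) * ν i)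

/-- The triangularity order on compositions. -/
def Below (ν μ : Fin N → ℕ) : Prop := Maj ν μ ∧ rank ν < rank μ

theorem Below.trans {ν μ κ : Fin N → ℕ} (h₁ : Below ν μ) (h₂ : Below μ κ) : Below ν κ :=
  ⟨h₁.1.trans h₂.1, h₁.2.trans h₂.2⟩

theorem rank_lt_iff (ν μ : Fin N → ℕ) : rank ν < rank μ ↔
    ∑ i, ν i ^ 2 < ∑ i, μ i ^ 2 ∨
      (∑ i, ν i ^ 2 = ∑ i, μ i ^ 2 ∧ ∑ i, (i.rev : ℕ) * ν i < ∑ i, (i.rev : ℕ) * μ i) := by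
  unfold rank
  rw [Prod.Lex.toLex_lt_toLex]

theorem not_below_antitone {κ : Fin N → ℕ} (hκ : Antitone κ) (τ : Equiv.Perm (Fin N)) :
    ¬ Below κ (κ ∘ τ) := by
  rintro ⟨_, h₁⟩
  rw [rank_lt_iff] at h₁
  have h₂ : ∑ i, (κ ∘ τ) i ^ 2 = ∑ i, κ i ^ 2 := Equiv.sum_comp τ fun i => κ i ^ 2
  rcases h₁ with h₁ | h₁
  · omega
  · have : Monovary (fun i : Fin N => (i.rev : ℕ)) κ := by
      intro a b hab
      have : b < a := by
        by_contra hn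
        exact absurd (hκ (not_lt.mp hn)) (not_le.mpr hab)
      exact Fin.le_def.mp (Fin.rev_le_rev.mpr this.le)
    exact absurd (this.sum_mul_comp_perm_le_sum_mul (σ := τ)) (not_le.mpr h₁.2)

theorem not_below_monotone {η : Fin N → ℕ} (hη : Monotone η) (τ : Equiv.Perm (Fin N)) :
    ¬ Below (η ∘ τ) η := by
  rintro ⟨_, h₁⟩
  rw [rank_lt_iff] at h₁
  have h₂ : ∑ i, (η ∘ τ) i ^ 2 = ∑ i, η i ^ 2 := Equiv.sum_comp τ fun i => η i ^ 2
  rcases h₁ with h₁ | h₁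
  · omega
  · have : Antivary (fun i : Fin N => (i.rev : ℕ)) η := by
      intro a b hab
      have : a < b := by
        by_contra hn
        exact absurd (hη (not_lt.mp hn)) (not_le.mpr hab)
      exact Fin.le_def.mp (Fin.rev_le_rev.mpr this.le)
    exact absurd (this.sum_mul_le_sum_mul_comp_perm (σ := τ)) (not_le.mpr h₁.2)

theorem sum_split_pair {M : Type*} [AddCommMonoid M] {i p : Fin N} (hip : i ≠ p) (f : Fin N → M) :
    ∑ a, f a = f i + f p + ∑ a ∈ (univ.erase i).erase p, f a := by
  rw [← add_sum_erase univ f (mem_univ i),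
    ← add_sum_erase (univ.erase i) f (mem_erase.mpr ⟨hip.symm, mem_univ p⟩), add_assoc]

/-- Replace the values of `η` at `i` and `p` by `a` and `b`. -/
def setPair (η : Fin N → ℕ) (i p : Fin N) (a b : ℕ) : Fin N → ℕ :=
  Function.update (Function.update η i a) p b

theorem setPair_right (η : Fin N → ℕ) (i p : Fin N) (a b : ℕ) : setPair η i p a b p = b := by
  simp [setPair]

theorem setPair_left (η : Fin N → ℕ) {i p : Fin N} (hip : i ≠ p) (a b : ℕ) :
    setPair η i p a b i = a := by
  simp [setPair, hip]

theorem setPair_of_ne (η : Fin N → ℕ) {i p q : Fin N} (h₁ : q ≠ i) (h₂ : q ≠ p) (a b : ℕ) :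
    setPair η i p a b q = η q := by
  simp [setPair, h₁, h₂]

theorem sum_setPair {M : Type*} [AddCommMonoid M] (F : Fin N → ℕ → M) (η : Fin N → ℕ)
    {i p : Fin N} (hip : i ≠ p) (a b : ℕ) :
    ∑ q, F q (setPair η i p a b q) =
      F i a + F p b + ∑ q ∈ (univ.erase i).erase p, F q (η q) := by
  rw [sum_split_pair hip, setPair_left η hip, setPair_right]
  congr 1
  refine sum_congr rfl fun q hq => ?_
  simp only [mem_erase, mem_univ, and_true] at hq
  rw [setPair_of_ne η hq.2 hq.1]

theorem setPair_self (η : Fin N → ℕ) (i p : Fin N) : setPair η i p (η i) (η p) = η := by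
  simp [setPair]

theorem setPair_swap (η : Fin N → ℕ) {i p : Fin N} (hip : i ≠ p) :
    setPair η i p (η p) (η i) = η ∘ Equiv.swap i p := by
  funext q
  by_cases h₁ : q = i
  · subst h₁; simp [setPair_left η hip]
  by_cases h₂ : q = p
  · subst h₂; simp [setPair_right]
  rw [setPair_of_ne η h₁ h₂, Function.comp, Equiv.swap_apply_of_ne_of_ne h₁ h₂]

/-- Squeezing two parts together lowers a composition. -/
theorem below_setPair_of_squeeze {η : Fin N → ℕ} {i p : Fin N} (hip : i ≠ p) {a b : ℕ}
    (hsum : a + b = η i + η p) (ha₁ : min (η i) (η p) < a) (ha₂ : a < max (η i) (η p)) :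
    Below (setPair η i p a b) η := by
  refine ⟨⟨?_, fun t => ?_⟩, ?_⟩
  · rw [sum_setPair (fun _ x => x) η hip, sum_split_pair hip η, hsum]
  · rw [sum_setPair (fun _ x => x - t) η hip, sum_split_pair hip fun q => η q - t]
    omega
  · rw [rank_lt_iff]
    left
    rw [sum_setPair (fun _ x => x ^ 2) η hip, sum_split_pair hip fun q => η q ^ 2]
    have : a ^ 2 + b ^ 2 < η i ^ 2 + η p ^ 2 := by
      zify at *
      rcases le_total (η i : ℤ) (η p) with h₁ | h₁
      · simp only [h₁, min_eq_left, max_eq_right] at *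
        nlinarith
      · simp only [h₁, min_eq_right, max_eq_left] at *
        nlinarith
    omega

/-- Moving the larger of two parts to the later row lowers a composition. -/
theorem below_swap {η : Fin N → ℕ} {i p : Fin N} (hip : i < p) (hη : η p < η i) :
    Below (η ∘ Equiv.swap i p) η := by
  refine ⟨Maj.comp_perm _ _, ?_⟩
  rw [rank_lt_iff]
  right
  refine ⟨Equiv.sum_comp (Equiv.swap i p) fun q => η q ^ 2, ?_⟩
  rw [← setPair_swap η hip.ne, sum_setPair (fun q x => (q.rev : ℕ) * x) η hip.ne,
    sum_split_pair hip.ne fun q => (q.rev : ℕ) * η q]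
  have h₁ : (p.rev : ℕ) < i.rev := Fin.lt_def.mp (Fin.rev_lt_rev.mpr hip)
  have : (i.rev : ℕ) * η p + p.rev * η i < i.rev * η i + p.rev * η p := by
    zify at *
    nlinarith
  omega

/-! ### The dominance order -/

theorem sum_mul_nonneg_of_antitone_of_nonneg {n : ℕ} (w δ : Fin n → ℝ) (hw : Antitone w)
    (hw₀ : ∀ i, 0 ≤ w i) (hδ : ∀ p, 0 ≤ ∑ i ∈ Iic p, δ i) : 0 ≤ ∑ i, w i * δ i := by
  induction n with
  | zero => simp
  | succ n ih =>
    have h₁ : ∑ i, w i * δ i =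
        ∑ i : Fin n, (w i.castSucc - w (Fin.last n)) * δ i.castSucc +
          w (Fin.last n) * ∑ i, δ i := by
      rw [Fin.sum_univ_castSucc, Fin.sum_univ_castSucc (f := δ), mul_add, mul_sum]
      simp only [sub_mul, sum_sub_distrib]
      ring
    rw [h₁]
    refine add_nonneg (ih _ _ ?_ ?_ ?_) (mul_nonneg (hw₀ _) ?_)
    · intro a b hab
      exact sub_le_sub_right (hw (Fin.castSucc_le_castSucc_iff.mpr hab)) _
    · intro i
      exact sub_nonneg.mpr (hw (Fin.le_last _))
    · intro p
      have := hδ p.castSucc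
      rwa [← Fin.map_castSuccEmb_Iic, sum_map] at this
    · have := hδ (Fin.last n)
      rwa [← Fin.top_eq_last, Iic_top] at this

/-- Summation by parts for an antitone weight. -/
theorem sum_mul_nonneg_of_antitone {n : ℕ} (w δ : Fin n → ℝ) (hw : Antitone w)
    (hδ : ∀ p, 0 ≤ ∑ i ∈ Iic p, δ i) (hδ₀ : ∑ i, δ i = 0) : 0 ≤ ∑ i, w i * δ i := by
  cases n with
  | zero => simp
  | succ n =>
    have h₁ := sum_mul_nonneg_of_antitone_of_nonneg (fun i => w i - w (Fin.last n)) δ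
      (fun a b hab => sub_le_sub_right (hw hab) _)
      (fun i => sub_nonneg.mpr (hw (Fin.le_last _))) hδ
    simp only [sub_mul, sum_sub_distrib, ← mul_sum, hδ₀, mul_zero, sub_zero] at h₁
    exact h₁

theorem DominatedBy.sum_mul_nonneg {μ κ : Fin N → ℕ} (hd : DominatedBy μ κ) (w : Fin N → ℝ)
    (hw : Antitone w) : 0 ≤ ∑ i, w i * ((κ i : ℝ) - μ i) := by
  refine sum_mul_nonneg_of_antitone w _ hw (fun p => ?_) ?_
  · rw [sum_sub_distrib, sub_nonneg]
    exact_mod_cast hd.2.1 p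
  · rw [sum_sub_distrib, sub_eq_zero]
    exact_mod_cast hd.1.symm

theorem DominatedBy.sum_sq_lt {μ κ : Fin N → ℕ} (hμ : Antitone μ) (hd : DominatedBy μ κ) :
    ∑ i, (μ i : ℝ) ^ 2 < ∑ i, (κ i : ℝ) ^ 2 := by
  have h₁ := hd.sum_mul_nonneg (fun i => (μ i : ℝ)) (fun a b hab => Nat.cast_le.mpr (hμ hab))
  have h₂ : 0 < ∑ i, ((κ i : ℝ) - μ i) ^ 2 := by
    obtain ⟨i, hi⟩ := Function.ne_iff.mp hd.2.2
    refine sum_pos' (fun _ _ => sq_nonneg _) ⟨i, mem_univ _, ?_⟩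
    have : (κ i : ℝ) - μ i ≠ 0 := sub_ne_zero.mpr (by exact_mod_cast hi.symm)
    positivity
  have h₃ : ∑ i, (κ i : ℝ) ^ 2 - ∑ i, (μ i : ℝ) ^ 2 =
      ∑ i, ((κ i : ℝ) - μ i) ^ 2 + 2 * ∑ i, (μ i : ℝ) * ((κ i : ℝ) - μ i) := by
    rw [mul_sum, ← sum_sub_distrib, ← sum_add_distrib]
    exact sum_congr rfl fun i _ => by ring
  linarith

theorem DominatedBy.sum_bar_sq_lt {α : ℝ} (hα : 0 < α) {μ κ : Fin N → ℕ} (hμ : Antitone μ)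
    (hκ : Antitone κ) (hd : DominatedBy μ κ) :
    ∑ i, bar α μ i ^ 2 < ∑ i, bar α κ i ^ 2 := by
  have h₁ := hd.sum_mul_nonneg (fun i => -((i : ℕ) : ℝ))
    (fun a b hab => neg_le_neg (by exact_mod_cast hab))
  have h₂ := hd.sum_sq_lt hμ
  have h₃ : ∑ i, bar α κ i ^ 2 - ∑ i, bar α μ i ^ 2 =
      α ^ 2 * (∑ i, (κ i : ℝ) ^ 2 - ∑ i, (μ i : ℝ) ^ 2) +
        2 * α * ∑ i : Fin N, -((i : ℕ) : ℝ) * ((κ i : ℝ) - μ i) := by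
    rw [mul_sum, mul_sub, mul_sum, mul_sum, ← sum_sub_distrib, ← sum_sub_distrib,
      ← sum_add_distrib]
    refine sum_congr rfl fun i _ => ?_
    rw [bar, bar, coleg_antitone hμ, coleg_antitone hκ]; ring
  have h₄ : 0 < α ^ 2 * (∑ i, (κ i : ℝ) ^ 2 - ∑ i, (μ i : ℝ) ^ 2) :=
    mul_pos (by positivity) (by linarith)
  have h₅ := mul_nonneg (by positivity : 0 ≤ 2 * α) h₁
  linarith

theorem Maj.dominatedBy {μ κ : Fin N → ℕ} (hκ : Antitone κ) (hm : Maj μ κ) (hne : μ ≠ κ) :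
    DominatedBy μ κ := by
  refine ⟨hm.1, fun p => ?_, hne⟩
  have h₁ : ∑ i ∈ Iic p, μ i ≤ ∑ i ∈ Iic p, ((μ i - κ p) + κ p) :=
    sum_le_sum fun i _ => by omega
  have h₂ : ∑ i ∈ Iic p, (μ i - κ p) ≤ ∑ i, (μ i - κ p) :=
    sum_le_sum_of_subset (subset_univ _)
  have h₃ : ∑ i, (κ i - κ p) = ∑ i ∈ Iic p, (κ i - κ p) := by
    symm
    refine sum_subset (subset_univ _) fun i _ hi => ?_
    have := hκ (not_le.mp (by simpa using hi)).le
    omega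
  have h₄ : ∑ i ∈ Iic p, κ i = ∑ i ∈ Iic p, ((κ i - κ p) + κ p) :=
    sum_congr rfl fun i hi => by
      have := hκ (mem_Iic.mp hi)
      omega
  rw [sum_add_distrib] at h₁ h₄
  have := hm.2 (κ p)
  omega

/-! ### Induction over compositions -/

/-- Every composition arises from `0` by raising and by moving larger parts to earlier rows. -/
theorem composition_induction {n : ℕ} {Q : (Fin (n + 1) → ℕ) → Prop} (h₀ : Q 0)
    (h₁ : ∀ η, Q η → Q (raise η))
    (h₂ : ∀ (η : Fin (n + 1) → ℕ) (i j : Fin (n + 1)), (i : ℕ) + 1 = j → η i < η j → Q η →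
      Q (η ∘ Equiv.swap i j)) (η : Fin (n + 1) → ℕ) : Q η := by
  obtain ⟨m, hm⟩ : ∃ m, ∑ i, η i = m := ⟨_, rfl⟩
  induction m using Nat.strong_induction_on generalizing η with
  | _ m ih =>
  obtain ⟨w, hw⟩ : ∃ w, ∑ i, (i.rev : ℕ) * η i = w := ⟨_, rfl⟩
  induction w using Nat.strong_induction_on generalizing η with
  | _ w ihw =>
  by_cases hlast : η (Fin.last n) = 0
  · by_cases hz : ∀ i j : Fin (n + 1), (i : ℕ) + 1 = j → η i ≤ η j
    · have hmono : Monotone η := Fin.monotone_iff_le_succ.mpr fun i => hz _ _ (by simp)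
      have : η = 0 := by
        funext i
        have := hmono (Fin.le_last i)
        simp only [Pi.zero_apply]; omega
      rwa [this]
    · push Not at hz
      obtain ⟨i, j, hij, hlt⟩ := hz
      have hlt' : i < j := Fin.lt_def.mpr (by omega)
      obtain ⟨_, hb⟩ := below_swap hlt' hlt
      rw [rank_lt_iff] at hb
      have hsq : ∑ a, (η ∘ Equiv.swap i j) a ^ 2 = ∑ a, η a ^ 2 :=
        Equiv.sum_comp (Equiv.swap i j) fun q => η q ^ 2
      have hQ := ihw (∑ a, (a.rev : ℕ) * (η ∘ Equiv.swap i j) a) (by omega)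
        (η ∘ Equiv.swap i j) ((Equiv.sum_comp (Equiv.swap i j) η).trans hm) rfl
      have := h₂ _ i j hij (by simpa using hlt) hQ
      rwa [Function.comp_assoc, ← Equiv.coe_trans, Equiv.swap_swap] at this
  · set ν : Fin (n + 1) → ℕ := fun i =>
      η ((finRotate (n + 1)).symm i) - if (finRotate (n + 1)).symm i = Fin.last n then 1 else 0
      with hν
    have hr : raise ν = η := by
      funext i
      simp only [raise, hν, Equiv.symm_apply_apply]
      split_ifs with h₃
      · subst h₃; omega
      · omega
    rw [← hr]
    refine h₁ _ (ih (∑ i, ν i) ?_ ν rfl)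
    rw [← hm, ← hr]
    simp only [raise, sum_add_distrib]
    rw [Equiv.sum_comp (finRotate (n + 1)) ν]
    simp

end JackTorus

end

noncomputable section

namespace JackTorus

open Finset MvPolynomial

variable {N : ℕ}

/-! ### Monomials and coefficients -/

/-- The monomial `z^η`. -/
def mon (η : Fin N → ℕ) : MvPolynomial (Fin N) ℂ :=
  monomial (Finsupp.equivFunOnFinite.symm η) 1

/-- The coefficient of `z^ν`. -/
def co (ν : Fin N → ℕ) : MvPolynomial (Fin N) ℂ →ₗ[ℂ] ℂ where
  toFun f := coeff (Finsupp.equivFunOnFinite.symm ν) f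
  map_add' f g := coeff_add _ f g
  map_smul' c f := coeff_smul _ c f

theorem co_mon (ν η : Fin N → ℕ) : co ν (mon η) = if η = ν then 1 else 0 := by
  show coeff _ (monomial _ _) = _
  rw [coeff_monomial]
  simp

theorem eq_sum_mon (f : MvPolynomial (Fin N) ℂ) :
    f = ∑ m ∈ f.support, co (Finsupp.equivFunOnFinite m) f • mon (Finsupp.equivFunOnFinite m) := by
  conv_lhs => rw [f.as_sum]
  refine sum_congr rfl fun m _ => ?_
  simp [co, mon, smul_monomial]

theorem eq_zero_of_co {f : MvPolynomial (Fin N) ℂ} (hf : ∀ ν, co ν f = 0) : f = 0 := by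
  rw [eq_sum_mon f]
  exact sum_eq_zero fun m _ => by rw [hf, zero_smul]

/-- To prove that linear maps agree it suffices to check monomials. -/
theorem linearMap_ext_mon {M : Type*} [AddCommMonoid M] [Module ℂ M]
    {S T : MvPolynomial (Fin N) ℂ →ₗ[ℂ] M} (hST : ∀ η, S (mon η) = T (mon η)) : S = T := by
  refine LinearMap.ext fun f => ?_
  rw [eq_sum_mon f]
  simp only [map_sum, map_smul, hST]

theorem X_mul_mon (i : Fin N) (η : Fin N → ℕ) :
    X i * mon η = mon (Function.update η i (η i + 1)) := by
  rw [mon, mon, X, monomial_mul, one_mul]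
  congr 2
  ext a
  by_cases ha : a = i
  · subst ha; simp [add_comm]
  · simp [ha]

theorem rename_mon (τ : Equiv.Perm (Fin N)) (η : Fin N → ℕ) :
    rename τ (mon η) = mon (η ∘ τ.symm) := by
  have h₁ : Finsupp.mapDomain τ (Finsupp.equivFunOnFinite.symm η) =
      Finsupp.equivFunOnFinite.symm (η ∘ τ.symm) := by
    refine Finsupp.ext fun a => ?_
    obtain ⟨b, rfl⟩ := τ.surjective a
    rw [Finsupp.mapDomain_apply τ.injective]
    simp
  rw [mon, mon, rename_monomial, h₁]

theorem co_rename (τ : Equiv.Perm (Fin N)) (ν : Fin N → ℕ) (f : MvPolynomial (Fin N) ℂ) :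
    co ν (rename τ f) = co (ν ∘ τ) f := by
  have : (co ν) ∘ₗ (rename (R := ℂ) τ).toLinearMap = co (ν ∘ τ) := by
    refine linearMap_ext_mon fun η => ?_
    simp only [LinearMap.comp_apply, AlgHom.toLinearMap_apply, rename_mon, co_mon]
    congr 1
    rw [eq_iff_iff]
    constructor
    · rintro rfl; funext a; simp
    · rintro rfl; funext a; simp
  exact LinearMap.congr_fun this f

/-! ### Divided differences -/

theorem exists_divided_difference (i p : Fin N) (f : MvPolynomial (Fin N) ℂ) :
    ∃ q, (X i - X p) * q = f - rename (Equiv.swap i p) f := by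
  induction f using MvPolynomial.induction_on with
  | C a => exact ⟨0, by simp⟩
  | add f g hf hg =>
    obtain ⟨a, ha⟩ := hf
    obtain ⟨b, hb⟩ := hg
    exact ⟨a + b, by rw [mul_add, ha, hb, map_add]; ring⟩
  | mul_X f k hf =>
    obtain ⟨a, ha⟩ := hf
    obtain ⟨c, hc⟩ : ∃ c : MvPolynomial (Fin N) ℂ,
        (X i - X p) * c = X k - X (Equiv.swap i p k) := by
      by_cases h₁ : k = i
      · subst h₁; exact ⟨1, by simp⟩
      by_cases h₂ : k = p
      · subst h₂; exact ⟨-1, by simp⟩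
      exact ⟨0, by simp [Equiv.swap_apply_of_ne_of_ne h₁ h₂]⟩
    refine ⟨a * X k + rename (Equiv.swap i p) f * c, ?_⟩
    rw [map_mul, rename_X]
    linear_combination X k * ha + rename (Equiv.swap i p) f * hc

theorem X_sub_X_ne_zero {i p : Fin N} (hip : i ≠ p) :
    (X i - X p : MvPolynomial (Fin N) ℂ) ≠ 0 :=
  sub_ne_zero.mpr fun hX => hip (X_injective hX)

/-- The divided difference `(f - s_{ip} f) / (z_i - z_p)`. -/
def dd (i p : Fin N) : MvPolynomial (Fin N) ℂ →ₗ[ℂ] MvPolynomial (Fin N) ℂ where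
  toFun f := if i = p then 0 else (exists_divided_difference i p f).choose
  map_add' f g := by
    split_ifs with hip
    · simp
    · apply mul_left_cancel₀ (X_sub_X_ne_zero hip)
      rw [mul_add, (exists_divided_difference i p f).choose_spec,
        (exists_divided_difference i p g).choose_spec,
        (exists_divided_difference i p (f + g)).choose_spec, map_add]
      ring
  map_smul' c f := by
    split_ifs with hip
    · simp
    · apply mul_left_cancel₀ (X_sub_X_ne_zero hip)
      rw [RingHom.id_apply, mul_smul_comm, (exists_divided_difference i p f).choose_spec,
        (exists_divided_difference i p (c • f)).choose_spec, map_smul, smul_sub]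

theorem X_sub_X_mul_dd (i p : Fin N) (f : MvPolynomial (Fin N) ℂ) :
    (X i - X p) * dd i p f = f - rename (Equiv.swap i p) f := by
  by_cases hip : i = p
  · subst hip; simp
  · show _ * (if i = p then _ else _) = _
    rw [if_neg hip]
    exact (exists_divided_difference i p f).choose_spec

theorem dd_eq_of_mul_eq {i p : Fin N} (hip : i ≠ p) {f q : MvPolynomial (Fin N) ℂ}
    (hq : (X i - X p) * q = f - rename (Equiv.swap i p) f) : dd i p f = q :=
  mul_left_cancel₀ (X_sub_X_ne_zero hip) ((X_sub_X_mul_dd i p f).trans hq.symm)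

theorem rename_dd (τ : Equiv.Perm (Fin N)) (i p : Fin N) (f : MvPolynomial (Fin N) ℂ) :
    rename τ (dd i p f) = dd (τ i) (τ p) (rename τ f) := by
  by_cases hip : i = p
  · subst hip; simp [dd]
  · symm
    apply dd_eq_of_mul_eq (fun he => hip (τ.injective he))
    have := congrArg (rename τ) (X_sub_X_mul_dd i p f)
    simp only [map_mul, map_sub, rename_X, rename_rename] at this
    rw [this, rename_rename, ← Equiv.coe_trans, ← Equiv.coe_trans]
    have h₁ : (Equiv.swap i p).trans τ = Equiv.trans τ (Equiv.swap (τ i) (τ p)) :=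
      Equiv.ext fun a => by simp [τ.injective.map_swap]
    rw [h₁]

theorem dd_X_mul_of_ne {i p l : Fin N} (hip : i ≠ p) (h₁ : l ≠ i) (h₂ : l ≠ p)
    (g : MvPolynomial (Fin N) ℂ) : dd i p (X l * g) = X l * dd i p g := by
  apply dd_eq_of_mul_eq hip
  rw [map_mul, rename_X, Equiv.swap_apply_of_ne_of_ne h₁ h₂]
  linear_combination X l * X_sub_X_mul_dd i p g

theorem dd_X_mul_right {i p : Fin N} (hip : i ≠ p) (g : MvPolynomial (Fin N) ℂ) :
    dd i p (X p * g) = X i * dd i p g - g := by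
  apply dd_eq_of_mul_eq hip
  rw [map_mul, rename_X, Equiv.swap_apply_right]
  linear_combination X i * X_sub_X_mul_dd i p g

theorem dd_X_mul_left {i p : Fin N} (hip : i ≠ p) (g : MvPolynomial (Fin N) ℂ) :
    dd i p (X i * g) = X p * dd i p g + g := by
  apply dd_eq_of_mul_eq hip
  rw [map_mul, rename_X, Equiv.swap_apply_left]
  linear_combination X p * X_sub_X_mul_dd i p g

/-- The Euler derivative `z_i ∂_i`. -/
def theta (i : Fin N) : MvPolynomial (Fin N) ℂ →ₗ[ℂ] MvPolynomial (Fin N) ℂ :=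
  LinearMap.mulLeft ℂ (X i) ∘ₗ (pderiv i).toLinearMap

theorem theta_apply (i : Fin N) (f : MvPolynomial (Fin N) ℂ) : theta i f = X i * pderiv i f := rfl

theorem theta_mon (i : Fin N) (η : Fin N → ℕ) : theta i (mon η) = (η i : ℂ) • mon η := by
  rw [theta_apply, mon, X_mul_pderiv_monomial]
  simp [Nat.cast_smul_eq_nsmul]

theorem rename_theta (τ : Equiv.Perm (Fin N)) (i : Fin N) (f : MvPolynomial (Fin N) ℂ) :
    rename τ (theta i f) = theta (τ i) (rename τ f) := by
  rw [theta_apply, theta_apply, map_mul, rename_X, pderiv_rename τ.injective]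

theorem theta_X_mul_of_ne {i l : Fin N} (hil : l ≠ i) (g : MvPolynomial (Fin N) ℂ) :
    theta i (X l * g) = X l * theta i g := by
  rw [theta_apply, theta_apply, Derivation.leibniz, pderiv_X_of_ne hil]
  simp only [smul_eq_mul]; ring

theorem theta_X_mul_self (i : Fin N) (g : MvPolynomial (Fin N) ℂ) :
    theta i (X i * g) = X i * theta i g + X i * g := by
  rw [theta_apply, theta_apply, Derivation.leibniz, pderiv_X_self]
  simp only [smul_eq_mul]; ring

/-! ### The Cherednik operators -/

/-- The Cherednik operator
`ξ_i = α z_i ∂_i + ∑_{p ≠ i} z_{max(i, p)} (1 - s_{ip}) / (z_i - z_p) - i` (with `i` counted from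
`0`). -/
def xi (α : ℝ) (i : Fin N) : MvPolynomial (Fin N) ℂ →ₗ[ℂ] MvPolynomial (Fin N) ℂ :=
  (α : ℂ) • theta i + ∑ p ∈ univ.erase i, LinearMap.mulLeft ℂ (X (max i p)) ∘ₗ dd i p -
    ((i : ℕ) : ℂ) • LinearMap.id

theorem xi_apply (α : ℝ) (i : Fin N) (f : MvPolynomial (Fin N) ℂ) :
    xi α i f = (α : ℂ) • theta i f + ∑ p ∈ univ.erase i, X (max i p) * dd i p f -
      ((i : ℕ) : ℂ) • f := by
  simp [xi, LinearMap.sum_apply]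

theorem rename_xi (α : ℝ) (τ : Equiv.Perm (Fin N)) (i : Fin N) (f : MvPolynomial (Fin N) ℂ) :
    rename τ (xi α i f) = (α : ℂ) • theta (τ i) (rename τ f) +
      ∑ q ∈ univ.erase (τ i), X (τ (max i (τ.symm q))) * dd (τ i) q (rename τ f) -
        ((i : ℕ) : ℂ) • rename τ f := by
  rw [xi_apply, map_sub, map_add, map_smul, map_smul, map_sum, rename_theta]
  congr 2
  refine sum_bij' (fun p _ => τ p) (fun q _ => τ.symm q) ?_ ?_ ?_ ?_ ?_
  · intro p hp; simpa using hp
  · intro q hq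
    simp only [mem_erase, mem_univ, and_true] at hq ⊢
    rintro rfl; simp at hq
  · simp
  · simp
  · intro p _
    simp [rename_dd]

theorem swap_max_of_ne {i j m : Fin N} (hij : (i : ℕ) + 1 = j) (h₁ : m ≠ i) (h₂ : m ≠ j)
    (q : Fin N) : Equiv.swap i j (max m (Equiv.swap i j q)) = max m q := by
  have h₃ : (m < i ∧ m < j) ∨ (i < m ∧ j < m) := by
    simp only [Fin.lt_def, ne_eq, Fin.ext_iff] at *; omega
  by_cases hi : q = i
  · subst hi
    rw [Equiv.swap_apply_left]
    rcases h₃ with h₃ | h₃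
    · rw [max_eq_right h₃.1.le, max_eq_right h₃.2.le, Equiv.swap_apply_right]
    · rw [max_eq_left h₃.1.le, max_eq_left h₃.2.le, Equiv.swap_apply_of_ne_of_ne h₁ h₂]
  by_cases hj : q = j
  · subst hj
    rw [Equiv.swap_apply_right]
    rcases h₃ with h₃ | h₃
    · rw [max_eq_right h₃.1.le, max_eq_right h₃.2.le, Equiv.swap_apply_left]
    · rw [max_eq_left h₃.1.le, max_eq_left h₃.2.le, Equiv.swap_apply_of_ne_of_ne h₁ h₂]
  rw [Equiv.swap_apply_of_ne_of_ne hi hj]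
  rcases max_choice m q with h₄ | h₄ <;> rw [h₄]
  · exact Equiv.swap_apply_of_ne_of_ne h₁ h₂
  · exact Equiv.swap_apply_of_ne_of_ne hi hj

theorem swap_max_left {i j q : Fin N} (hij : (i : ℕ) + 1 = j) (h₁ : q ≠ i) (h₂ : q ≠ j) :
    Equiv.swap i j (max i q) = max j q := by
  have := swap_max_of_ne hij h₁ h₂ j
  rwa [Equiv.swap_apply_right, max_comm q i, max_comm q j] at this

theorem rename_swap_xi_of_ne (α : ℝ) {i j m : Fin N} (hij : (i : ℕ) + 1 = j) (h₁ : m ≠ i)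
    (h₂ : m ≠ j) (f : MvPolynomial (Fin N) ℂ) :
    rename (Equiv.swap i j) (xi α m f) = xi α m (rename (Equiv.swap i j) f) := by
  rw [rename_xi, xi_apply, Equiv.swap_apply_of_ne_of_ne h₁ h₂]
  congr 2
  refine sum_congr rfl fun q _ => ?_
  congr 2
  rw [Equiv.symm_swap, swap_max_of_ne hij h₁ h₂]

theorem rename_swap_xi_left (α : ℝ) {i j : Fin N} (hij : (i : ℕ) + 1 = j)
    (f : MvPolynomial (Fin N) ℂ) :
    rename (Equiv.swap i j) (xi α i f) = xi α j (rename (Equiv.swap i j) f) + f := by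
  have hne : i ≠ j := by rintro rfl; omega
  have hlt : i < j := Fin.lt_def.mpr (by omega)
  set g := rename (Equiv.swap i j) f with hg
  have hf : f = rename (Equiv.swap j i) g := by
    rw [hg, rename_rename, ← Equiv.coe_trans, Equiv.swap_comm j i, Equiv.swap_swap]; simp
  have hmem : i ∈ univ.erase j := by simp [hne]
  rw [rename_xi, xi_apply, Equiv.swap_apply_left, ← add_sum_erase _ _ hmem,
    ← add_sum_erase _ _ hmem]
  have hrest : ∑ q ∈ (univ.erase j).erase i,
      X ((Equiv.swap i j) (max i ((Equiv.swap i j).symm q))) * dd j q g =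
      ∑ q ∈ (univ.erase j).erase i, X (max j q) * dd j q g := by
    refine sum_congr rfl fun q hq => ?_
    simp only [mem_erase, mem_univ, and_true] at hq
    rw [Equiv.symm_swap, Equiv.swap_apply_of_ne_of_ne hq.1 hq.2,
      swap_max_left hij hq.1 hq.2]
  rw [hrest, Equiv.symm_swap, Equiv.swap_apply_left, max_eq_right hlt.le, Equiv.swap_apply_right,
    max_eq_left hlt.le]
  have hd := X_sub_X_mul_dd j i g
  rw [← hf] at hd
  have hj : ((j : ℕ) : ℂ) = (i : ℕ) + 1 := by exact_mod_cast hij.symm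
  simp only [hj, add_smul, one_smul]
  linear_combination -hd

theorem rename_swap_xi_right (α : ℝ) {i j : Fin N} (hij : (i : ℕ) + 1 = j)
    (f : MvPolynomial (Fin N) ℂ) :
    rename (Equiv.swap i j) (xi α j f) = xi α i (rename (Equiv.swap i j) f) - f := by
  have hinv : ∀ g : MvPolynomial (Fin N) ℂ,
      rename (Equiv.swap i j) (rename (Equiv.swap i j) g) = g := fun g => by
    rw [rename_rename, ← Equiv.coe_trans, Equiv.swap_swap]; simp
  have h₁ := congrArg (rename (Equiv.swap i j))
    (rename_swap_xi_left α hij (rename (Equiv.swap i j) f))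
  simp only [map_add, hinv] at h₁
  rw [h₁]; ring

/-- The raising operator `f ↦ z_N f(z_N, z_1, …, z_{N-1})`. -/
def raiseOp {n : ℕ} (f : MvPolynomial (Fin (n + 1)) ℂ) : MvPolynomial (Fin (n + 1)) ℂ :=
  X (Fin.last n) * rename (finRotate (n + 1)).symm f

theorem raiseOp_mon {n : ℕ} (η : Fin (n + 1) → ℕ) : raiseOp (mon η) = mon (raise η) := by
  rw [raiseOp, rename_mon, X_mul_mon]
  congr 1
  funext a
  unfold raise
  by_cases ha : a = Fin.last n
  · subst ha; simp
  · simp [ha]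

theorem co_raise {n : ℕ} (η : Fin (n + 1) → ℕ) (f : MvPolynomial (Fin (n + 1)) ℂ) :
    co (raise η) (raiseOp f) = co η f := by
  have : (co (raise η)) ∘ₗ LinearMap.mulLeft ℂ (X (Fin.last n)) ∘ₗ
      (rename (R := ℂ) (finRotate (n + 1)).symm).toLinearMap = co η := by
    refine linearMap_ext_mon fun ν => ?_
    have h₁ := raiseOp_mon ν
    rw [raiseOp] at h₁
    simp only [LinearMap.comp_apply, AlgHom.toLinearMap_apply, LinearMap.mulLeft_apply, h₁, co_mon]
    congr 1
    rw [eq_iff_iff]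
    refine ⟨fun he => ?_, fun he => by rw [he]⟩
    funext a
    have := congrFun he ((finRotate (n + 1)).symm a)
    simpa [raise] using this
  exact LinearMap.congr_fun this f

theorem rotate_symm_max {n : ℕ} {m q : Fin (n + 1)} (hm : m ≠ Fin.last n) :
    (finRotate (n + 1)).symm (max (finRotate (n + 1) m) (finRotate (n + 1) q)) =
      if q = Fin.last n then m else max m q := by
  rw [Equiv.symm_apply_eq]
  have h₁ := rotate_val m
  have h₂ := rotate_val q
  have h₃ := rotate_val (max m q)
  split_ifs with hq
  · rw [if_pos hq] at h₂
    exact max_eq_left (Fin.le_def.mpr (by omega))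
  · rw [if_neg hm] at h₁
    rw [if_neg hq] at h₂
    rcases le_total m q with hmq | hmq
    · rw [max_eq_right hmq]
      exact max_eq_right (Fin.le_def.mpr (by have := Fin.le_def.mp hmq; omega))
    · rw [max_eq_left hmq]
      exact max_eq_left (Fin.le_def.mpr (by have := Fin.le_def.mp hmq; omega))

theorem xi_raiseOp_of_ne {n : ℕ} (α : ℝ) {m : Fin (n + 1)} (hm : m ≠ Fin.last n)
    (f : MvPolynomial (Fin (n + 1)) ℂ) :
    xi α m (raiseOp f) = raiseOp (xi α (finRotate (n + 1) m) f) := by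
  have hmem : Fin.last n ∈ univ.erase m := by simp [Ne.symm hm]
  rw [raiseOp, raiseOp, rename_xi, xi_apply, Equiv.symm_apply_apply]
  set g := rename (finRotate (n + 1)).symm f
  rw [theta_X_mul_of_ne hm.symm, ← add_sum_erase _ _ hmem, ← add_sum_erase _ _ hmem]
  have hrest : ∑ q ∈ (univ.erase m).erase (Fin.last n), X (max m q) * dd m q (X (Fin.last n) * g) =
      X (Fin.last n) * ∑ q ∈ (univ.erase m).erase (Fin.last n),
        X ((finRotate (n + 1)).symm (max (finRotate (n + 1) m)
          ((finRotate (n + 1)).symm.symm q))) * dd m q g := by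
    rw [mul_sum]
    refine sum_congr rfl fun q hq => ?_
    simp only [mem_erase, mem_univ, and_true] at hq
    rw [dd_X_mul_of_ne hq.2.symm hm.symm hq.1.symm, Equiv.symm_symm, rotate_symm_max hm,
      if_neg hq.1]
    ring
  rw [hrest, Equiv.symm_symm, rotate_symm_max hm, if_pos rfl, dd_X_mul_right hm,
    max_eq_right (Fin.le_last m)]
  have h₁ : (((finRotate (n + 1) m : Fin (n + 1)) : ℕ) : ℂ) = (m : ℕ) + 1 := by
    rw [rotate_val, if_neg hm]; push_cast; rfl
  simp only [h₁, add_smul, one_smul, smul_eq_C_mul, mul_sub, mul_add]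
  ring

theorem xi_raiseOp_last {n : ℕ} (α : ℝ) (f : MvPolynomial (Fin (n + 1)) ℂ) :
    xi α (Fin.last n) (raiseOp f) = raiseOp (xi α 0 f) + (α : ℂ) • raiseOp f := by
  have h₀ : (finRotate (n + 1)).symm 0 = Fin.last n := by
    rw [Equiv.symm_apply_eq, finRotate_last]
  rw [raiseOp, raiseOp, rename_xi, xi_apply, h₀]
  set g := rename (finRotate (n + 1)).symm f
  rw [theta_X_mul_self]
  have hrest : ∑ q ∈ univ.erase (Fin.last n),
      X (max (Fin.last n) q) * dd (Fin.last n) q (X (Fin.last n) * g) =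
      X (Fin.last n) * ∑ q ∈ univ.erase (Fin.last n),
        X ((finRotate (n + 1)).symm (max 0 ((finRotate (n + 1)).symm.symm q))) *
          dd (Fin.last n) q g + (n : ℂ) • (X (Fin.last n) * g) := by
    have hc : (n : ℂ) • (X (Fin.last n) * g) =
        ∑ q ∈ univ.erase (Fin.last n), X (Fin.last n) * g := by
      rw [sum_const, card_erase_of_mem (mem_univ _), card_univ, Fintype.card_fin,
        Nat.add_sub_cancel, Nat.cast_smul_eq_nsmul]
    rw [hc, mul_sum, ← sum_add_distrib]
    refine sum_congr rfl fun q hq => ?_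
    simp only [mem_erase, mem_univ, and_true] at hq
    rw [dd_X_mul_left hq.symm, max_eq_left (Fin.le_last q), max_eq_right (Fin.zero_le _),
      Equiv.symm_symm, Equiv.symm_apply_apply]
    ring
  rw [hrest]
  simp only [Fin.val_last, Fin.val_zero, smul_eq_C_mul, mul_sub, mul_add, Nat.cast_zero, map_zero,
    zero_mul]
  ring

/-! ### Triangularity -/

/-- The span of the monomials below `z^μ`. -/
def lowerSpan (μ : Fin N → ℕ) : Submodule ℂ (MvPolynomial (Fin N) ℂ) :=
  Submodule.span ℂ (mon '' {ν | Below ν μ})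

theorem mon_mem_lowerSpan {ν μ : Fin N → ℕ} (hb : Below ν μ) : mon ν ∈ lowerSpan μ :=
  Submodule.subset_span ⟨ν, hb, rfl⟩

theorem co_eq_zero_of_mem_lowerSpan {ν μ : Fin N → ℕ} {f : MvPolynomial (Fin N) ℂ}
    (hf : f ∈ lowerSpan μ) (hb : ¬ Below ν μ) : co ν f = 0 := by
  have : lowerSpan μ ≤ LinearMap.ker (co ν) := by
    refine Submodule.span_le.mpr ?_
    rintro _ ⟨ρ, hρ, rfl⟩
    simp only [SetLike.mem_coe, LinearMap.mem_ker, co_mon]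
    rw [if_neg]
    rintro rfl
    exact hb hρ
  exact this hf

/-- `T` is triangular on monomials, with diagonal `c`. -/
def IsTriangular (T : MvPolynomial (Fin N) ℂ →ₗ[ℂ] MvPolynomial (Fin N) ℂ)
    (c : (Fin N → ℕ) → ℂ) : Prop :=
  ∀ μ, T (mon μ) - c μ • mon μ ∈ lowerSpan μ

theorem IsTriangular.co_apply {T : MvPolynomial (Fin N) ℂ →ₗ[ℂ] MvPolynomial (Fin N) ℂ}
    {c : (Fin N → ℕ) → ℂ} (hT : IsTriangular T c) {f : MvPolynomial (Fin N) ℂ} {ν : Fin N → ℕ}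
    (hν : ∀ μ, co μ f ≠ 0 → ¬ Below ν μ) : co ν (T f) = c ν * co ν f := by
  have key : ∀ μ, co μ f * co ν (T (mon μ)) = c ν * (co μ f * co ν (mon μ)) := by
    intro μ
    by_cases hμ : co μ f = 0
    · simp [hμ]
    · have h₁ := co_eq_zero_of_mem_lowerSpan (hT μ) (hν μ hμ)
      rw [map_sub, map_smul, sub_eq_zero] at h₁
      rw [h₁, co_mon, smul_eq_mul]
      split_ifs with he
      · rw [he]; ring
      · ring
  have h₁ := congrArg (fun g => co ν (T g)) (eq_sum_mon f)
  have h₂ := congrArg (fun g => c ν * co ν g) (eq_sum_mon f)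
  simp only [map_sum, map_smul, smul_eq_mul, mul_sum] at h₁ h₂
  rw [h₁, h₂]
  exact sum_congr rfl fun m _ => key _

theorem IsTriangular.map_lowerSpan {T : MvPolynomial (Fin N) ℂ →ₗ[ℂ] MvPolynomial (Fin N) ℂ}
    {c : (Fin N → ℕ) → ℂ} (hT : IsTriangular T c) {f : MvPolynomial (Fin N) ℂ} {μ : Fin N → ℕ}
    (hf : f ∈ lowerSpan μ) : T f ∈ lowerSpan μ := by
  have : lowerSpan μ ≤ (lowerSpan μ).comap T := by
    conv_lhs => rw [lowerSpan]
    refine Submodule.span_le.mpr ?_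
    rintro _ ⟨ρ, hρ, rfl⟩
    have h₁ : lowerSpan ρ ≤ lowerSpan μ := by
      refine Submodule.span_mono ?_
      rintro _ ⟨π, hπ, rfl⟩
      exact ⟨π, hπ.trans hρ, rfl⟩
    have h₂ := (lowerSpan μ).add_mem (h₁ (hT ρ))
      ((lowerSpan μ).smul_mem (c ρ) (mon_mem_lowerSpan hρ))
    rw [sub_add_cancel] at h₂
    exact h₂
  exact this hf

theorem IsTriangular.comp {S T : MvPolynomial (Fin N) ℂ →ₗ[ℂ] MvPolynomial (Fin N) ℂ}
    {c c' : (Fin N → ℕ) → ℂ} (hS : IsTriangular S c) (hT : IsTriangular T c') :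
    IsTriangular (S ∘ₗ T) fun μ => c μ * c' μ := by
  intro μ
  have h₁ := (lowerSpan μ).add_mem (hS.map_lowerSpan (hT μ))
    ((lowerSpan μ).smul_mem (c' μ) (hS μ))
  have h₂ : S (T (mon μ) - c' μ • mon μ) + c' μ • (S (mon μ) - c μ • mon μ) =
      (S ∘ₗ T) (mon μ) - (c μ * c' μ) • mon μ := by
    rw [map_sub, map_smul, smul_sub, smul_smul, mul_comm (c' μ), LinearMap.comp_apply]
    abel
  rwa [h₂] at h₁

theorem IsTriangular.sum {ι : Type*} (s : Finset ι)
    {T : ι → MvPolynomial (Fin N) ℂ →ₗ[ℂ] MvPolynomial (Fin N) ℂ}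
    {c : ι → (Fin N → ℕ) → ℂ} (hT : ∀ i ∈ s, IsTriangular (T i) (c i)) :
    IsTriangular (∑ i ∈ s, T i) fun μ => ∑ i ∈ s, c i μ := by
  intro μ
  rw [LinearMap.sum_apply, sum_smul, ← sum_sub_distrib]
  exact (lowerSpan μ).sum_mem fun i hi => hT i hi μ

theorem X_left_mul_mon_setPair (η : Fin N → ℕ) {i p : Fin N} (hip : i ≠ p) (a b : ℕ) :
    X i * mon (setPair η i p a b) = mon (setPair η i p (a + 1) b) := by
  rw [X_mul_mon, setPair_left η hip]
  congr 1
  simp only [setPair]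
  rw [Function.update_comm hip, Function.update_idem, Function.update_comm hip.symm]

theorem X_right_mul_mon_setPair (η : Fin N → ℕ) (i p : Fin N) (a b : ℕ) :
    X p * mon (setPair η i p a b) = mon (setPair η i p a (b + 1)) := by
  rw [X_mul_mon, setPair_right]
  congr 1
  simp only [setPair, Function.update_idem]

theorem X_mul_sum_mon_setPair (η : Fin N → ℕ) {i p : Fin N} (hip : i ≠ p) (lo n : ℕ) :
    X i * ∑ t ∈ range n, mon (setPair η i p (lo + t) (lo + n - 1 - t)) =
        ∑ t ∈ range n, mon (setPair η i p (lo + (t + 1)) (lo + n - (t + 1))) ∧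
      X p * ∑ t ∈ range n, mon (setPair η i p (lo + t) (lo + n - 1 - t)) =
        ∑ t ∈ range n, mon (setPair η i p (lo + t) (lo + n - t)) := by
  constructor
  · rw [mul_sum]
    refine sum_congr rfl fun t ht => ?_
    rw [X_left_mul_mon_setPair η hip]
    congr 2; omega
  · rw [mul_sum]
    refine sum_congr rfl fun t ht => ?_
    rw [X_right_mul_mon_setPair]
    have := mem_range.mp ht
    congr 2; omega

theorem X_sub_X_mul_sum_mon_setPair (η : Fin N → ℕ) {i p : Fin N} (hip : i ≠ p) (lo n : ℕ) :
    (X i - X p) * ∑ t ∈ range n, mon (setPair η i p (lo + t) (lo + n - 1 - t)) =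
      mon (setPair η i p (lo + n) lo) - mon (setPair η i p lo (lo + n)) := by
  rw [sub_mul, (X_mul_sum_mon_setPair η hip lo n).1, (X_mul_sum_mon_setPair η hip lo n).2,
    ← sum_sub_distrib, sum_range_sub (fun t => mon (setPair η i p (lo + t) (lo + n - t)))]
  simp

theorem dd_mon_of_le {η : Fin N → ℕ} {i p : Fin N} (hip : i ≠ p) {n : ℕ} (hn : η i = η p + n) :
    dd i p (mon η) = ∑ t ∈ range n, mon (setPair η i p (η p + t) (η p + n - 1 - t)) := by
  apply dd_eq_of_mul_eq hip
  rw [X_sub_X_mul_sum_mon_setPair η hip, ← hn, setPair_self, setPair_swap η hip, rename_mon,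
    Equiv.symm_swap]

theorem dd_mon_of_ge {η : Fin N → ℕ} {i p : Fin N} (hip : i ≠ p) {n : ℕ} (hn : η p = η i + n) :
    dd i p (mon η) = -∑ t ∈ range n, mon (setPair η i p (η i + t) (η i + n - 1 - t)) := by
  apply dd_eq_of_mul_eq hip
  rw [mul_neg, X_sub_X_mul_sum_mon_setPair η hip, ← hn, setPair_self, setPair_swap η hip,
    rename_mon, Equiv.symm_swap, neg_sub]

/-- The diagonal of `z_{max(i, p)} (1 - s_{ip}) / (z_i - z_p)` on monomials. -/
def exchangeDiag (i p : Fin N) (η : Fin N → ℕ) : ℂ :=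
  if p < i then (if η p < η i then 1 else 0) else (if η i < η p then -1 else 0)

theorem isTriangular_exchange {i p : Fin N} (hip : i ≠ p) :
    IsTriangular (LinearMap.mulLeft ℂ (X (max i p)) ∘ₗ dd i p) (exchangeDiag i p) := by
  intro η
  rw [LinearMap.comp_apply, LinearMap.mulLeft_apply]
  unfold exchangeDiag
  rcases lt_trichotomy (η i) (η p) with hlt | heq | hgt
  · obtain ⟨n, hn⟩ := Nat.exists_eq_add_of_lt hlt
    have hn' : η p = η i + (n + 1) := by omega
    rw [dd_mon_of_ge hip hn', mul_neg]
    by_cases hpi : p < i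
    · rw [max_eq_left hpi.le, (X_mul_sum_mon_setPair η hip _ _).1, if_pos hpi,
        if_neg (show ¬ η p < η i by omega), zero_smul, sub_zero]
      refine Submodule.neg_mem _ (Submodule.sum_mem _ fun t ht => mon_mem_lowerSpan ?_)
      have ht' := mem_range.mp ht
      by_cases htn : t = n
      · subst htn
        have : setPair η i p (η i + (t + 1)) (η i + (t + 1) - (t + 1)) = η ∘ Equiv.swap p i := by
          rw [← hn', Equiv.swap_comm, ← setPair_swap η hip]; congr 1; omega
        rw [this]
        exact below_swap hpi hlt
      · exact below_setPair_of_squeeze hip (by omega) (by omega) (by omega)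
    · have hpi' : i ≤ p := not_lt.mp hpi
      rw [max_eq_right hpi', (X_mul_sum_mon_setPair η hip _ _).2, if_neg hpi, if_pos hlt,
        sum_range_succ']
      have : setPair η i p (η i + 0) (η i + (n + 1) - 0) = η := by
        rw [add_zero, tsub_zero, ← hn', setPair_self]
      rw [this, neg_smul, one_smul, neg_add, add_sub_assoc, sub_self, add_zero]
      refine Submodule.neg_mem _ (Submodule.sum_mem _ fun t ht => mon_mem_lowerSpan ?_)
      have ht' := mem_range.mp ht
      exact below_setPair_of_squeeze hip (by omega) (by omega) (by omega)
  · rw [dd_mon_of_le hip (n := 0) (by omega)]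
    simp [heq]
  · obtain ⟨n, hn⟩ := Nat.exists_eq_add_of_lt hgt
    have hn' : η i = η p + (n + 1) := by omega
    rw [dd_mon_of_le hip hn']
    by_cases hpi : p < i
    · rw [max_eq_left hpi.le, (X_mul_sum_mon_setPair η hip _ _).1, if_pos hpi, if_pos hgt,
        sum_range_succ]
      have : setPair η i p (η p + (n + 1)) (η p + (n + 1) - (n + 1)) = η := by
        rw [Nat.add_sub_cancel, ← hn', setPair_self]
      rw [this, one_smul, add_sub_assoc, sub_self, add_zero]
      refine Submodule.sum_mem _ fun t ht => mon_mem_lowerSpan ?_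
      have ht' := mem_range.mp ht
      exact below_setPair_of_squeeze hip (by omega) (by omega) (by omega)
    · have hpi' : i < p := lt_of_le_of_ne (not_lt.mp hpi) hip
      rw [max_eq_right hpi'.le, (X_mul_sum_mon_setPair η hip _ _).2, if_neg hpi,
        if_neg (show ¬ η i < η p by omega), zero_smul, sub_zero]
      refine Submodule.sum_mem _ fun t ht => mon_mem_lowerSpan ?_
      have ht' := mem_range.mp ht
      by_cases ht₀ : t = 0
      · subst ht₀
        have : setPair η i p (η p + 0) (η p + (n + 1) - 0) = η ∘ Equiv.swap i p := by
          rw [add_zero, tsub_zero, ← hn', setPair_swap η hip]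
        rw [this]
        exact below_swap hpi' hgt
      · exact below_setPair_of_squeeze hip (by omega) (by omega) (by omega)

theorem sum_exchangeDiag (i : Fin N) (η : Fin N → ℕ) :
    ∑ p ∈ univ.erase i, exchangeDiag i p η = ((i : ℕ) : ℂ) - coleg η i := by
  have h₁ : ∑ p ∈ univ.erase i, exchangeDiag i p η =
      ∑ p, ((if p < i then (1 : ℂ) else 0) - (if p < i ∧ η i ≤ η p then 1 else 0) -
        (if i < p ∧ η i < η p then 1 else 0)) := by
    rw [← add_sum_erase univ _ (mem_univ i)]
    simp only [lt_self_iff_false, false_and, if_false, sub_zero, zero_add]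
    refine sum_congr rfl fun p hp => ?_
    have hpi : p ≠ i := (mem_erase.mp hp).1
    unfold exchangeDiag
    rcases lt_or_gt_of_ne hpi with hlt | hlt
    · have h₂ : ¬ i < p := hlt.not_gt
      by_cases h₃ : η p < η i
      · simp [hlt, h₂, h₃, not_le.mpr h₃]
      · simp [hlt, h₂, h₃, not_lt.mp h₃]
    · have h₂ : ¬ p < i := hlt.not_gt
      by_cases h₃ : η i < η p
      · simp [hlt, h₂, h₃]
      · simp [h₂, h₃]
  have h₂ : (univ.filter fun p : Fin N => p < i).card = i := by
    have : (univ.filter fun p : Fin N => p < i) = Iio i := by ext; simp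
    rw [this, Fin.card_Iio]
  rw [h₁, sum_sub_distrib, sum_sub_distrib, sum_boole, sum_boole, sum_boole, h₂, coleg]
  push_cast
  ring

/-- The Cherednik operators are triangular on monomials. -/
theorem isTriangular_xi (α : ℝ) (i : Fin N) :
    IsTriangular (xi α i) fun η => (bar α η i : ℂ) := by
  intro η
  have h₁ := IsTriangular.sum (univ.erase i) (fun p hp => isTriangular_exchange
    (i := i) (p := p) (mem_erase.mp hp).1.symm) η
  beta_reduce at h₁
  rw [sum_exchangeDiag, LinearMap.sum_apply] at h₁
  convert h₁ using 1
  rw [xi_apply, theta_mon]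
  simp only [bar, LinearMap.comp_apply, LinearMap.mulLeft_apply]
  push_cast
  simp only [sub_smul, mul_smul]
  abel

/-! ### Joint eigenfunctions -/

/-- `f` is a joint eigenfunction of the Cherednik operators with eigenvalues `c`. -/
def IsJoint (α : ℝ) (c : Fin N → ℝ) (f : MvPolynomial (Fin N) ℂ) : Prop :=
  ∀ i, xi α i f = (c i : ℂ) • f

/-- Among the monomials of `f` with a property there is one of maximal rank. -/
theorem exists_max_rank {f : MvPolynomial (Fin N) ℂ} {p : (Fin N → ℕ) → Prop}
    (hp : ∃ ν, co ν f ≠ 0 ∧ p ν) :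
    ∃ ν, co ν f ≠ 0 ∧ p ν ∧ ∀ μ, co μ f ≠ 0 → p μ → ¬ Below ν μ := by
  classical
  let s := (f.support.image fun m => (Finsupp.equivFunOnFinite m : Fin N → ℕ)).filter p
  have hs : ∀ ν, ν ∈ s ↔ co ν f ≠ 0 ∧ p ν := by
    intro ν
    simp only [s, mem_filter, mem_image, mem_support_iff]
    constructor
    · rintro ⟨⟨m, hm, rfl⟩, hpν⟩
      exact ⟨by simpa [co] using hm, hpν⟩
    · rintro ⟨hν, hpν⟩
      exact ⟨⟨Finsupp.equivFunOnFinite.symm ν, hν, by simp⟩, hpν⟩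
  obtain ⟨ν₀, hν₀⟩ := hp
  obtain ⟨ν, hν, hmax⟩ := s.exists_max_image rank ⟨ν₀, (hs _).mpr hν₀⟩
  refine ⟨ν, ((hs _).mp hν).1, ((hs _).mp hν).2, fun μ h₁ h₂ hb => ?_⟩
  exact absurd hb.2 (not_lt.mpr (hmax μ ((hs _).mpr ⟨h₁, h₂⟩)))

theorem IsJoint.eq_bar {α : ℝ} {c : Fin N → ℝ} {f : MvPolynomial (Fin N) ℂ} (hf : IsJoint α c f)
    {ν : Fin N → ℕ} (hν : co ν f ≠ 0) (hmax : ∀ μ, co μ f ≠ 0 → ¬ Below ν μ) : c = bar α ν := by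
  funext i
  have h₁ := (isTriangular_xi α i).co_apply hmax
  rw [hf i, map_smul, smul_eq_mul] at h₁
  exact_mod_cast mul_right_cancel₀ hν h₁

/-- The eigenvalues of a nonzero joint eigenfunction come from a composition. -/
theorem IsJoint.exists_bar {α : ℝ} {c : Fin N → ℝ} {f : MvPolynomial (Fin N) ℂ}
    (hf : IsJoint α c f) (hf₀ : f ≠ 0) : ∃ ν, co ν f ≠ 0 ∧ c = bar α ν := by
  obtain ⟨ν, hν, -, hmax⟩ := exists_max_rank (f := f) (p := fun _ => True) (by
    by_contra hn
    push Not at hn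
    exact hf₀ (eq_zero_of_co fun ν => by_contra fun hν => hn ν hν))
  exact ⟨ν, hν, hf.eq_bar hν fun μ hμ => hmax μ hμ trivial⟩

theorem IsJoint.eq_zero {α : ℝ} (hα : 0 < α) {η : Fin N → ℕ} {f : MvPolynomial (Fin N) ℂ}
    (hf : IsJoint α (bar α η) f) (hη : co η f = 0) : f = 0 := by
  by_contra hn
  obtain ⟨ν, hν, hb⟩ := hf.exists_bar hn
  exact hν (by rw [← eq_of_bar_eq hα hb, hη])

/-- A joint eigenfunction is supported on the compositions below its label. -/
theorem IsJoint.support {α : ℝ} (hα : 0 < α) {η : Fin N → ℕ} {f : MvPolynomial (Fin N) ℂ}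
    (hf : IsJoint α (bar α η) f) {ν : Fin N → ℕ} (hν : co ν f ≠ 0) : ν = η ∨ Below ν η := by
  by_contra hn
  obtain ⟨ρ, hρ, hp, hmax⟩ := exists_max_rank (p := fun ρ => ¬ (ρ = η ∨ Below ρ η)) ⟨ν, hν, hn⟩
  refine hp (Or.inl (eq_of_bar_eq hα ((hf.eq_bar hρ fun μ hμ hb => ?_).symm)))
  by_cases h₁ : μ = η ∨ Below μ η
  · rcases h₁ with rfl | h₁
    · exact hp (Or.inr hb)
    · exact hp (Or.inr (hb.trans h₁))
  · exact hmax μ hμ h₁ hb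

end JackTorus

end

noncomputable section

namespace JackTorus

open Finset MvPolynomial MeasureTheory Filter Topology

variable {N : ℕ}

/-! ### Points of the torus -/

theorem torusPoint_mul_conj (x : Fin N → ℝ) (j : Fin N) :
    torusPoint x j * conj (torusPoint x j) = 1 := by
  have h₁ : torusPoint x j = Complex.exp (((2 * Real.pi * x j : ℝ) : ℂ) * Complex.I) := by
    rw [torusPoint]; congr 1; push_cast; ring
  rw [Complex.mul_conj, Complex.normSq_eq_norm_sq, h₁, Complex.norm_exp_ofReal_mul_I]
  simp

theorem conj_torusPoint (x : Fin N → ℝ) (j : Fin N) :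
    conj (torusPoint x j) = Complex.exp (-(2 * Real.pi * Complex.I) * x j) := by
  rw [torusPoint, ← Complex.exp_conj]
  congr 1
  simp [Complex.conj_ofNat]

theorem contDiff_torusPoint (j : Fin N) : ContDiff ℝ 1 fun x : Fin N → ℝ => torusPoint x j := by
  unfold torusPoint
  have h₁ : ContDiff ℝ 1 fun x : Fin N → ℝ => ((x j : ℝ) : ℂ) :=
    Complex.ofRealCLM.contDiff.comp (contDiff_apply ℝ ℝ j)
  exact (contDiff_const.mul h₁).cexp

theorem contDiff_conj_torusPoint (j : Fin N) :
    ContDiff ℝ 1 fun x : Fin N → ℝ => conj (torusPoint x j) :=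
  Complex.conjCLE.contDiff.comp (contDiff_torusPoint j)

theorem contDiff_eval_comp {y : (Fin N → ℝ) → Fin N → ℂ} (hy : ∀ j, ContDiff ℝ 1 fun x => y x j)
    (f : MvPolynomial (Fin N) ℂ) : ContDiff ℝ 1 fun x => eval (y x) f := by
  induction f using MvPolynomial.induction_on with
  | C a => simpa using contDiff_const
  | add f g hf hg => simpa using hf.add hg
  | mul_X f k hf => simpa using hf.mul (hy k)

theorem contDiff_eval (f : MvPolynomial (Fin N) ℂ) :
    ContDiff ℝ 1 fun x : Fin N → ℝ => eval (torusPoint x) f :=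
  contDiff_eval_comp contDiff_torusPoint f

theorem contDiff_eval_conj (f : MvPolynomial (Fin N) ℂ) :
    ContDiff ℝ 1 fun x : Fin N → ℝ => eval (fun j => conj (torusPoint x j)) f :=
  contDiff_eval_comp contDiff_conj_torusPoint f

theorem torusPoint_add_single (x : Fin N → ℝ) (i : Fin N) :
    torusPoint (x + Pi.single i 1) = torusPoint x := by
  funext j
  unfold torusPoint
  by_cases hj : j = i
  · subst hj
    rw [Complex.exp_eq_exp_iff_exists_int]
    exact ⟨1, by simp; ring⟩
  · simp [hj]

/-- The squared distance of two coordinates on the torus. -/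
def chordSq (x : Fin N → ℝ) (j k : Fin N) : ℝ := ‖torusPoint x k - torusPoint x j‖ ^ 2

theorem chordSq_nonneg (x : Fin N → ℝ) (j k : Fin N) : 0 ≤ chordSq x j k := sq_nonneg _

theorem chordSq_symm (x : Fin N → ℝ) (j k : Fin N) : chordSq x j k = chordSq x k j := by
  rw [chordSq, chordSq, norm_sub_rev]

theorem chordSq_eq_mul (x : Fin N → ℝ) (j k : Fin N) : (chordSq x j k : ℂ) =
    (torusPoint x j - torusPoint x k) * (conj (torusPoint x j) - conj (torusPoint x k)) := by
  rw [chordSq_symm, chordSq, ← Complex.normSq_eq_norm_sq, ← Complex.mul_conj, map_sub]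

theorem torusPoint_mul_conj_eq (x : Fin N → ℝ) (j k : Fin N) :
    torusPoint x j * conj (torusPoint x k) =
      Complex.exp (((2 * Real.pi * (x j - x k) : ℝ) : ℂ) * Complex.I) := by
  rw [conj_torusPoint, torusPoint, ← Complex.exp_add]
  congr 1; push_cast; ring

theorem torusPoint_add_mul_conj_sub (x : Fin N → ℝ) (j k : Fin N) :
    (torusPoint x j + torusPoint x k) * (conj (torusPoint x j) - conj (torusPoint x k)) =
      -2 * Complex.I * (Real.sin (2 * Real.pi * (x j - x k)) : ℝ) := by
  have h₁ := torusPoint_mul_conj_eq x j k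
  have h₂ := torusPoint_mul_conj_eq x k j
  have h₃ := torusPoint_mul_conj x j
  have h₄ := torusPoint_mul_conj x k
  rw [Complex.exp_mul_I] at h₁ h₂
  rw [show (2 * Real.pi * (x k - x j) : ℝ) = -(2 * Real.pi * (x j - x k)) by ring,
    Complex.ofReal_neg, Complex.cos_neg, Complex.sin_neg] at h₂
  rw [Complex.ofReal_sin]
  linear_combination h₃ - h₄ - h₁ + h₂

theorem chordSq_eq_cos (x : Fin N → ℝ) (j k : Fin N) :
    chordSq x j k = 2 - 2 * Real.cos (2 * Real.pi * (x j - x k)) := by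
  have h₁ := torusPoint_mul_conj_eq x j k
  have h₂ := torusPoint_mul_conj_eq x k j
  have h₃ := torusPoint_mul_conj x j
  have h₄ := torusPoint_mul_conj x k
  rw [Complex.exp_mul_I] at h₁ h₂
  rw [show (2 * Real.pi * (x k - x j) : ℝ) = -(2 * Real.pi * (x j - x k)) by ring,
    Complex.ofReal_neg, Complex.cos_neg, Complex.sin_neg] at h₂
  rw [← Complex.ofReal_inj, chordSq_eq_mul]
  simp only [Complex.ofReal_sub, Complex.ofReal_mul, Complex.ofReal_cos, Complex.ofReal_ofNat] at *
  linear_combination h₃ + h₄ - h₁ - h₂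

theorem chordSq_le (x : Fin N → ℝ) (j k : Fin N) : chordSq x j k ≤ 4 := by
  rw [chordSq_eq_cos]
  linarith [Real.neg_one_le_cos (2 * Real.pi * (x j - x k))]

theorem contDiff_chordSq (j k : Fin N) : ContDiff ℝ 1 fun x : Fin N → ℝ => chordSq x j k := by
  simp only [chordSq_eq_cos]
  exact contDiff_const.sub (contDiff_const.mul (Real.contDiff_cos.comp
    (contDiff_const.mul ((contDiff_apply ℝ ℝ j).sub (contDiff_apply ℝ ℝ k)))))

/-! ### The weight and its regularization -/

/-- The weight with `|z_j - z_k|²` replaced by `|z_j - z_k|² + ε`. -/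
def regWeight (α ε : ℝ) (x : Fin N → ℝ) : ℝ :=
  ∏ j, ∏ k ∈ univ.erase j, (chordSq x j k + ε) ^ (1 / (2 * α))

@[to_additive]
theorem prod_erase_eq_prod_Ioi {M : Type*} [CommMonoid M] (F : Fin N → Fin N → M) :
    ∏ j, ∏ k ∈ univ.erase j, F j k = ∏ j, ∏ k ∈ Ioi j, F j k * F k j := by
  have h₁ : ∀ j : Fin N, (univ.erase j : Finset (Fin N)) = Ioi j ∪ Iio j := fun j => by
    ext k; simp [lt_or_lt_iff_ne, ne_comm]
  have h₂ : ∀ j : Fin N, Disjoint (Ioi j) (Iio j) := fun j => by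
    rw [disjoint_left]; intro k h₁ h₂
    exact lt_asymm (mem_Ioi.mp h₁) (mem_Iio.mp h₂)
  simp only [h₁, prod_union (h₂ _), prod_mul_distrib]
  congr 1
  exact prod_comm' (by simp)

theorem regWeight_zero {α : ℝ} (x : Fin N → ℝ) :
    regWeight α 0 x =
      ∏ j, ∏ k ∈ Ioi j, ‖torusPoint x k - torusPoint x j‖ ^ (2 / α) := by
  rw [regWeight, prod_erase_eq_prod_Ioi]
  refine prod_congr rfl fun j _ => prod_congr rfl fun k _ => ?_
  have h₁ := norm_nonneg (torusPoint x k - torusPoint x j)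
  rw [chordSq_symm x k j, add_zero, ← Real.mul_rpow (chordSq_nonneg x j k) (chordSq_nonneg x j k),
    chordSq, ← pow_add, ← Real.rpow_natCast, ← Real.rpow_mul h₁]
  congr 1
  push_cast
  rw [mul_one_div, ← mul_div_mul_left 2 α two_ne_zero]
  norm_num

theorem regWeight_nonneg (α : ℝ) {ε : ℝ} (hε : 0 ≤ ε) (x : Fin N → ℝ) : 0 ≤ regWeight α ε x :=
  prod_nonneg fun j _ => prod_nonneg fun k _ =>
    Real.rpow_nonneg (add_nonneg (chordSq_nonneg x j k) hε) _

theorem regWeight_le {α : ℝ} (hα : 0 < α) {ε : ℝ} (hε : 0 ≤ ε) (hε₁ : ε ≤ 1) (x : Fin N → ℝ) :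
    regWeight α ε x ≤ ∏ j : Fin N, ∏ _k ∈ univ.erase j, (5 : ℝ) ^ (1 / (2 * α)) := by
  refine prod_le_prod (fun j _ => prod_nonneg fun k _ =>
    Real.rpow_nonneg (add_nonneg (chordSq_nonneg x j k) hε) _) fun j _ => ?_
  refine prod_le_prod (fun k _ =>
    Real.rpow_nonneg (add_nonneg (chordSq_nonneg x j k) hε) _) fun k _ => ?_
  refine Real.rpow_le_rpow (add_nonneg (chordSq_nonneg x j k) hε) ?_ (by positivity)
  linarith [chordSq_le x j k]

theorem continuous_regWeight {α : ℝ} (hα : 0 < α) (ε : ℝ) :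
    Continuous fun x : Fin N → ℝ => regWeight α ε x := by
  refine continuous_finsetProd _ fun j _ => continuous_finsetProd _ fun k _ => ?_
  exact ((contDiff_chordSq j k).continuous.add continuous_const).rpow_const
    fun _ => Or.inr (by positivity)

theorem tendsto_regWeight {α : ℝ} (hα : 0 < α) (x : Fin N → ℝ) :
    Tendsto (fun ε => regWeight α ε x) (𝓝[>] 0) (𝓝 (regWeight α 0 x)) := by
  have : Continuous fun ε => regWeight α ε x := by
    refine continuous_finsetProd _ fun j _ => continuous_finsetProd _ fun k _ => ?_
    exact (continuous_const.add continuous_id).rpow_const fun _ => Or.inr (by positivity)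
  exact this.continuousAt.tendsto.mono_left nhdsWithin_le_nhds

theorem regWeight_comp_perm (α ε : ℝ) (x : Fin N → ℝ) (τ : Equiv.Perm (Fin N)) :
    regWeight α ε (x ∘ τ) = regWeight α ε x := by
  unfold regWeight
  rw [← Equiv.prod_comp τ fun j => ∏ k ∈ univ.erase j, (chordSq x j k + ε) ^ (1 / (2 * α))]
  refine prod_congr rfl fun j _ => ?_
  refine prod_bij' (fun k _ => τ k) (fun k _ => τ.symm k) ?_ ?_ ?_ ?_ ?_
  · intro k hk; simpa using hk
  · intro k hk
    simp only [mem_erase, mem_univ, and_true] at hk ⊢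
    rintro rfl; simp at hk
  · simp
  · simp
  · intro k _; rfl

/-! ### Integration over the torus -/

theorem setIntegral_comp_perm (τ : Equiv.Perm (Fin N)) (F : (Fin N → ℝ) → ℂ) :
    ∫ x in Set.Icc (0 : Fin N → ℝ) 1, F (x ∘ τ) = ∫ x in Set.Icc (0 : Fin N → ℝ) 1, F x := by
  have h₁ := volume_measurePreserving_piCongrLeft (fun _ : Fin N => ℝ) τ.symm
  have h₂ := h₁.setIntegral_preimage_emb (MeasurableEquiv.measurableEmbedding _) F
    (Set.Icc (0 : Fin N → ℝ) 1)
  have h₃ : ∀ x : Fin N → ℝ, MeasurableEquiv.piCongrLeft (fun _ : Fin N => ℝ) τ.symm x = x ∘ τ :=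
    fun x => by
      funext j
      obtain ⟨k, rfl⟩ := τ.symm.surjective j
      rw [MeasurableEquiv.coe_piCongrLeft, Equiv.piCongrLeft_apply_apply]
      simp
  simp only [h₃] at h₂
  rw [← h₂]
  congr 2
  ext x
  simp only [Set.mem_preimage, h₃, Set.mem_Icc, Pi.le_def, Function.comp, Pi.zero_apply,
    Pi.one_apply]
  constructor
  · rintro ⟨h₄, h₅⟩
    exact ⟨fun i => h₄ (τ i), fun i => h₅ (τ i)⟩
  · rintro ⟨h₄, h₅⟩
    exact ⟨fun i => by simpa using h₄ (τ.symm i), fun i => by simpa using h₅ (τ.symm i)⟩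

theorem setIntegral_fderiv_eq_zero (i : Fin N) {F : (Fin N → ℝ) → ℂ} (hF : ContDiff ℝ 1 F)
    (hper : ∀ x, F (x + Pi.single i 1) = F x) :
    ∫ x in Set.Icc (0 : Fin N → ℝ) 1, fderiv ℝ F x (Pi.single i 1) = 0 := by
  obtain ⟨n, rfl⟩ : ∃ n, N = n + 1 := ⟨N - 1, by have := i.isLt; omega⟩
  have hcont : Continuous fun x => fderiv ℝ F x (Pi.single i 1) :=
    (hF.continuous_fderiv (by norm_num)).clm_apply continuous_const
  have key := integral_divergence_of_hasFDerivAt_off_countable' (0 : Fin (n + 1) → ℝ) 1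
    (by intro j; simp)
    (fun j x => if j = i then F x else 0)
    (fun j x => if j = i then fderiv ℝ F x else 0) ∅ Set.countable_empty
    (fun j => by
      by_cases hj : j = i
      · simpa [hj] using hF.continuous.continuousOn
      · simpa [hj] using continuousOn_const)
    (fun x _ j => by
      by_cases hj : j = i
      · simpa [hj] using (hF.differentiable (by norm_num) x).hasFDerivAt
      · simpa [hj] using hasFDerivAt_const (0 : ℂ) x)
    (by
      have : (fun x => ∑ j, (if j = i then fderiv ℝ F x else 0) (Pi.single j (1 : ℝ))) =
          fun x => fderiv ℝ F x (Pi.single i 1) := by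
        funext x
        rw [sum_eq_single i] <;> simp +contextual
      rw [this]
      exact hcont.continuousOn.integrableOn_compact isCompact_Icc)
  have hl : ∀ x, ∑ j, (if j = i then fderiv ℝ F x else 0) (Pi.single j (1 : ℝ)) =
      fderiv ℝ F x (Pi.single i 1) := fun x => by
    rw [sum_eq_single i] <;> simp +contextual
  simp only [hl] at key
  rw [key, sum_eq_single i]
  · simp only [if_true]
    rw [sub_eq_zero]
    congr 1
    funext y
    have : (i.insertNth ((1 : Fin (n + 1) → ℝ) i) y : Fin (n + 1) → ℝ) =
        (i.insertNth ((0 : Fin (n + 1) → ℝ) i) y : Fin (n + 1) → ℝ) + Pi.single i 1 := by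
      funext j
      refine Fin.succAboveCases i ?_ (fun k => ?_) j
      · simp
      · simp [Fin.succAbove_ne]
    rw [this, hper]
  · intro j _ hj; simp [hj]
  · simp

end JackTorus

end

noncomputable section

namespace JackTorus

open Finset MvPolynomial MeasureTheory Filter Topology

variable {N : ℕ}

/-! ### The torus inner product as a bilinear form -/

/-- The value of `f` at a point of the torus. -/
def ev (x : Fin N → ℝ) (f : MvPolynomial (Fin N) ℂ) : ℂ := eval (torusPoint x) f

/-- The value of `f` at the conjugate of a point of the torus. -/
def evc (x : Fin N → ℝ) (f : MvPolynomial (Fin N) ℂ) : ℂ :=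
  eval (fun j => conj (torusPoint x j)) f

theorem continuous_ev (f : MvPolynomial (Fin N) ℂ) : Continuous fun x => ev x f :=
  (contDiff_eval f).continuous

theorem continuous_evc (f : MvPolynomial (Fin N) ℂ) : Continuous fun x => evc x f :=
  (contDiff_eval_conj f).continuous

theorem ev_rename (x : Fin N → ℝ) (τ : Equiv.Perm (Fin N)) (f : MvPolynomial (Fin N) ℂ) :
    ev x (rename τ f) = ev (x ∘ τ) f := by
  rw [ev, eval_rename]; rfl

theorem evc_rename (x : Fin N → ℝ) (τ : Equiv.Perm (Fin N)) (f : MvPolynomial (Fin N) ℂ) :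
    evc x (rename τ f) = evc (x ∘ τ) f := by
  rw [evc, eval_rename]; rfl

theorem torusInner_eq (α : ℝ) (f g : MvPolynomial (Fin N) ℂ) :
    torusInner α f g = ∫ x in Set.Icc (0 : Fin N → ℝ) 1,
      (regWeight α 0 x : ℂ) * (evc x f * ev x g) := by
  simp only [torusInner, regWeight_zero]; rfl

theorem integrableOn_cube {F : (Fin N → ℝ) → ℂ} (hF : Continuous F) :
    IntegrableOn F (Set.Icc (0 : Fin N → ℝ) 1) :=
  hF.continuousOn.integrableOn_compact isCompact_Icc

theorem continuous_weight_mul {α : ℝ} (hα : 0 < α) (f g : MvPolynomial (Fin N) ℂ) :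
    Continuous fun x : Fin N → ℝ => (regWeight α 0 x : ℂ) * (evc x f * ev x g) :=
  (Complex.continuous_ofReal.comp (continuous_regWeight hα 0)).mul
    ((continuous_evc f).mul (continuous_ev g))

/-- The torus inner product as a bilinear form. -/
def torusForm {α : ℝ} (hα : 0 < α) :
    MvPolynomial (Fin N) ℂ →ₗ[ℂ] MvPolynomial (Fin N) ℂ →ₗ[ℂ] ℂ :=
  LinearMap.mk₂ ℂ (torusInner α)
    (fun f₁ f₂ g => by
      simp only [torusInner_eq]
      rw [← integral_add (integrableOn_cube (continuous_weight_mul hα f₁ g))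
        (integrableOn_cube (continuous_weight_mul hα f₂ g))]
      congr 1; funext x; simp only [evc, map_add]; ring)
    (fun c f g => by
      simp only [torusInner_eq]
      rw [smul_eq_mul, ← integral_const_mul]
      congr 1; funext x; simp only [evc, smul_eval]; ring)
    (fun f g₁ g₂ => by
      simp only [torusInner_eq]
      rw [← integral_add (integrableOn_cube (continuous_weight_mul hα f g₁))
        (integrableOn_cube (continuous_weight_mul hα f g₂))]
      congr 1; funext x; simp only [ev, map_add]; ring)
    (fun c f g => by
      simp only [torusInner_eq]
      rw [smul_eq_mul, ← integral_const_mul]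
      congr 1; funext x; simp only [ev, smul_eval]; ring)

theorem torusForm_apply {α : ℝ} (hα : 0 < α) (f g : MvPolynomial (Fin N) ℂ) :
    torusForm hα f g = torusInner α f g := rfl

theorem torusForm_rename {α : ℝ} (hα : 0 < α) (τ : Equiv.Perm (Fin N))
    (f g : MvPolynomial (Fin N) ℂ) :
    torusForm hα (rename τ f) (rename τ g) = torusForm hα f g := by
  rw [torusForm_apply, torusForm_apply, torusInner_eq, torusInner_eq,
    ← setIntegral_comp_perm τ fun x => (regWeight α 0 x : ℂ) * (evc x f * ev x g)]
  simp only [regWeight_comp_perm, ev_rename, evc_rename]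

theorem torusForm_X_mul {α : ℝ} (hα : 0 < α) (i : Fin N) (f g : MvPolynomial (Fin N) ℂ) :
    torusForm hα (X i * f) (X i * g) = torusForm hα f g := by
  rw [torusForm_apply, torusForm_apply, torusInner_eq, torusInner_eq]
  congr 1
  funext x
  simp only [ev, evc, map_mul, eval_X]
  linear_combination (regWeight α 0 x : ℂ) * eval (fun j => conj (torusPoint x j)) f *
    eval (torusPoint x) g * torusPoint_mul_conj x i

theorem torusForm_raiseOp {n : ℕ} {α : ℝ} (hα : 0 < α) (f g : MvPolynomial (Fin (n + 1)) ℂ) :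
    torusForm hα (raiseOp f) (raiseOp g) = torusForm hα f g := by
  rw [raiseOp, raiseOp, torusForm_X_mul, torusForm_rename]

theorem torusForm_one_ne_zero {α : ℝ} (hα : 0 < α) :
    torusForm hα (1 : MvPolynomial (Fin N) ℂ) 1 ≠ 0 := by
  rw [torusForm_apply, torusInner_eq]
  simp only [ev, evc, map_one, mul_one]
  rw [integral_complex_ofReal, Complex.ofReal_ne_zero]
  have hc := continuous_regWeight (N := N) hα 0
  refine ne_of_gt ((setIntegral_pos_iff_support_of_nonneg_ae
    (Eventually.of_forall fun x => regWeight_nonneg α le_rfl x)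
    (hc.continuousOn.integrableOn_compact isCompact_Icc)).mpr ?_)
  set x₀ : Fin N → ℝ := fun j => ((j : ℕ) + 1 : ℝ) / (N + 1) with hx₀
  have hN : (0 : ℝ) < N + 1 := by positivity
  have hpos : ∀ j : Fin N, 0 < x₀ j := fun j => by rw [hx₀]; positivity
  have hlt : ∀ j : Fin N, x₀ j < 1 := fun j => by
    rw [hx₀]
    simp only
    rw [div_lt_one hN]
    have : ((j : ℕ) : ℝ) < N := by exact_mod_cast j.isLt
    linarith
  have hopen : IsOpen ((Function.support fun x => regWeight α 0 x) ∩
      Set.univ.pi fun _ : Fin N => Set.Ioo (0 : ℝ) 1) :=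
    hc.isOpen_support.inter (isOpen_set_pi Set.finite_univ fun _ _ => isOpen_Ioo)
  have hmem : x₀ ∈ (Function.support fun x => regWeight α 0 x) ∩
      Set.univ.pi fun _ : Fin N => Set.Ioo (0 : ℝ) 1 := by
    refine ⟨?_, fun j _ => ⟨hpos j, hlt j⟩⟩
    rw [Function.mem_support]
    refine ne_of_gt (prod_pos fun j _ => prod_pos fun k hk => Real.rpow_pos_of_pos ?_ _)
    rw [add_zero]
    refine lt_of_le_of_ne (chordSq_nonneg _ _ _) (Ne.symm ?_)
    rw [chordSq]
    refine pow_ne_zero 2 (norm_ne_zero_iff.mpr (sub_ne_zero.mpr fun he => ?_))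
    have hjk : (k : ℕ) ≠ j := fun h₁ => (mem_erase.mp hk).1 (Fin.ext h₁)
    rw [torusPoint, torusPoint, Complex.exp_eq_exp_iff_exists_int] at he
    obtain ⟨n, hn⟩ := he
    have hI : (2 * Real.pi * Complex.I : ℂ) ≠ 0 := Complex.two_pi_I_ne_zero
    have h₂ : (x₀ k : ℂ) = x₀ j + n := by
      apply mul_left_cancel₀ hI
      rw [hn]; ring
    have h₃ : x₀ k = x₀ j + n := by exact_mod_cast h₂
    have h₄ := hpos j
    have h₅ := hpos k
    have h₆ := hlt j
    have h₇ := hlt k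
    have h₈ : (n : ℝ) < 1 := by linarith
    have h₉ : (-1 : ℝ) < n := by linarith
    have h₁₀ : n = 0 := by
      have : n < 1 := by exact_mod_cast h₈
      have : -1 < n := by exact_mod_cast h₉
      omega
    rw [h₁₀] at h₃
    simp only [hx₀, Int.cast_zero, add_zero, div_left_inj' hN.ne', add_left_inj] at h₃
    exact hjk (by exact_mod_cast h₃)
  refine lt_of_lt_of_le (hopen.measure_pos volume ⟨x₀, hmem⟩) (measure_mono ?_)
  exact Set.inter_subset_inter_right _ fun x hx =>
    ⟨fun j => (hx j trivial).1.le, fun j => (hx j trivial).2.le⟩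

/-! ### Derivatives along a coordinate -/

/-- The line through `x` in direction `i`. -/
def lineTo (x : Fin N → ℝ) (i : Fin N) (t : ℝ) : Fin N → ℝ := x + t • Pi.single i 1

theorem lineTo_zero (x : Fin N → ℝ) (i : Fin N) : lineTo x i 0 = x := by simp [lineTo]

theorem hasDerivAt_lineTo (x : Fin N → ℝ) (i : Fin N) :
    HasDerivAt (lineTo x i) (Pi.single i 1) 0 := by
  unfold lineTo
  simpa using ((hasDerivAt_id (0 : ℝ)).smul_const (Pi.single i (1 : ℝ) : Fin N → ℝ)).const_add x

theorem hasDerivAt_lineTo_apply (x : Fin N → ℝ) (i j : Fin N) :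
    HasDerivAt (fun t => lineTo x i t j) ((Pi.single i 1 : Fin N → ℝ) j) 0 :=
  (hasDerivAt_pi.mp (hasDerivAt_lineTo x i)) j

theorem fderiv_eq_of_hasDerivAt_lineTo {F : (Fin N → ℝ) → ℂ} (hF : ContDiff ℝ 1 F)
    {x : Fin N → ℝ} {i : Fin N} {c : ℂ} (hc : HasDerivAt (fun t => F (lineTo x i t)) c 0) :
    fderiv ℝ F x (Pi.single i 1) = c := by
  have h₁ : HasFDerivAt F (fderiv ℝ F x) (lineTo x i 0) := by
    rw [lineTo_zero]; exact (hF.differentiable (by norm_num) x).hasFDerivAt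
  exact (h₁.comp_hasDerivAt 0 (hasDerivAt_lineTo x i)).unique hc

theorem hasDerivAt_eval_comp {y : ℝ → Fin N → ℂ} {i : Fin N} {c : ℂ}
    (hy : ∀ j, HasDerivAt (fun t => y t j) (if j = i then c * y 0 j else 0) 0)
    (f : MvPolynomial (Fin N) ℂ) :
    HasDerivAt (fun t => eval (y t) f) (c * eval (y 0) (theta i f)) 0 := by
  simp only [theta_apply]
  induction f using MvPolynomial.induction_on with
  | C a => simpa using hasDerivAt_const (0 : ℝ) a
  | add f g hf hg =>
    simp only [map_add, mul_add]
    exact hf.add hg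
  | mul_X f k hf =>
    simp only [map_mul, eval_X]
    refine (hf.fun_mul (hy k)).congr_deriv ?_
    rw [Derivation.leibniz]
    by_cases hk : k = i
    · subst hk
      simp only [pderiv_X_self, smul_eq_mul, map_add, map_mul, eval_X, map_one, if_true]
      ring
    · rw [pderiv_X_of_ne hk]
      simp only [smul_eq_mul, map_add, map_mul, eval_X, map_zero, if_neg hk]
      ring

theorem hasDerivAt_exp_lineTo (c : ℂ) (x : Fin N → ℝ) (i j : Fin N) :
    HasDerivAt (fun t => Complex.exp (c * lineTo x i t j))
      (if j = i then c * Complex.exp (c * lineTo x i 0 j) else 0) 0 := by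
  have h₁ := ((hasDerivAt_lineTo_apply x i j).ofReal_comp.const_mul c).cexp
  convert h₁ using 1
  by_cases hj : j = i
  · subst hj; simp; ring
  · simp [hj]

theorem hasDerivAt_ev (x : Fin N → ℝ) (i : Fin N) (f : MvPolynomial (Fin N) ℂ) :
    HasDerivAt (fun t => ev (lineTo x i t) f) (2 * Real.pi * Complex.I * ev x (theta i f)) 0 := by
  have := hasDerivAt_eval_comp (hasDerivAt_exp_lineTo (2 * Real.pi * Complex.I) x i) f
  rw [lineTo_zero] at this
  exact this

theorem hasDerivAt_evc (x : Fin N → ℝ) (i : Fin N) (f : MvPolynomial (Fin N) ℂ) :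
    HasDerivAt (fun t => evc (lineTo x i t) f)
      (-(2 * Real.pi * Complex.I) * evc x (theta i f)) 0 := by
  have := hasDerivAt_eval_comp (hasDerivAt_exp_lineTo (-(2 * Real.pi * Complex.I)) x i) f
  rw [lineTo_zero] at this
  simp only [evc, conj_torusPoint]
  exact this

theorem regWeight_eq_exp (α : ℝ) {ε : ℝ} (hε : 0 < ε) (x : Fin N → ℝ) :
    regWeight α ε x =
      Real.exp (1 / (2 * α) * ∑ j, ∑ k ∈ univ.erase j, Real.log (chordSq x j k + ε)) := by
  simp only [mul_sum, Real.exp_sum]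
  refine prod_congr rfl fun j _ => prod_congr rfl fun k _ => ?_
  rw [Real.rpow_def_of_pos (add_pos_of_nonneg_of_pos (chordSq_nonneg x j k) hε), mul_comm]

theorem contDiff_regWeight (α : ℝ) {ε : ℝ} (hε : 0 < ε) :
    ContDiff ℝ 1 fun x : Fin N → ℝ => regWeight α ε x := by
  simp only [regWeight_eq_exp α hε]
  refine (contDiff_const.mul (ContDiff.sum fun j _ => ContDiff.sum fun k _ => ?_)).exp
  exact ((contDiff_chordSq j k).add contDiff_const).log
    fun x => (add_pos_of_nonneg_of_pos (chordSq_nonneg x j k) hε).ne'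

theorem hasDerivAt_regWeight (α : ℝ) {ε : ℝ} (hε : 0 < ε) (x : Fin N → ℝ) (i : Fin N) :
    HasDerivAt (fun t => regWeight α ε (lineTo x i t))
      (regWeight α ε x * (1 / α * ∑ p ∈ univ.erase i,
        4 * Real.pi * Real.sin (2 * Real.pi * (x i - x p)) / (chordSq x i p + ε))) 0 := by
  set A : Fin N → Fin N → ℝ := fun j k =>
    4 * Real.pi * Real.sin (2 * Real.pi * (x j - x k)) / (chordSq x j k + ε) with hA
  have hanti : ∀ j k, A k j = -A j k := fun j k => by
    rw [hA]
    simp only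
    rw [chordSq_symm x k j, show 2 * Real.pi * (x k - x j) = -(2 * Real.pi * (x j - x k)) by ring,
      Real.sin_neg]
    ring
  have hlog : ∀ j k, HasDerivAt (fun t => Real.log (chordSq (lineTo x i t) j k + ε))
      (A j k * ((Pi.single i 1 : Fin N → ℝ) j - (Pi.single i 1 : Fin N → ℝ) k)) 0 := by
    intro j k
    have h₁ := (((((hasDerivAt_lineTo_apply x i j).sub (hasDerivAt_lineTo_apply x i k)).const_mul
      (2 * Real.pi)).cos.const_mul 2).const_sub 2).add_const ε
    simp only [← chordSq_eq_cos, Pi.sub_apply] at h₁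
    have h₂ := h₁.log (add_pos_of_nonneg_of_pos (chordSq_nonneg _ j k) hε).ne'
    simp only [lineTo_zero] at h₂
    convert h₂ using 1
    rw [hA]
    simp only
    ring
  have hsum := ((HasDerivAt.fun_sum fun j (_ : j ∈ univ) =>
    HasDerivAt.fun_sum fun k (_ : k ∈ univ.erase j) => hlog j k).const_mul (1 / (2 * α))).exp
  simp only [← regWeight_eq_exp α hε, lineTo_zero] at hsum
  convert hsum using 1
  congr 1
  have h₁ : ∑ j, ∑ k ∈ univ.erase j,
      A j k * ((Pi.single i 1 : Fin N → ℝ) j - (Pi.single i 1 : Fin N → ℝ) k) =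
      2 * ∑ p ∈ univ.erase i, A i p := by
    have h₂ : ∀ j, ∑ k ∈ univ.erase j,
        A j k * ((Pi.single i 1 : Fin N → ℝ) j - (Pi.single i 1 : Fin N → ℝ) k) =
        if j = i then ∑ p ∈ univ.erase i, A i p else A i j := by
      intro j
      split_ifs with hj
      · subst hj
        refine sum_congr rfl fun k hk => ?_
        simp [(mem_erase.mp hk).1]
      · rw [sum_eq_single i]
        · rw [hanti]; simp [hj]
        · intro k _ hk; simp [hj, hk]
        · intro hi; simp [Ne.symm hj] at hi
    simp only [h₂]
    rw [← add_sum_erase univ _ (mem_univ i), if_pos rfl, two_mul]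
    congr 1
    exact sum_congr rfl fun k hk => if_neg (mem_erase.mp hk).1
  rw [h₁]
  change 1 / α * ∑ p ∈ univ.erase i, A i p = _
  generalize ∑ p ∈ univ.erase i, A i p = S
  by_cases hα : α = 0
  · simp [hα]
  · field_simp

end JackTorus

end

noncomputable section

namespace JackTorus

open Finset MvPolynomial MeasureTheory Filter Topology

variable {N : ℕ}

/-! ### Self-adjointness of the Cherednik operators -/

theorem continuous_torusPoint (j : Fin N) : Continuous fun x : Fin N → ℝ => torusPoint x j :=
  (contDiff_torusPoint j).continuous

theorem continuous_conj_torusPoint (j : Fin N) :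
    Continuous fun x : Fin N → ℝ => conj (torusPoint x j) :=
  (contDiff_conj_torusPoint j).continuous

/-- The contribution of the Euler derivative to the defect of self-adjointness. -/
def eulerDefect (α : ℝ) (i : Fin N) (f g : MvPolynomial (Fin N) ℂ) (x : Fin N → ℝ) : ℂ :=
  α * (evc x f * ev x (theta i g) - evc x (theta i f) * ev x g)

/-- The contribution of the exchange of `z_i` and `z_p` to the defect of self-adjointness. -/
def exchangeDefect (i p : Fin N) (f g : MvPolynomial (Fin N) ℂ) (x : Fin N → ℝ) : ℂ :=
  evc x f * ev x (X (max i p) * dd i p g) - evc x (X (max i p) * dd i p f) * ev x g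

/-- The logarithmic derivative of the weight, up to a constant. -/
def weightTerm (i p : Fin N) (x : Fin N → ℝ) : ℂ :=
  (torusPoint x i + torusPoint x p) * (conj (torusPoint x i) - conj (torusPoint x p))

theorem continuous_eulerDefect (α : ℝ) (i : Fin N) (f g : MvPolynomial (Fin N) ℂ) :
    Continuous (eulerDefect α i f g) :=
  continuous_const.mul (((continuous_evc f).mul (continuous_ev _)).sub
    ((continuous_evc _).mul (continuous_ev g)))

theorem continuous_exchangeDefect (i p : Fin N) (f g : MvPolynomial (Fin N) ℂ) :
    Continuous (exchangeDefect i p f g) :=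
  ((continuous_evc f).mul (continuous_ev _)).sub ((continuous_evc _).mul (continuous_ev g))

theorem continuous_weightTerm (i p : Fin N) : Continuous (weightTerm i p) :=
  ((continuous_torusPoint i).add (continuous_torusPoint p)).mul
    ((continuous_conj_torusPoint i).sub (continuous_conj_torusPoint p))

theorem continuous_chordSq_complex (i p : Fin N) :
    Continuous fun x : Fin N → ℝ => (chordSq x i p : ℂ) :=
  Complex.continuous_ofReal.comp (contDiff_chordSq i p).continuous

theorem chordSq_add_ne_zero {ε : ℝ} (hε : 0 < ε) (x : Fin N → ℝ) (i p : Fin N) :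
    ((chordSq x i p : ℂ) + ε) ≠ 0 := by
  exact_mod_cast (add_pos_of_nonneg_of_pos (chordSq_nonneg x i p) hε).ne'

theorem continuous_regWeight_complex {α : ℝ} (hα : 0 < α) (ε : ℝ) :
    Continuous fun x : Fin N → ℝ => (regWeight α ε x : ℂ) :=
  Complex.continuous_ofReal.comp (continuous_regWeight hα ε)

theorem regWeight_add_single (α ε : ℝ) (x : Fin N → ℝ) (i : Fin N) :
    regWeight α ε (x + Pi.single i 1) = regWeight α ε x := by
  simp only [regWeight, chordSq, torusPoint_add_single]

/-- Integration by parts for the regularized weight. -/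
theorem integral_regWeight_eulerDefect {α : ℝ} (hα : 0 < α) {ε : ℝ} (hε : 0 < ε) (i : Fin N)
    (f g : MvPolynomial (Fin N) ℂ) :
    ∫ x in Set.Icc (0 : Fin N → ℝ) 1, (regWeight α ε x : ℂ) * (eulerDefect α i f g x +
      ∑ p ∈ univ.erase i, weightTerm i p x / (chordSq x i p + ε) * (evc x f * ev x g)) = 0 := by
  have hF : ContDiff ℝ 1 fun x : Fin N → ℝ => (regWeight α ε x : ℂ) * (evc x f * ev x g) :=
    (Complex.ofRealCLM.contDiff.comp (contDiff_regWeight α hε)).mul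
      ((contDiff_eval_conj f).mul (contDiff_eval g))
  have h₁ := setIntegral_fderiv_eq_zero i hF fun x => by
    simp only [regWeight_add_single, ev, evc, torusPoint_add_single]
  have h₂ : ∀ x, fderiv ℝ (fun x : Fin N → ℝ => (regWeight α ε x : ℂ) * (evc x f * ev x g)) x
      (Pi.single i 1) = (2 * Real.pi * Complex.I / α) *
        ((regWeight α ε x : ℂ) * (eulerDefect α i f g x +
      ∑ p ∈ univ.erase i, weightTerm i p x / (chordSq x i p + ε) * (evc x f * ev x g))) := by
    intro x
    have hαc : (α : ℂ) ≠ 0 := by exact_mod_cast hα.ne'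
    refine fderiv_eq_of_hasDerivAt_lineTo hF (HasDerivAt.congr_deriv
      ((hasDerivAt_regWeight α hε x i).ofReal_comp.fun_mul
        ((hasDerivAt_evc x i f).fun_mul (hasDerivAt_ev x i g))) ?_)
    simp only [lineTo_zero]
    have h₃ : ((∑ p ∈ univ.erase i, 4 * Real.pi * Real.sin (2 * Real.pi * (x i - x p)) /
        (chordSq x i p + ε) : ℝ) : ℂ) = 2 * Real.pi * Complex.I *
          ∑ p ∈ univ.erase i, weightTerm i p x / (chordSq x i p + ε) := by
      rw [Complex.ofReal_sum, mul_sum]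
      refine sum_congr rfl fun p _ => ?_
      rw [weightTerm, torusPoint_add_mul_conj_sub]
      push_cast
      rw [← mul_div_assoc]
      congr 1
      linear_combination (4 * Real.pi * Complex.sin (2 * Real.pi * (x i - x p))) * Complex.I_sq
    rw [Complex.ofReal_mul, Complex.ofReal_mul, h₃, ← sum_mul, eulerDefect]
    push_cast
    field_simp
    ring
  simp only [h₂] at h₁
  rw [integral_const_mul] at h₁
  refine (mul_eq_zero.mp h₁).resolve_left (div_ne_zero Complex.two_pi_I_ne_zero ?_)
  exact_mod_cast hα.ne'

theorem chordSq_mul_exchangeDefect {i p : Fin N} (f g : MvPolynomial (Fin N) ℂ) (x : Fin N → ℝ) :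
    chordSq x i p * exchangeDefect i p f g x - weightTerm i p x * (evc x f * ev x g) =
      -((conj (torusPoint x i) - conj (torusPoint x p)) *
        (torusPoint x (max i p) * (evc x f * ev (x ∘ Equiv.swap i p) g) +
          torusPoint x (min i p) * (evc (x ∘ Equiv.swap i p) f * ev x g))) := by
  have h₁ := congrArg (ev x) (X_sub_X_mul_dd i p g)
  have h₂ := congrArg (evc x) (X_sub_X_mul_dd i p f)
  have h₃ : ev x (rename (Equiv.swap i p) g) = ev (x ∘ Equiv.swap i p) g := ev_rename _ _ _
  have h₄ : evc x (rename (Equiv.swap i p) f) = evc (x ∘ Equiv.swap i p) f := evc_rename _ _ _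
  have hi := torusPoint_mul_conj x i
  have hp := torusPoint_mul_conj x p
  simp only [exchangeDefect, weightTerm, chordSq_eq_mul]
  simp only [ev, evc, map_mul, map_sub, eval_X] at h₁ h₂ h₃ h₄ ⊢
  rw [h₃] at h₁
  rw [h₄] at h₂
  generalize eval (torusPoint x) (dd i p g) = dg at *
  generalize eval (fun j => conj (torusPoint x j)) (dd i p f) = df at *
  generalize eval (torusPoint x) g = eg at *
  generalize eval (fun j => conj (torusPoint x j)) f = ef at *
  generalize eval (torusPoint (x ∘ Equiv.swap i p)) g = sg at *
  generalize eval (fun j => conj (torusPoint (x ∘ Equiv.swap i p) j)) f = tf at *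
  rcases le_total i p with hle | hle
  · rw [max_eq_right hle, min_eq_left hle]
    generalize conj (torusPoint x i) = a' at *
    generalize conj (torusPoint x p) = b' at *
    generalize torusPoint x i = a at *
    generalize torusPoint x p = b at *
    linear_combination ((a' - b') * b * ef) * h₁ - ((a - b) * b' * eg) * h₂ +
      (ef - tf) * eg * (hp - hi)
  · rw [max_eq_left hle, min_eq_right hle]
    generalize conj (torusPoint x i) = a' at *
    generalize conj (torusPoint x p) = b' at *
    generalize torusPoint x i = a at *
    generalize torusPoint x p = b at *
    linear_combination ((a' - b') * a * ef) * h₁ - ((a - b) * a' * eg) * h₂ +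
      (ef - tf) * eg * (hp - hi)

theorem setIntegral_eq_zero_of_antisymm (τ : Equiv.Perm (Fin N)) {F : (Fin N → ℝ) → ℂ}
    (hF : ∀ x, F (x ∘ τ) = -F x) : ∫ x in Set.Icc (0 : Fin N → ℝ) 1, F x = 0 := by
  have h₁ := setIntegral_comp_perm τ F
  simp only [hF] at h₁
  rw [integral_neg] at h₁
  linear_combination (-1 / 2 : ℂ) * h₁

theorem integral_regWeight_exchangeDefect {α : ℝ} {ε : ℝ} {i p : Fin N}
    (f g : MvPolynomial (Fin N) ℂ) :
    ∫ x in Set.Icc (0 : Fin N → ℝ) 1, (regWeight α ε x : ℂ) *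
      ((chordSq x i p * exchangeDefect i p f g x - weightTerm i p x * (evc x f * ev x g)) /
        (chordSq x i p + ε)) = 0 := by
  refine setIntegral_eq_zero_of_antisymm (Equiv.swap i p) fun x => ?_
  simp only [chordSq_mul_exchangeDefect]
  have h₁ : (x ∘ Equiv.swap i p) ∘ Equiv.swap i p = x := by
    funext j; simp
  have h₂ : ∀ j, torusPoint (x ∘ Equiv.swap i p) j = torusPoint x (Equiv.swap i p j) :=
    fun j => rfl
  have h₃ : chordSq (x ∘ Equiv.swap i p) i p = chordSq x i p := by
    rw [chordSq, chordSq, h₂, h₂, Equiv.swap_apply_left, Equiv.swap_apply_right, norm_sub_rev]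
  rw [h₁, h₃, regWeight_comp_perm]
  simp only [h₂, Equiv.swap_apply_left, Equiv.swap_apply_right]
  rcases le_total i p with hle | hle
  · rw [max_eq_right hle, min_eq_left hle, Equiv.swap_apply_left, Equiv.swap_apply_right]
    ring
  · rw [max_eq_left hle, min_eq_right hle, Equiv.swap_apply_left, Equiv.swap_apply_right]
    ring

/-- The regularized defect of self-adjointness vanishes. -/
theorem integral_regWeight_defect {α : ℝ} (hα : 0 < α) {ε : ℝ} (hε : 0 < ε) (i : Fin N)
    (f g : MvPolynomial (Fin N) ℂ) :
    ∫ x in Set.Icc (0 : Fin N → ℝ) 1, (regWeight α ε x : ℂ) * (eulerDefect α i f g x +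
      ∑ p ∈ univ.erase i, (chordSq x i p / (chordSq x i p + ε) : ℂ) *
        exchangeDefect i p f g x) = 0 := by
  have hfg : Continuous fun x : Fin N → ℝ => evc x f * ev x g :=
    (continuous_evc f).mul (continuous_ev g)
  have hden : ∀ p : Fin N, Continuous fun x : Fin N → ℝ => (chordSq x i p : ℂ) + ε :=
    fun p => (continuous_chordSq_complex i p).add continuous_const
  have hw := continuous_regWeight_complex (N := N) hα ε
  have h₁ : ∀ x : Fin N → ℝ, (regWeight α ε x : ℂ) * (eulerDefect α i f g x +
      ∑ p ∈ univ.erase i, (chordSq x i p / (chordSq x i p + ε) : ℂ) *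
        exchangeDefect i p f g x) =
      (regWeight α ε x : ℂ) * (eulerDefect α i f g x +
        ∑ p ∈ univ.erase i, weightTerm i p x / (chordSq x i p + ε) * (evc x f * ev x g)) +
      ∑ p ∈ univ.erase i, (regWeight α ε x : ℂ) *
        ((chordSq x i p * exchangeDefect i p f g x - weightTerm i p x * (evc x f * ev x g)) /
          (chordSq x i p + ε)) := by
    intro x
    rw [← mul_sum, ← mul_add, add_assoc, ← sum_add_distrib]
    congr 2
    refine sum_congr rfl fun p _ => ?_
    ring
  simp only [h₁]
  rw [integral_add, integral_finsetSum, integral_regWeight_eulerDefect hα hε, zero_add]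
  · exact sum_eq_zero fun p _ => integral_regWeight_exchangeDefect f g
  · intro p _
    refine integrableOn_cube (hw.mul (Continuous.div ?_ (hden p)
      fun x => chordSq_add_ne_zero hε x i p))
    exact ((continuous_chordSq_complex i p).mul (continuous_exchangeDefect i p f g)).sub
      ((continuous_weightTerm i p).mul hfg)
  · refine integrableOn_cube (hw.mul ((continuous_eulerDefect α i f g).add
      (continuous_finsetSum _ fun p _ => ((continuous_weightTerm i p).div (hden p)
        fun x => chordSq_add_ne_zero hε x i p).mul hfg)))
  · refine integrable_finsetSum _ fun p _ => ?_
    refine integrableOn_cube (hw.mul (Continuous.div ?_ (hden p)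
      fun x => chordSq_add_ne_zero hε x i p))
    exact ((continuous_chordSq_complex i p).mul (continuous_exchangeDefect i p f g)).sub
      ((continuous_weightTerm i p).mul hfg)

theorem norm_chordSq_div_le {ε : ℝ} (hε : 0 < ε) (x : Fin N → ℝ) (i p : Fin N) :
    ‖(chordSq x i p / (chordSq x i p + ε) : ℂ)‖ ≤ 1 := by
  have h₁ := chordSq_nonneg x i p
  have h₂ : (chordSq x i p / (chordSq x i p + ε) : ℂ) =
      ((chordSq x i p / (chordSq x i p + ε) : ℝ) : ℂ) := by push_cast; rfl
  rw [h₂, Complex.norm_of_nonneg (by positivity)]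
  exact div_le_one_of_le₀ (by linarith) (by linarith)

theorem regWeight_zero_eq_zero {α : ℝ} (hα : 0 < α) {x : Fin N → ℝ} {i p : Fin N} (hip : p ≠ i)
    (hx : chordSq x i p = 0) : regWeight α 0 x = 0 := by
  refine prod_eq_zero (mem_univ i) (prod_eq_zero (mem_erase.mpr ⟨hip, mem_univ p⟩) ?_)
  rw [hx, add_zero, Real.zero_rpow (by positivity)]

theorem tendsto_regWeight_mul_chordSq_div {α : ℝ} (hα : 0 < α) (x : Fin N → ℝ) {i p : Fin N}
    (hip : p ≠ i) :
    Tendsto (fun ε : ℝ => (regWeight α ε x : ℂ) * (chordSq x i p / (chordSq x i p + ε) : ℂ))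
      (𝓝[>] 0) (𝓝 (regWeight α 0 x)) := by
  have hw : Tendsto (fun ε : ℝ => (regWeight α ε x : ℂ)) (𝓝[>] 0) (𝓝 (regWeight α 0 x)) :=
    (Complex.continuous_ofReal.tendsto _).comp (tendsto_regWeight hα x)
  by_cases hx : chordSq x i p = 0
  · rw [regWeight_zero_eq_zero hα hip hx]
    simp [hx]
  · have hx' : (chordSq x i p : ℂ) ≠ 0 := by exact_mod_cast hx
    have h₁ : Tendsto (fun ε : ℝ => (chordSq x i p : ℂ) + ε) (𝓝[>] 0) (𝓝 (chordSq x i p)) := by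
      have : Continuous fun ε : ℝ => (chordSq x i p : ℂ) + ε :=
        continuous_const.add Complex.continuous_ofReal
      have h₂ := this.tendsto 0
      rw [Complex.ofReal_zero, add_zero] at h₂
      exact h₂.mono_left nhdsWithin_le_nhds
    have h₂ := hw.mul ((tendsto_const_nhds (x := (chordSq x i p : ℂ))).div h₁ hx')
    rwa [div_self hx', mul_one] at h₂

theorem integral_defect {α : ℝ} (hα : 0 < α) (i : Fin N) (f g : MvPolynomial (Fin N) ℂ) :
    ∫ x in Set.Icc (0 : Fin N → ℝ) 1, (regWeight α 0 x : ℂ) * (eulerDefect α i f g x +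
      ∑ p ∈ univ.erase i, exchangeDefect i p f g x) = 0 := by
  set C : ℝ := ∏ j : Fin N, ∏ _k ∈ univ.erase j, (5 : ℝ) ^ (1 / (2 * α)) with hC
  have hC₀ : 0 ≤ C := by rw [hC]; positivity
  have hlim := tendsto_integral_filter_of_dominated_convergence
    (μ := volume.restrict (Set.Icc (0 : Fin N → ℝ) 1)) (l := 𝓝[>] (0 : ℝ))
    (F := fun (ε : ℝ) x => (regWeight α ε x : ℂ) * (eulerDefect α i f g x +
      ∑ p ∈ univ.erase i, (chordSq x i p / (chordSq x i p + ε) : ℂ) * exchangeDefect i p f g x))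
    (f := fun x => (regWeight α 0 x : ℂ) * (eulerDefect α i f g x +
      ∑ p ∈ univ.erase i, exchangeDefect i p f g x))
    (fun x => C * (‖eulerDefect α i f g x‖ + ∑ p ∈ univ.erase i, ‖exchangeDefect i p f g x‖))
    ?_ ?_ ?_ ?_
  · refine tendsto_nhds_unique hlim (tendsto_const_nhds.congr' ?_)
    filter_upwards [self_mem_nhdsWithin] with ε hε
    exact (integral_regWeight_defect hα hε i f g).symm
  · filter_upwards [self_mem_nhdsWithin] with ε hε
    refine Continuous.aestronglyMeasurable ?_
    refine (continuous_regWeight_complex hα ε).mul ((continuous_eulerDefect α i f g).add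
      (continuous_finsetSum _ fun p _ => ?_))
    exact ((continuous_chordSq_complex i p).div
      ((continuous_chordSq_complex i p).add continuous_const)
      fun x => chordSq_add_ne_zero hε x i p).mul (continuous_exchangeDefect i p f g)
  · filter_upwards [Ioo_mem_nhdsGT (zero_lt_one' ℝ)] with ε hε
    refine Eventually.of_forall fun x => ?_
    rw [norm_mul]
    have h₁ : ‖(regWeight α ε x : ℂ)‖ ≤ C := by
      rw [Complex.norm_of_nonneg (regWeight_nonneg α hε.1.le x)]
      exact regWeight_le hα hε.1.le hε.2.le x
    refine mul_le_mul h₁ ?_ (norm_nonneg _) hC₀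
    refine (norm_add_le _ _).trans (add_le_add le_rfl ((norm_sum_le _ _).trans
      (sum_le_sum fun p _ => ?_)))
    rw [norm_mul]
    exact mul_le_of_le_one_left (norm_nonneg _) (norm_chordSq_div_le hε.1 x i p)
  · refine (Continuous.continuousOn ?_).integrableOn_compact isCompact_Icc
    exact continuous_const.mul ((continuous_eulerDefect α i f g).norm.add
      (continuous_finsetSum _ fun p _ => (continuous_exchangeDefect i p f g).norm))
  · refine Eventually.of_forall fun x => ?_
    simp only [mul_add, mul_sum, ← mul_assoc]
    refine Tendsto.add (Tendsto.mul ?_ tendsto_const_nhds) (tendsto_finsetSum _ fun p hp =>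
      (tendsto_regWeight_mul_chordSq_div hα x (mem_erase.mp hp).1).mul tendsto_const_nhds)
    exact (Complex.continuous_ofReal.tendsto _).comp (tendsto_regWeight hα x)

/-- The Cherednik operators are self-adjoint for the torus form. -/
theorem torusForm_xi {α : ℝ} (hα : 0 < α) (i : Fin N) (f g : MvPolynomial (Fin N) ℂ) :
    torusForm hα (xi α i f) g = torusForm hα f (xi α i g) := by
  rw [eq_comm, ← sub_eq_zero, torusForm_apply, torusForm_apply, torusInner_eq, torusInner_eq,
    ← integral_sub (integrableOn_cube (continuous_weight_mul hα _ _))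
      (integrableOn_cube (continuous_weight_mul hα _ _)), ← integral_defect hα i f g]
  congr 1
  funext x
  rw [← mul_sub]
  congr 1
  simp only [eulerDefect, exchangeDefect, ev, evc, xi_apply, map_add, map_sub, map_sum, smul_eval,
    sum_sub_distrib, ← mul_sum, ← sum_mul]
  ring

end JackTorus

end

noncomputable section

namespace JackTorus

open Finset MvPolynomial

variable {N : ℕ}

/-! ### Tied rows -/

theorem prod_card_gt {M : Type*} [CommMonoid M] (F : ℕ → M) (S : Finset (Fin N)) :
    ∏ a ∈ S, F (S.filter (a < ·)).card = ∏ t ∈ range S.card, F t := by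
  induction S using Finset.induction_on_min with
  | empty => simp
  | insert m S hm ih =>
    have hmS : m ∉ S := fun h₁ => lt_irrefl _ (hm m h₁)
    rw [prod_insert hmS, card_insert_of_notMem hmS, prod_range_succ, ← ih, mul_comm]
    congr 1
    · refine prod_congr rfl fun a ha => ?_
      rw [filter_insert, if_neg (hm a ha).not_gt]
    · rw [filter_insert, if_neg (lt_irrefl m), filter_true_of_mem hm]

theorem prod_eq_prod_parts {M : Type*} [CommMonoid M] (η : Fin N → ℕ) (G : Fin N → M) :
    ∏ a, G a = ∏ v ∈ range (univ.sup η + 1), ∏ a ∈ univ.filter (η · = v), G a :=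
  (prod_fiberwise_of_maps_to
    (fun a _ => mem_range.mpr (Nat.lt_succ_of_le (le_sup (mem_univ a)))) G).symm

theorem prod_ties_gt {M : Type*} [CommMonoid M] (F : ℕ → ℕ → M) (η : Fin N → ℕ) :
    ∏ a, F (η a) (univ.filter fun k => a < k ∧ η k = η a).card =
      ∏ v ∈ range (univ.sup η + 1), ∏ t ∈ range (freq η v), F v t := by
  rw [prod_eq_prod_parts η]
  refine prod_congr rfl fun v _ => ?_
  rw [freq, ← prod_card_gt]
  refine prod_congr rfl fun a ha => ?_
  have h₁ : η a = v := (mem_filter.mp ha).2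
  rw [h₁, filter_filter]
  simp only [and_comm]

theorem prod_ties_gt_succ (η : Fin N → ℕ) :
    ∏ a, ((univ.filter fun k => a < k ∧ η k = η a).card + 1) = freqFactorial η := by
  rw [prod_ties_gt (fun _ t => t + 1), freqFactorial]
  exact prod_congr rfl fun v _ => prod_range_add_one_eq_factorial _

theorem card_stabilizer (η : Fin N → ℕ) :
    (univ.filter fun τ : Equiv.Perm (Fin N) => η ∘ τ = η).card = freqFactorial η := by
  rw [← Fintype.card_subtype, DomMulAct.stabilizer_card', freqFactorial]
  have h₁ : ∀ v, Fintype.card {a // η a = v} = freq η v := fun v => by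
    rw [Fintype.card_subtype, freq]
  simp only [h₁]
  refine prod_subset ?_ fun v _ hv => ?_
  · intro v hv
    obtain ⟨a, -, rfl⟩ := mem_image.mp hv
    exact mem_range.mpr (Nat.lt_succ_of_le (le_sup (mem_univ a)))
  · have : freq η v = 0 := by
      rw [freq, card_eq_zero, filter_eq_empty_iff]
      intro a _ ha
      exact hv (mem_image.mpr ⟨a, mem_univ a, ha⟩)
    rw [this, Nat.factorial_zero]

/-! ### Products over ranked pairs of rows -/

/-- The product over the pairs of rows `(a, b)` such that `a` precedes `b` in the ranking of `η`, of
`A` or `B` at the difference of eigenvalues, according to whether `a < b` or `b < a`. -/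
def pairProd (α : ℝ) (A B : ℝ → ℝ) (η : Fin N → ℕ) : ℝ :=
  ∏ p : Fin N × Fin N, if Beats η p.1 p.2 then
    (if p.1 < p.2 then A (bar α η p.1 - bar α η p.2) else B (bar α η p.1 - bar α η p.2)) else 1

theorem pairProd_comp_swap (α : ℝ) (A B : ℝ → ℝ) {η : Fin N → ℕ} {i j : Fin N}
    (hij : (i : ℕ) + 1 = j) (hη : η i < η j) :
    pairProd α A B (η ∘ Equiv.swap i j) * B (bar α η j - bar α η i) =
      pairProd α A B η * A (bar α η j - bar α η i) := by
  have hlt : i < j := Fin.lt_def.mpr (by omega)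
  have hne : η i ≠ η j := hη.ne
  have hb : Beats η j i := Or.inl hη
  have h₁ : pairProd α A B (η ∘ Equiv.swap i j) = ∏ p : Fin N × Fin N, if Beats η p.1 p.2 then
      (if Equiv.swap i j p.1 < Equiv.swap i j p.2 then A (bar α η p.1 - bar α η p.2)
        else B (bar α η p.1 - bar α η p.2)) else 1 := by
    rw [pairProd, ← Equiv.prod_comp ((Equiv.swap i j).prodCongr (Equiv.swap i j))]
    refine prod_congr rfl fun p _ => ?_
    simp only [Equiv.prodCongr_apply, Prod.map_fst, Prod.map_snd, beats_comp_swap hij hne,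
      bar_comp_swap α hij hne, Function.comp, Equiv.swap_apply_self]
  rw [h₁, pairProd, ← mul_prod_erase univ _ (mem_univ ((j, i) : Fin N × Fin N)),
    ← mul_prod_erase univ _ (mem_univ ((j, i) : Fin N × Fin N))]
  simp only [Equiv.swap_apply_left, Equiv.swap_apply_right, if_pos hb, if_pos hlt,
    if_neg hlt.not_gt]
  have h₂ : ∏ p ∈ univ.erase ((j, i) : Fin N × Fin N), (if Beats η p.1 p.2 then
      (if Equiv.swap i j p.1 < Equiv.swap i j p.2 then A (bar α η p.1 - bar α η p.2)
        else B (bar α η p.1 - bar α η p.2)) else 1) =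
      ∏ p ∈ univ.erase ((j, i) : Fin N × Fin N), (if Beats η p.1 p.2 then
      (if p.1 < p.2 then A (bar α η p.1 - bar α η p.2)
        else B (bar α η p.1 - bar α η p.2)) else 1) := by
    refine prod_congr rfl fun p hp => ?_
    by_cases hbp : Beats η p.1 p.2
    · rw [if_pos hbp, if_pos hbp]
      congr 1
      rw [eq_iff_iff]
      refine swap_lt_swap_iff hij ?_ ?_
      · rintro ⟨h₁, h₂⟩
        rw [h₁, h₂] at hbp
        exact hb.asymm hbp
      · rintro ⟨h₁, h₂⟩
        exact (mem_erase.mp hp).1 (Prod.ext h₁ h₂)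
    · rw [if_neg hbp, if_neg hbp]
  rw [h₂]
  ring

theorem pairProd_raise {n : ℕ} {α : ℝ} {A B : ℝ → ℝ} (hAB : ∀ x, B (x + α) = A x)
    (η : Fin (n + 1) → ℕ) : pairProd α A B (raise η) = pairProd α A B η := by
  rw [pairProd, pairProd,
    ← Equiv.prod_comp ((finRotate (n + 1)).prodCongr (finRotate (n + 1))) fun p =>
      if Beats η p.1 p.2 then (if p.1 < p.2 then A (bar α η p.1 - bar α η p.2)
        else B (bar α η p.1 - bar α η p.2)) else 1]
  refine prod_congr rfl fun p _ => ?_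
  simp only [Equiv.prodCongr_apply, Prod.map_fst, Prod.map_snd, beats_raise, bar_raise]
  obtain ⟨a, b⟩ := p
  simp only
  by_cases hb : Beats η (finRotate (n + 1) a) (finRotate (n + 1) b)
  swap
  · rw [if_neg hb, if_neg hb]
  rw [if_pos hb, if_pos hb]
  simp only [Fin.lt_def, rotate_val]
  have ha' := a.isLt
  have hb' := b.isLt
  by_cases h₁ : a = Fin.last n
  · by_cases h₂ : b = Fin.last n
    · exact absurd hb (by rw [h₁, h₂]; exact Beats.irrefl _)
    · rw [if_pos h₁, if_pos h₁, if_neg h₂, if_neg h₂, if_neg, if_pos, ← hAB]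
      · congr 1; ring
      · omega
      · rw [h₁, Fin.val_last]; omega
  · by_cases h₂ : b = Fin.last n
    · rw [if_pos h₂, if_pos h₂, if_neg h₁, if_neg h₁, if_pos, if_neg, ← hAB]
      · congr 1; ring
      · omega
      · have : (a : ℕ) ≠ n := fun he => h₁ (Fin.ext he)
        rw [h₂, Fin.val_last]; omega
    · rw [if_neg h₁, if_neg h₁, if_neg h₂, if_neg h₂, add_zero, add_zero]
      simp only [add_lt_add_iff_right]

theorem pairProd_antitone (α : ℝ) (A B : ℝ → ℝ) {κ : Fin N → ℕ} (hκ : Antitone κ) :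
    pairProd α A B κ = ∏ p : Fin N × Fin N,
      if p.1 < p.2 then A (bar α κ p.1 - bar α κ p.2) else 1 := by
  refine prod_congr rfl fun p _ => ?_
  simp only [beats_antitone hκ]
  split_ifs <;> rfl

theorem prod_one_add_inv {a : Fin N} (T : Finset (Fin N)) (h₁ : ∀ b ∈ T, a < b)
    (h₂ : ∀ b ∈ T, ∀ c, a < c → c < b → c ∈ T) :
    ∏ b ∈ T, (1 + 1 / ((b : ℕ) - (a : ℕ) : ℝ)) = T.card + 1 := by
  induction T using Finset.induction_on_max with
  | empty => simp
  | insert m T hm ih =>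
    have hmT : m ∉ T := fun h₁ => lt_irrefl _ (hm m h₁)
    have hT : T = Ioo a m := by
      ext c
      rw [mem_Ioo]
      refine ⟨fun hc => ⟨h₁ c (mem_insert_of_mem hc), hm c hc⟩, fun hc => ?_⟩
      exact (mem_insert.mp (h₂ m (mem_insert_self _ _) c hc.1 hc.2)).resolve_left hc.2.ne
    have ham : a < m := h₁ m (mem_insert_self _ _)
    have hcard : (T.card : ℝ) + 1 = (m : ℕ) - (a : ℕ) := by
      rw [hT, Fin.card_Ioo]
      have : (a : ℕ) < m := ham
      rw [Nat.cast_sub (by omega), Nat.cast_sub (by omega)]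
      push_cast; ring
    have hne : ((m : ℕ) - (a : ℕ) : ℝ) ≠ 0 := by
      have : ((a : ℕ) : ℝ) < (m : ℕ) := by exact_mod_cast ham
      linarith
    rw [prod_insert hmT, card_insert_of_notMem hmT, ih (fun b hb => h₁ b (mem_insert_of_mem hb))
      (fun b hb c hac hcb => ?_)]
    · push_cast
      rw [hcard]
      field_simp
    · exact (mem_insert.mp (h₂ b (mem_insert_of_mem hb) c hac hcb)).resolve_left
        (hcb.trans (hm b hb)).ne

theorem pairProd_monotone (α : ℝ) {η : Fin N → ℕ} (hη : Monotone η) :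
    pairProd α (fun x => 1 + 1 / x) (fun _ => 1) η = freqFactorial η := by
  have hcol : ∀ a b : Fin N, a < b → η b = η a → bar α η a - bar α η b = (b : ℕ) - (a : ℕ) := by
    intro a b hab he
    have h₁ : coleg η b = coleg η a + ((b : ℕ) - a) := by
      rw [coleg_eq, coleg_eq, ← Fin.card_Ico, ← card_union_of_disjoint]
      · congr 1
        ext k
        simp only [mem_union, mem_filter, mem_univ, true_and, mem_Ico]
        unfold Beats
        rw [he]
        have h₂ : a ≤ k → k < b → η k = η a := fun h₂ h₃ =>
          le_antisymm (he ▸ hη h₃.le) (hη h₂)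
        constructor
        · rintro (h₃ | ⟨h₃, h₄⟩)
          · exact Or.inl (Or.inl h₃)
          · rcases lt_or_ge k a with h₅ | h₅
            · exact Or.inl (Or.inr ⟨h₃, h₅⟩)
            · exact Or.inr ⟨h₅, h₄⟩
        · rintro ((h₃ | ⟨h₃, h₄⟩) | ⟨h₃, h₄⟩)
          · exact Or.inl h₃
          · exact Or.inr ⟨h₃, h₄.trans hab⟩
          · exact Or.inr ⟨h₂ h₃ h₄, h₄⟩
      · rw [disjoint_left]
        intro k h₂ h₃
        have h₄ := (mem_filter.mp h₂).2
        have h₅ := mem_Ico.mp h₃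
        have h₆ := hη h₅.2.le
        have h₇ := h₅.1
        unfold Beats at h₄
        omega
    have h₂ : (a : ℕ) ≤ b := hab.le
    unfold bar
    rw [h₁, he, Nat.cast_add, Nat.cast_sub h₂]
    ring
  rw [pairProd, ← prod_ties_gt_succ, Fintype.prod_prod_type]
  push_cast
  refine prod_congr rfl fun a _ => ?_
  rw [← prod_one_add_inv (a := a), prod_filter]
  · refine prod_congr rfl fun b _ => ?_
    by_cases hab : a < b
    · by_cases he : η b = η a
      · rw [if_pos (show Beats η a b from Or.inr ⟨he.symm, hab⟩), if_pos hab, if_pos ⟨hab, he⟩, hcol a b hab he]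
      · have := hη hab.le
        rw [if_neg (fun hb : Beats η a b => by unfold Beats at hb; omega),
          if_neg (fun h₁ => he h₁.2)]
    · rw [if_neg hab, ite_self, if_neg (fun h₁ => hab h₁.1)]
  · intro b hb; exact (mem_filter.mp hb).2.1
  · intro b hb c hac hcb
    have h₁ := (mem_filter.mp hb).2
    refine mem_filter.mpr ⟨mem_univ _, hac, ?_⟩
    exact le_antisymm (h₁.2 ▸ hη hcb.le) (hη hac.le)

end JackTorus

end

noncomputable section

namespace JackTorus

open Finset MvPolynomial

variable {N : ℕ}

/-! ### Nonsymmetric Jack polynomials -/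

theorem rename_swap_rename_swap (i j : Fin N) (f : MvPolynomial (Fin N) ℂ) :
    rename (Equiv.swap i j) (rename (Equiv.swap i j) f) = f := by
  rw [rename_rename, ← Equiv.coe_trans, Equiv.swap_swap]; simp

theorem comp_swap_comp_swap {β : Type*} (η : Fin N → β) (i j : Fin N) :
    (η ∘ Equiv.swap i j) ∘ Equiv.swap i j = η := by
  funext a; simp

theorem IsJoint.orthogonal {α : ℝ} (hα : 0 < α) {c c' : Fin N → ℝ} {f g : MvPolynomial (Fin N) ℂ}
    (hf : IsJoint α c f) (hg : IsJoint α c' g) (hc : c ≠ c') : torusForm hα f g = 0 := by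
  obtain ⟨i, hi⟩ := Function.ne_iff.mp hc
  have h₁ := torusForm_xi hα i f g
  rw [hf i, hg i, map_smul, LinearMap.smul_apply, map_smul, smul_eq_mul, smul_eq_mul,
    ← sub_eq_zero, ← sub_mul] at h₁
  refine (mul_eq_zero.mp h₁).resolve_left (sub_ne_zero.mpr ?_)
  exact_mod_cast hi

theorem IsJoint.eq_of_co {α : ℝ} (hα : 0 < α) {η : Fin N → ℕ} {f g : MvPolynomial (Fin N) ℂ}
    (hf : IsJoint α (bar α η) f) (hg : IsJoint α (bar α η) g) (h : co η f = co η g) : f = g := by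
  refine sub_eq_zero.mp (IsJoint.eq_zero hα (η := η) (fun i => ?_) ?_)
  · rw [map_sub, hf i, hg i, smul_sub]
  · rw [map_sub, h, sub_self]

theorem IsJoint.swap {α : ℝ} {c : Fin N → ℝ} {f : MvPolynomial (Fin N) ℂ} (hf : IsJoint α c f)
    {i j : Fin N} (hij : (i : ℕ) + 1 = j) (hc : c i ≠ c j) :
    IsJoint α (c ∘ Equiv.swap i j)
      (rename (Equiv.swap i j) f + ((1 / (c j - c i) : ℝ) : ℂ) • f) := by
  have hc' : (c j : ℂ) - c i ≠ 0 := sub_ne_zero.mpr (by exact_mod_cast hc.symm)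
  have hinv : (1 / ((c j : ℂ) - c i)) * (c j - c i) = 1 := one_div_mul_cancel hc'
  push_cast
  intro m
  rw [map_add, map_smul, hf m]
  by_cases hm : m = i
  · subst hm
    have h₁ := rename_swap_xi_right α hij f
    rw [hf j, map_smul, eq_sub_iff_add_eq] at h₁
    rw [← h₁, Function.comp, Equiv.swap_apply_left]
    linear_combination (norm := module) (-hinv) • f
  by_cases hm' : m = j
  · subst hm'
    have h₁ := rename_swap_xi_left α hij f
    rw [hf i, map_smul, ← sub_eq_iff_eq_add] at h₁
    rw [← h₁, Function.comp, Equiv.swap_apply_right]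
    linear_combination (norm := module) hinv • f
  · have h₁ := rename_swap_xi_of_ne α hij hm hm' f
    rw [hf m, map_smul] at h₁
    rw [← h₁, Function.comp, Equiv.swap_apply_of_ne_of_ne hm hm']
    module

/-- The quotient `Γ(x + 1 + k) Γ(x + 1 - k) / Γ(x + 1)²`. -/
def gammaQuot (k x : ℝ) : ℝ :=
  Real.Gamma (x + 1 + k) * Real.Gamma (x + 1 - k) / Real.Gamma (x + 1) ^ 2

theorem gammaQuot_sub_one {k y : ℝ} (hk : 0 < k) (hy : k < y) :
    gammaQuot k y = (1 - (k / y) ^ 2) * gammaQuot k (y - 1) := by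
  have hy₀ : 0 < y := hk.trans hy
  unfold gammaQuot
  rw [sub_add_cancel, show y + 1 + k = (y + k) + 1 by ring, show y + 1 - k = (y - k) + 1 by ring,
    Real.Gamma_add_one (by linarith), Real.Gamma_add_one (by linarith),
    Real.Gamma_add_one hy₀.ne']
  have := (Real.Gamma_pos_of_pos hy₀).ne'
  field_simp
  ring

theorem gammaQuot_pos {k x : ℝ} (hk : 0 < k) (hx : k < x + 1) : 0 < gammaQuot k x := by
  unfold gammaQuot
  have h₁ := Real.Gamma_pos_of_pos (show 0 < x + 1 + k by linarith)
  have h₂ := Real.Gamma_pos_of_pos (show 0 < x + 1 - k by linarith)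
  have h₃ := Real.Gamma_pos_of_pos (show 0 < x + 1 by linarith)
  positivity

/-- The squared norm of the nonsymmetric Jack polynomial, up to a constant. -/
def normProd (α : ℝ) (η : Fin N → ℕ) : ℝ :=
  pairProd α (fun x => gammaQuot (1 / α) (x / α)) (fun x => gammaQuot (1 / α) (x / α - 1)) η

theorem normProd_comp_swap {α : ℝ} (hα : 0 < α) {η : Fin N → ℕ} {i j : Fin N}
    (hij : (i : ℕ) + 1 = j) (hη : η i < η j) :
    normProd α (η ∘ Equiv.swap i j) =
      (1 - (1 / (bar α η j - bar α η i)) ^ 2) * normProd α η := by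
  have hk : 0 < 1 / α := one_div_pos.mpr hα
  have hb : Beats η j i := Or.inl hη
  set y := (bar α η j - bar α η i) / α with hy
  have h₁ : 1 / α + 1 ≤ y := by
    have h₂ := bar_sub_of_beats α hb
    have h₃ : (1 : ℝ) ≤ (η j : ℝ) - η i := by
      have : (η i : ℝ) + 1 ≤ η j := by exact_mod_cast hη
      linarith
    rw [hy, le_div_iff₀ hα, add_mul, one_div_mul_cancel hα.ne']
    nlinarith
  have h₂ := pairProd_comp_swap α (fun x => gammaQuot (1 / α) (x / α))
    (fun x => gammaQuot (1 / α) (x / α - 1)) hij hη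
  simp only [← hy] at h₂
  rw [gammaQuot_sub_one (y := y) hk (by linarith)] at h₂
  have h₃ : gammaQuot (1 / α) (y - 1) ≠ 0 := (gammaQuot_pos hk (by linarith)).ne'
  have h₄ : 1 / α / y = 1 / (bar α η j - bar α η i) := by
    rw [hy]
    field_simp
  rw [h₄] at h₂
  apply mul_right_cancel₀ h₃
  unfold normProd
  rw [h₂]
  ring

theorem normProd_raise {n : ℕ} {α : ℝ} (hα : 0 < α) (η : Fin (n + 1) → ℕ) :
    normProd α (raise η) = normProd α η :=
  pairProd_raise (fun x => by simp only [add_div, div_self hα.ne', add_sub_cancel_right]) η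

theorem bar_lt_bar_of_lt {α : ℝ} (hα : 0 < α) {η : Fin N → ℕ} {i j : Fin N} (hη : η i < η j) :
    bar α η i < bar α η j := bar_lt_of_beats hα (Or.inl hη)

/-- The defining properties of the nonsymmetric Jack polynomial, and its norm. -/
structure IsNonsymmetricJack {α : ℝ} (hα : 0 < α) (η : Fin N → ℕ) (f : MvPolynomial (Fin N) ℂ) :
    Prop where
  joint : IsJoint α (bar α η) f
  monic : co η f = 1
  norm : torusForm hα f f * normProd α (0 : Fin N → ℕ) =
    torusForm hα (1 : MvPolynomial (Fin N) ℂ) 1 * normProd α η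

theorem mon_zero : mon (0 : Fin N → ℕ) = 1 := by
  have : Finsupp.equivFunOnFinite.symm (0 : Fin N → ℕ) = 0 := Finsupp.ext fun _ => rfl
  rw [mon, this]
  exact C_1

theorem isNonsymmetricJack_one {α : ℝ} (hα : 0 < α) :
    IsNonsymmetricJack hα (0 : Fin N → ℕ) 1 := by
  refine ⟨fun i => ?_, ?_, rfl⟩
  · have h₁ : lowerSpan (0 : Fin N → ℕ) = ⊥ := by
      rw [lowerSpan, Submodule.span_eq_bot]
      rintro _ ⟨ν, hν, rfl⟩
      exfalso
      have h₂ := hν.1.1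
      simp only [Pi.zero_apply, sum_const_zero, sum_eq_zero_iff, mem_univ, true_implies] at h₂
      have h₃ : ν = 0 := funext h₂
      rw [h₃] at hν
      exact lt_irrefl _ hν.2
    have h₂ := isTriangular_xi α i (0 : Fin N → ℕ)
    rw [h₁, Submodule.mem_bot, sub_eq_zero, mon_zero] at h₂
    exact h₂
  · rw [← mon_zero, co_mon, if_pos rfl]

theorem IsNonsymmetricJack.raise {n : ℕ} {α : ℝ} {hα : 0 < α} {η : Fin (n + 1) → ℕ}
    {f : MvPolynomial (Fin (n + 1)) ℂ} (hf : IsNonsymmetricJack hα η f) :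
    IsNonsymmetricJack hα (JackTorus.raise η) (raiseOp f) := by
  have hsmul : ∀ (c : ℂ) (g : MvPolynomial (Fin (n + 1)) ℂ), raiseOp (c • g) = c • raiseOp g :=
    fun c g => by rw [raiseOp, map_smul, mul_smul_comm, raiseOp]
  refine ⟨fun i => ?_, ?_, ?_⟩
  · rw [bar_raise]
    by_cases hi : i = Fin.last n
    · subst hi
      rw [xi_raiseOp_last, if_pos rfl, finRotate_last, hf.joint, hsmul]
      push_cast
      rw [add_smul]
    · rw [xi_raiseOp_of_ne α hi, if_neg hi, hf.joint, hsmul, add_zero]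
  · rw [co_raise, hf.monic]
  · rw [torusForm_raiseOp, normProd_raise hα, hf.norm]

theorem IsNonsymmetricJack.swap {α : ℝ} {hα : 0 < α} {η : Fin N → ℕ}
    {f : MvPolynomial (Fin N) ℂ} (hf : IsNonsymmetricJack hα η f) {i j : Fin N}
    (hij : (i : ℕ) + 1 = j) (hη : η i < η j) :
    IsNonsymmetricJack hα (η ∘ Equiv.swap i j)
      (rename (Equiv.swap i j) f + ((1 / (bar α η j - bar α η i) : ℝ) : ℂ) • f) := by
  have hlt : i < j := Fin.lt_def.mpr (by omega)
  have hbar := bar_lt_bar_of_lt hα hη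
  have hjoint : IsJoint α (bar α (η ∘ Equiv.swap i j))
      (rename (Equiv.swap i j) f + ((1 / (bar α η j - bar α η i) : ℝ) : ℂ) • f) := by
    rw [bar_comp_swap α hij hη.ne]
    exact hf.joint.swap hij hbar.ne
  have hbelow : Below η (η ∘ Equiv.swap i j) := by
    have := below_swap (η := η ∘ Equiv.swap i j) hlt (by simpa using hη)
    rwa [comp_swap_comp_swap] at this
  refine ⟨hjoint, ?_, ?_⟩
  · rw [map_add, map_smul, co_rename, comp_swap_comp_swap, hf.monic]
    have : co (η ∘ Equiv.swap i j) f = 0 := by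
      by_contra hn
      rcases hf.joint.support hα hn with h₁ | h₁
      · rw [h₁] at hbelow; exact lt_irrefl _ hbelow.2
      · exact lt_asymm hbelow.2 h₁.2
    rw [this, smul_zero, add_zero]
  · set c : ℂ := ((1 / (bar α η j - bar α η i) : ℝ) : ℂ) with hc
    have h₁ : torusForm hα (rename (Equiv.swap i j) f + c • f) f = 0 := by
      refine hjoint.orthogonal hα hf.joint fun he => ?_
      rw [bar_comp_swap α hij hη.ne] at he
      have := congrFun he i
      simp only [Function.comp, Equiv.swap_apply_left] at this
      exact hbar.ne' this
    have h₂ : torusForm hα f (rename (Equiv.swap i j) f) =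
        torusForm hα (rename (Equiv.swap i j) f) f := by
      rw [← torusForm_rename hα (Equiv.swap i j), rename_swap_rename_swap]
    rw [normProd_comp_swap hα hij hη]
    push_cast at hc ⊢
    rw [← hc, mul_left_comm, ← hf.norm]
    simp only [map_add, map_smul, LinearMap.add_apply, LinearMap.smul_apply, smul_eq_mul,
      torusForm_rename, h₂] at h₁ ⊢
    linear_combination (2 * c * normProd α (0 : Fin N → ℕ)) * h₁

theorem exists_isNonsymmetricJack {α : ℝ} (hα : 0 < α) (η : Fin N → ℕ) :
    ∃ f, IsNonsymmetricJack hα η f := by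
  cases N with
  | zero => exact ⟨1, by rw [Subsingleton.elim η 0]; exact isNonsymmetricJack_one hα⟩
  | succ n =>
    refine composition_induction (Q := fun η => ∃ f, IsNonsymmetricJack hα η f)
      ⟨1, isNonsymmetricJack_one hα⟩ ?_ ?_ η
    · rintro η ⟨f, hf⟩; exact ⟨_, hf.raise⟩
    · rintro η i j hij hη ⟨f, hf⟩; exact ⟨_, hf.swap hij hη⟩

/-- The nonsymmetric Jack polynomial `E_η`. -/
def nsJack {α : ℝ} (hα : 0 < α) (η : Fin N → ℕ) : MvPolynomial (Fin N) ℂ :=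
  (exists_isNonsymmetricJack hα η).choose

theorem nsJack_spec {α : ℝ} (hα : 0 < α) (η : Fin N → ℕ) :
    IsNonsymmetricJack hα η (nsJack hα η) :=
  (exists_isNonsymmetricJack hα η).choose_spec

theorem nsJack_comp_swap {α : ℝ} (hα : 0 < α) {η : Fin N → ℕ} {i j : Fin N}
    (hij : (i : ℕ) + 1 = j) (hη : η i < η j) :
    nsJack hα (η ∘ Equiv.swap i j) = rename (Equiv.swap i j) (nsJack hα η) +
      ((1 / (bar α η j - bar α η i) : ℝ) : ℂ) • nsJack hα η := by
  have h₁ := (nsJack_spec hα η).swap hij hη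
  have h₂ := nsJack_spec hα (η ∘ Equiv.swap i j)
  exact h₂.joint.eq_of_co hα h₁.joint (h₂.monic.trans h₁.monic.symm)

theorem rename_swap_nsJack_of_eq {α : ℝ} (hα : 0 < α) {η : Fin N → ℕ} {i j : Fin N}
    (hij : (i : ℕ) + 1 = j) (hη : η i = η j) :
    rename (Equiv.swap i j) (nsJack hα η) = nsJack hα η := by
  have hne : i ≠ j := by rintro rfl; omega
  have hs := nsJack_spec hα η
  have hbar : bar α η i ≠ bar α η j := fun he => hne (bar_injective hα η he)
  have hg := hs.joint.swap hij hbar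
  set c : ℂ := ((1 / (bar α η j - bar α η i) : ℝ) : ℂ)
  have hzero : rename (Equiv.swap i j) (nsJack hα η) + c • nsJack hα η = 0 := by
    by_contra hn
    obtain ⟨ν, -, hν⟩ := hg.exists_bar hn
    have h₁ := eq_comp_of_bar_eq_comp hα (Equiv.swap i j) hν.symm
    rw [comp_swap_of_eq hη] at h₁
    rw [h₁] at hν
    have h₂ := congrFun hν j
    simp only [Function.comp, Equiv.swap_apply_right] at h₂
    exact hbar h₂
  have hco := congrArg (co η) hzero
  rw [map_add, map_smul, co_rename, comp_swap_of_eq hη, hs.monic, map_zero, smul_eq_mul,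
    mul_one] at hco
  have hc : c = -1 := by linear_combination hco
  rw [hc, neg_smul, one_smul, add_neg_eq_zero] at hzero
  exact hzero

/-! ### The symmetrization of a nonsymmetric Jack polynomial -/

theorem perm_mul_induction {Q : Equiv.Perm (Fin N) → Prop} (h₁ : Q 1)
    (hs : ∀ τ (i j : Fin N), (i : ℕ) + 1 = j → Q τ → Q (τ * Equiv.swap i j))
    (τ : Equiv.Perm (Fin N)) : Q τ := by
  cases N with
  | zero => rwa [Subsingleton.elim τ 1]
  | succ n =>
    refine Submonoid.induction_of_closure_eq_top_right
      (Equiv.Perm.mclosure_swap_castSucc_succ n) τ h₁ ?_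
    rintro τ _ ⟨i, rfl⟩ hτ
    exact hs τ _ _ (by simp) hτ

/-- The span of the nonsymmetric Jack polynomials of the rearrangements of `κ`. -/
def orbitSpan {α : ℝ} (hα : 0 < α) (κ : Fin N → ℕ) : Submodule ℂ (MvPolynomial (Fin N) ℂ) :=
  Submodule.span ℂ (Set.range fun τ : Equiv.Perm (Fin N) => nsJack hα (κ ∘ τ))

theorem nsJack_mem_orbitSpan {α : ℝ} (hα : 0 < α) (κ : Fin N → ℕ) (τ : Equiv.Perm (Fin N)) :
    nsJack hα (κ ∘ τ) ∈ orbitSpan hα κ := Submodule.subset_span ⟨τ, rfl⟩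

theorem rename_swap_nsJack_mem {α : ℝ} (hα : 0 < α) (κ : Fin N → ℕ) {i j : Fin N}
    (hij : (i : ℕ) + 1 = j) (τ : Equiv.Perm (Fin N)) :
    rename (Equiv.swap i j) (nsJack hα (κ ∘ τ)) ∈ orbitSpan hα κ := by
  have hmem : nsJack hα ((κ ∘ τ) ∘ Equiv.swap i j) ∈ orbitSpan hα κ :=
    nsJack_mem_orbitSpan hα κ (τ * Equiv.swap i j)
  have hmem' := nsJack_mem_orbitSpan hα κ τ
  rcases lt_trichotomy ((κ ∘ τ) i) ((κ ∘ τ) j) with hlt | heq | hgt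
  · have h₁ := nsJack_comp_swap hα hij hlt
    rw [← sub_eq_iff_eq_add] at h₁
    rw [← h₁]
    exact Submodule.sub_mem _ hmem (Submodule.smul_mem _ _ hmem')
  · rw [rename_swap_nsJack_of_eq hα hij heq]
    exact hmem'
  · have h₁ := nsJack_comp_swap hα (η := (κ ∘ τ) ∘ Equiv.swap i j) hij (by simpa using hgt)
    rw [comp_swap_comp_swap] at h₁
    have h₂ := nsJack_comp_swap hα (η := (κ ∘ τ) ∘ Equiv.swap i j) hij (by simpa using hgt)
    rw [comp_swap_comp_swap] at h₂
    have h₃ := congrArg (rename (Equiv.swap i j)) h₁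
    rw [map_add, rename_swap_rename_swap, map_smul] at h₃
    rw [← sub_eq_iff_eq_add] at h₁
    rw [h₃, ← h₁]
    exact Submodule.add_mem _ hmem (Submodule.smul_mem _ _
      (Submodule.sub_mem _ hmem' (Submodule.smul_mem _ _ hmem)))

theorem rename_mem_orbitSpan {α : ℝ} (hα : 0 < α) (κ : Fin N → ℕ) (τ : Equiv.Perm (Fin N)) :
    ∀ f ∈ orbitSpan hα κ, rename τ f ∈ orbitSpan hα κ := by
  refine perm_mul_induction
    (Q := fun τ => ∀ f ∈ orbitSpan hα κ, rename τ f ∈ orbitSpan hα κ) ?_ ?_ τ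
  · intro f hf; simpa using hf
  · intro τ i j hij hτ f hf
    have h₁ : rename (Equiv.swap i j) f ∈ orbitSpan hα κ := by
      have : orbitSpan hα κ ≤
          (orbitSpan hα κ).comap (rename (R := ℂ) (Equiv.swap i j)).toLinearMap := by
        refine Submodule.span_le.mpr ?_
        rintro _ ⟨ρ, rfl⟩
        exact rename_swap_nsJack_mem hα κ hij ρ
      exact this hf
    have h₂ := hτ _ h₁
    rwa [rename_rename] at h₂

/-- The symmetrization `∑_σ σ f`. -/
def symmetrize (f : MvPolynomial (Fin N) ℂ) : MvPolynomial (Fin N) ℂ :=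
  ∑ τ : Equiv.Perm (Fin N), rename τ f

theorem symmetrize_isSymmetric (f : MvPolynomial (Fin N) ℂ) : (symmetrize f).IsSymmetric := by
  intro σ
  rw [symmetrize, map_sum, ← Equiv.sum_comp (Equiv.mulLeft σ) fun τ => rename τ f]
  refine sum_congr rfl fun τ _ => ?_
  rw [rename_rename]; rfl

theorem symmetrize_mem_orbitSpan {α : ℝ} (hα : 0 < α) (κ : Fin N → ℕ) :
    symmetrize (nsJack hα κ) ∈ orbitSpan hα κ :=
  Submodule.sum_mem _ fun τ _ => rename_mem_orbitSpan hα κ τ _ (nsJack_mem_orbitSpan hα κ 1)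

theorem torusForm_nsJack_of_mem {α : ℝ} (hα : 0 < α) {κ : Fin N → ℕ} (hκ : Antitone κ)
    {f : MvPolynomial (Fin N) ℂ} (hf : f ∈ orbitSpan hα κ) :
    torusForm hα (nsJack hα κ) f =
      co κ f * torusForm hα (nsJack hα κ) (nsJack hα κ) := by
  have : orbitSpan hα κ ≤ LinearMap.eqLocus (torusForm hα (nsJack hα κ))
      ((co κ).smulRight (torusForm hα (nsJack hα κ) (nsJack hα κ))) := by
    refine Submodule.span_le.mpr ?_
    rintro _ ⟨τ, rfl⟩
    simp only [SetLike.mem_coe, LinearMap.mem_eqLocus, LinearMap.smulRight_apply, smul_eq_mul]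
    by_cases hτ : κ ∘ τ = κ
    · rw [hτ, (nsJack_spec hα κ).monic, one_mul]
    · have h₁ : co κ (nsJack hα (κ ∘ τ)) = 0 := by
        by_contra hn
        rcases (nsJack_spec hα (κ ∘ τ)).joint.support hα hn with h₁ | h₁
        · exact hτ h₁.symm
        · exact not_below_antitone hκ τ h₁
      rw [h₁, zero_mul]
      exact (nsJack_spec hα κ).joint.orthogonal hα (nsJack_spec hα (κ ∘ τ)).joint
        fun he => hτ (eq_of_bar_eq hα he.symm)
  exact this hf

theorem torusForm_symmetrize {α : ℝ} (hα : 0 < α) {κ : Fin N → ℕ} (hκ : Antitone κ) :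
    torusForm hα (symmetrize (nsJack hα κ)) (symmetrize (nsJack hα κ)) =
      N ! * (co κ (symmetrize (nsJack hα κ)) *
        torusForm hα (nsJack hα κ) (nsJack hα κ)) := by
  rw [← torusForm_nsJack_of_mem hα hκ (symmetrize_mem_orbitSpan hα κ)]
  have h₀ : ∀ R, torusForm hα (symmetrize (nsJack hα κ)) R =
      ∑ τ : Equiv.Perm (Fin N), torusForm hα (rename τ (nsJack hα κ)) R := fun R => by
    rw [symmetrize, map_sum, LinearMap.sum_apply]
  have h₁ : ∀ τ : Equiv.Perm (Fin N),
      torusForm hα (rename τ (nsJack hα κ)) (symmetrize (nsJack hα κ)) =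
        torusForm hα (nsJack hα κ) (symmetrize (nsJack hα κ)) := fun τ => by
    conv_lhs => rw [← symmetrize_isSymmetric (nsJack hα κ) τ]
    exact torusForm_rename hα τ _ _
  simp only [h₀ (symmetrize (nsJack hα κ)), h₁, sum_const, card_univ, Fintype.card_perm,
    Fintype.card_fin, nsmul_eq_mul]

/-- The coefficient of the symmetrization of `E_η` at the rearrangements of `η`. -/
def leadCoeff {α : ℝ} (hα : 0 < α) (η : Fin N → ℕ) : ℂ :=
  ∑ τ : Equiv.Perm (Fin N), co (η ∘ τ) (nsJack hα η)

theorem co_symmetrize {α : ℝ} (hα : 0 < α) (κ : Fin N → ℕ) :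
    co κ (symmetrize (nsJack hα κ)) = leadCoeff hα κ := by
  rw [symmetrize, map_sum, leadCoeff]
  exact sum_congr rfl fun τ _ => co_rename τ κ _

/-- The value of the leading coefficient of the symmetrization. -/
def leadProd (α : ℝ) (η : Fin N → ℕ) : ℝ := pairProd α (fun x => 1 + 1 / x) (fun _ => 1) η

theorem leadCoeff_comp_swap {α : ℝ} (hα : 0 < α) {η : Fin N → ℕ} {i j : Fin N}
    (hij : (i : ℕ) + 1 = j) (hη : η i < η j) :
    leadCoeff hα (η ∘ Equiv.swap i j) =
      ((1 + 1 / (bar α η j - bar α η i) : ℝ) : ℂ) * leadCoeff hα η := by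
  have h₁ : leadCoeff hα (η ∘ Equiv.swap i j) =
      ∑ τ : Equiv.Perm (Fin N), co (η ∘ τ) (nsJack hα (η ∘ Equiv.swap i j)) := by
    rw [leadCoeff, ← Equiv.sum_comp (Equiv.mulLeft (Equiv.swap i j)) fun τ =>
      co (η ∘ τ) (nsJack hα (η ∘ Equiv.swap i j))]
    rfl
  rw [h₁, nsJack_comp_swap hα hij hη]
  simp only [map_add, map_smul, sum_add_distrib, ← smul_sum]
  have h₂ : ∑ τ : Equiv.Perm (Fin N), co (η ∘ τ) (rename (Equiv.swap i j) (nsJack hα η)) =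
      leadCoeff hα η := by
    rw [leadCoeff, ← Equiv.sum_comp (Equiv.mulRight (Equiv.swap i j)) fun τ =>
      co (η ∘ τ) (nsJack hα η)]
    refine sum_congr rfl fun τ _ => ?_
    rw [co_rename]; rfl
  rw [h₂, ← leadCoeff, smul_eq_mul]
  push_cast
  ring

theorem leadCoeff_of_monotone {α : ℝ} (hα : 0 < α) {η : Fin N → ℕ} (hη : Monotone η) :
    leadCoeff hα η = (freqFactorial η : ℂ) := by
  rw [leadCoeff, ← card_stabilizer, card_filter]
  push_cast
  refine sum_congr rfl fun τ _ => ?_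
  split_ifs with hτ
  · rw [hτ, (nsJack_spec hα η).monic]
  · by_contra hn
    rcases (nsJack_spec hα η).joint.support hα hn with h₁ | h₁
    · exact hτ h₁
    · exact not_below_monotone hη τ h₁

theorem leadCoeff_eq {α : ℝ} (hα : 0 < α) (η : Fin N → ℕ) :
    leadCoeff hα η = (leadProd α η : ℂ) := by
  obtain ⟨w, hw⟩ : ∃ w, ∑ i, (i.rev : ℕ) * η i = w := ⟨_, rfl⟩
  induction w using Nat.strong_induction_on generalizing η with
  | _ w ih =>
  by_cases hz : ∀ i j : Fin N, (i : ℕ) + 1 = j → η i ≤ η j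
  · have hmono : Monotone η := by
      cases N with
      | zero => exact fun a => a.elim0
      | succ n => exact Fin.monotone_iff_le_succ.mpr fun i => hz _ _ (by simp)
    rw [leadCoeff_of_monotone hα hmono, leadProd, pairProd_monotone α hmono]
    norm_cast
  · push Not at hz
    obtain ⟨i, j, hij, hlt⟩ := hz
    have hlt' : i < j := Fin.lt_def.mpr (by omega)
    obtain ⟨_, hb⟩ := below_swap hlt' hlt
    rw [rank_lt_iff] at hb
    have hsq : ∑ a, (η ∘ Equiv.swap i j) a ^ 2 = ∑ a, η a ^ 2 :=
      Equiv.sum_comp (Equiv.swap i j) fun q => η q ^ 2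
    have h₁ := ih (∑ a, (a.rev : ℕ) * (η ∘ Equiv.swap i j) a) (by omega)
      (η ∘ Equiv.swap i j) rfl
    have hη : (η ∘ Equiv.swap i j) i < (η ∘ Equiv.swap i j) j := by simpa using hlt
    have h₂ := leadCoeff_comp_swap hα hij hη
    have h₃ := pairProd_comp_swap α (fun x => 1 + 1 / x) (fun _ => 1) hij hη
    rw [comp_swap_comp_swap] at h₂ h₃
    rw [h₂, h₁, leadProd, leadProd, ← mul_one (pairProd α _ _ η), h₃]
    push_cast
    ring

theorem leadProd_pos {α : ℝ} (hα : 0 < α) (η : Fin N → ℕ) : 0 < leadProd α η := by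
  refine prod_pos fun p _ => ?_
  split_ifs with h₁ h₂
  · have := sub_pos.mpr (bar_lt_of_beats hα h₁)
    positivity
  · exact one_pos
  · exact one_pos

end JackTorus

end

noncomputable section

namespace JackTorus

open Finset MvPolynomial

variable {N : ℕ}

/-! ### The sum of squares of the Cherednik operators on symmetric polynomials -/

/-- The sum of the squares of the Cherednik operators. -/
def cherSq (α : ℝ) : MvPolynomial (Fin N) ℂ →ₗ[ℂ] MvPolynomial (Fin N) ℂ :=
  ∑ i, xi α i ∘ₗ xi α i

theorem isTriangular_cherSq (α : ℝ) :
    IsTriangular (cherSq (N := N) α) fun η => ((∑ i, bar α η i ^ 2 : ℝ) : ℂ) := by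
  have := IsTriangular.sum univ (fun (i : Fin N) _ => (isTriangular_xi α i).comp (isTriangular_xi α i))
  simpa only [cherSq, pow_two, Complex.ofReal_sum, Complex.ofReal_mul] using this

theorem IsJoint.cherSq {α : ℝ} {c : Fin N → ℝ} {f : MvPolynomial (Fin N) ℂ} (hf : IsJoint α c f) :
    cherSq α f = ((∑ i, c i ^ 2 : ℝ) : ℂ) • f := by
  simp only [JackTorus.cherSq, LinearMap.sum_apply, LinearMap.comp_apply, hf _, map_smul, smul_smul,
    ← sum_smul]
  simp [pow_two]

theorem dd_of_isSymmetric {i p : Fin N} (hip : i ≠ p) {f : MvPolynomial (Fin N) ℂ}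
    (hf : f.IsSymmetric) : dd i p f = 0 := by
  have := X_sub_X_mul_dd i p f
  rw [hf, sub_self] at this
  exact (mul_eq_zero.mp this).resolve_left (X_sub_X_ne_zero hip)

theorem xi_of_isSymmetric (α : ℝ) (i : Fin N) {f : MvPolynomial (Fin N) ℂ} (hf : f.IsSymmetric) :
    xi α i f = (α : ℂ) • theta i f - ((i : ℕ) : ℂ) • f := by
  rw [xi_apply, sum_eq_zero, add_zero]
  intro p hp
  rw [dd_of_isSymmetric (ne_of_mem_erase hp).symm hf, mul_zero]

theorem cherSq_of_isSymmetric (α : ℝ) {f : MvPolynomial (Fin N) ℂ} (hf : f.IsSymmetric) :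
    cherSq α f = ((α : ℂ) ^ 2) • ∑ i, theta i (theta i f) +
      (α : ℂ) • (∑ i, ∑ p ∈ univ.erase i, X (max i p) * dd i p (theta i f)) -
      (2 * (α : ℂ)) • ∑ i : Fin N, ((i : ℕ) : ℂ) • theta i f +
      (∑ i : Fin N, ((i : ℕ) : ℂ) ^ 2) • f := by
  simp only [cherSq, LinearMap.sum_apply, LinearMap.comp_apply, smul_sum, sum_smul,
    ← sum_add_distrib, ← sum_sub_distrib]
  refine sum_congr rfl fun i _ => ?_
  rw [xi_of_isSymmetric α i hf, map_sub, map_smul, map_smul, xi_of_isSymmetric α i hf, xi_apply]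
  simp only [smul_sub, smul_add, smul_sum]
  module

theorem rename_swap_theta_of_isSymmetric (i p : Fin N) {f : MvPolynomial (Fin N) ℂ}
    (hf : f.IsSymmetric) : rename (Equiv.swap i p) (theta i f) = theta p f := by
  rw [rename_theta, hf, Equiv.swap_apply_left]

theorem card_Ioi_fin (i : Fin N) : (((Ioi i).card : ℕ) : ℂ) = (N : ℂ) - 1 - (i : ℕ) := by
  rw [Fin.card_Ioi]
  have := i.isLt
  rw [Nat.sub_sub, Nat.cast_sub (by omega)]
  push_cast; ring

section Field

variable {K : Type*} [Field K] {ι : MvPolynomial (Fin N) ℂ →+* K}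

theorem map_exchange_pair (hι : Function.Injective ι) {i p : Fin N} (hip : i < p)
    {f : MvPolynomial (Fin N) ℂ} (hf : f.IsSymmetric) :
    ι (X (max i p) * dd i p (theta i f)) + ι (X (max p i) * dd p i (theta p f)) =
      2 * (ι (X i) / (ι (X i) - ι (X p)) * ι (theta i f) +
        ι (X p) / (ι (X p) - ι (X i)) * ι (theta p f)) - 2 * ι (theta i f) := by
  have h₀ : ι (X i) - ι (X p) ≠ 0 := by
    rw [← map_sub]
    exact (map_ne_zero_iff ι hι).mpr (X_sub_X_ne_zero hip.ne)
  have h₀' : ι (X p) - ι (X i) ≠ 0 := by rwa [← neg_sub, neg_ne_zero]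
  have h₁ := congrArg ι (X_sub_X_mul_dd i p (theta i f))
  have h₂ := congrArg ι (X_sub_X_mul_dd p i (theta p f))
  rw [rename_swap_theta_of_isSymmetric i p hf, map_mul, map_sub, map_sub] at h₁
  rw [rename_swap_theta_of_isSymmetric p i hf, map_mul, map_sub, map_sub] at h₂
  rw [max_eq_right hip.le, max_eq_left hip.le, map_mul, map_mul,
    eq_div_of_mul_eq h₀ ((mul_comm _ _).trans h₁), eq_div_of_mul_eq h₀' ((mul_comm _ _).trans h₂),
    ← neg_sub (ι (X i)) (ι (X p))]
  field_simp
  ring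

theorem map_sum_exchange (hι : Function.Injective ι) {f : MvPolynomial (Fin N) ℂ}
    (hf : f.IsSymmetric) :
    ι (∑ i, ∑ p ∈ univ.erase i, X (max i p) * dd i p (theta i f)) =
      2 * (∑ i, ∑ p ∈ univ.erase i, ι (X i) / (ι (X i) - ι (X p)) * ι (theta i f)) -
        2 * ∑ i : Fin N, ι (C ((N : ℂ) - 1 - (i : ℕ)) * theta i f) := by
  simp only [map_sum]
  rw [sum_erase_eq_sum_Ioi, sum_erase_eq_sum_Ioi]
  simp only [mul_sum, ← sum_sub_distrib]
  refine sum_congr rfl fun i _ => ?_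
  have h₁ : 2 * ι (C ((N : ℂ) - 1 - (i : ℕ)) * theta i f) = ∑ p ∈ Ioi i, 2 * ι (theta i f) := by
    rw [sum_const, nsmul_eq_mul, ← card_Ioi_fin, map_natCast, map_mul, map_natCast]; ring
  rw [h₁, ← sum_sub_distrib]
  exact sum_congr rfl fun p hp => map_exchange_pair hι (mem_Ioi.mp hp) hf

theorem map_cherSq (hι : Function.Injective ι) {α : ℝ} (hα : 0 < α) {f : MvPolynomial (Fin N) ℂ}
    (hf : f.IsSymmetric) :
    ι (cherSq α f) = ι (C ((α : ℂ) ^ 2)) *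
      ((∑ j, ι (.X j) ^ 2 * ι (pderiv j (pderiv j f))) +
        ι (.C (2 / (α : ℂ))) * ∑ j, ∑ k ∈ Finset.univ.erase j,
          ι (.X j) ^ 2 / (ι (.X j) - ι (.X k)) * ι (pderiv j f)) +
      ι (((α : ℂ) ^ 2 - 2 * α * (N - 1)) • ∑ i, theta i f + (∑ i : Fin N, ((i : ℕ) : ℂ) ^ 2) • f) := by
  have hα' : (α : ℂ) ≠ 0 := by exact_mod_cast hα.ne'
  have h₁ : ι (C ((α : ℂ) ^ 2)) * ι (C (2 / (α : ℂ))) = 2 * ι (C (α : ℂ)) := by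
    rw [← map_mul, ← map_mul, show (α : ℂ) ^ 2 * (2 / α) = (2 : ℕ) * α by push_cast; field_simp,
      map_mul, map_mul, map_natCast, map_natCast]
    norm_num
  have h₂ : ∑ j, ι (.X j) ^ 2 * ι (pderiv j (pderiv j f)) =
      ι (∑ i, theta i (theta i f)) - ι (∑ i, theta i f) := by
    rw [← map_sub, ← sum_sub_distrib, map_sum]
    refine sum_congr rfl fun i _ => ?_
    rw [← map_pow, ← map_mul]
    congr 1
    simp only [theta_apply, Derivation.leibniz, pderiv_X_self, smul_eq_mul]
    ring
  have h₃ : ∑ j, ∑ k ∈ univ.erase j, ι (.X j) ^ 2 / (ι (.X j) - ι (.X k)) * ι (pderiv j f) =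
      ∑ i, ∑ p ∈ univ.erase i, ι (X i) / (ι (X i) - ι (X p)) * ι (theta i f) := by
    refine sum_congr rfl fun i _ => sum_congr rfl fun p _ => ?_
    rw [theta_apply, map_mul]
    ring
  have h₄ : ∑ i : Fin N, ι (C ((N : ℂ) - 1 - (i : ℕ)) * theta i f) =
      ι (C ((N : ℂ) - 1)) * ι (∑ i, theta i f) - ι (∑ i : Fin N, C ((i : ℕ) : ℂ) * theta i f) := by
    rw [← map_mul, ← map_sub, mul_sum, ← sum_sub_distrib, map_sum]
    refine sum_congr rfl fun i _ => congrArg ι ?_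
    rw [map_sub, sub_mul]
  rw [h₂, h₃, mul_add, ← mul_assoc, h₁, cherSq_of_isSymmetric α hf]
  have h₅ : ι (C 2) = 2 := by
    rw [show (2 : ℂ) = ((2 : ℕ) : ℂ) by norm_num, map_natCast, map_natCast]; norm_num
  simp only [smul_eq_C_mul, map_add, map_sub ι, map_mul ι]
  rw [map_sum_exchange hι hf, h₄]
  simp only [map_sub C, map_sub ι, map_mul C, map_mul ι, h₅]
  ring

end Field

theorem algebraMap_cherSq {α : ℝ} (hα : 0 < α) {f : MvPolynomial (Fin N) ℂ} (hf : f.IsSymmetric) :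
    algebraMap _ (FractionRing (MvPolynomial (Fin N) ℂ)) (cherSq α f) =
      algebraMap (MvPolynomial (Fin N) ℂ) _ (C ((α : ℂ) ^ 2)) * D₂ α f +
        algebraMap (MvPolynomial (Fin N) ℂ) _
        (((α : ℂ) ^ 2 - 2 * α * (N - 1)) • ∑ i, theta i f + (∑ i : Fin N, ((i : ℕ) : ℂ) ^ 2) • f) :=
  map_cherSq (IsFractionRing.injective _ _) hα hf

end JackTorus

end

noncomputable section

namespace JackTorus

open Finset MvPolynomial

variable {N : ℕ}

/-! ### Monomial symmetric polynomials -/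

theorem freq_comp_perm (η : Fin N → ℕ) (τ : Equiv.Perm (Fin N)) (j : ℕ) :
    freq (η ∘ τ) j = freq η j :=
  card_bij (fun a _ => τ a) (by simp) (fun a _ b _ h => τ.injective h)
    fun b hb => ⟨τ.symm b, by simpa using hb, by simp⟩

theorem exists_perm_of_freq_eq {ν μ : Fin N → ℕ} (h : ∀ j, j ≠ 0 → freq ν j = freq μ j) :
    ∃ τ : Equiv.Perm (Fin N), ν = μ ∘ τ := by
  have hsum : ∀ (η : Fin N → ℕ) (M : ℕ), (∀ i, η i < M + 1) →
      N = ∑ j ∈ range M, freq η (j + 1) + freq η 0 := fun η M hM => by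
    have := card_eq_sum_card_fiberwise (s := (univ : Finset (Fin N))) (t := range (M + 1)) (f := η)
      (fun i _ => by simpa using hM i)
    rw [sum_range_succ', card_univ, Fintype.card_fin] at this
    exact this
  have h₀ : freq ν 0 = freq μ 0 := by
    have h₁ := hsum ν (univ.sup ν ⊔ univ.sup μ) fun i =>
      Nat.lt_succ_of_le ((le_sup (mem_univ i)).trans le_sup_left)
    have h₂ := hsum μ (univ.sup ν ⊔ univ.sup μ) fun i =>
      Nat.lt_succ_of_le ((le_sup (f := μ) (mem_univ i)).trans le_sup_right)
    rw [sum_congr rfl fun j _ => h (j + 1) (Nat.succ_ne_zero j)] at h₁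
    omega
  have hall : ∀ j, Fintype.card {a // ν a = j} = Fintype.card {a // μ a = j} := fun j => by
    rw [Fintype.card_subtype, Fintype.card_subtype]
    rcases eq_or_ne j 0 with rfl | hj
    · exact h₀
    · exact h j hj
  refine ⟨Equiv.ofFiberEquiv fun j => Fintype.equivOfCardEq (hall j), ?_⟩
  ext i
  exact (Equiv.ofFiberEquiv_map _ i).symm

theorem count_ofSym_parts {n : ℕ} (s : Sym (Fin N) n) (j : ℕ) (hj : j ≠ 0) :
    (Nat.Partition.ofSym s).parts.count j = freq (fun i => s.1.count i) j := by
  change (s.1.dedup.map s.1.count).count j = _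
  rw [Multiset.count_map, freq]
  change _ = Multiset.card (Multiset.filter _ univ.val)
  congr 1
  rw [← Multiset.toFinset_val, ← filter_val, ← filter_val]
  congr 1
  ext i
  simp only [mem_filter, Multiset.mem_toFinset, mem_univ, true_and]
  refine ⟨fun h => h.2.symm, fun h => ⟨?_, h.symm⟩⟩
  rw [← Multiset.count_ne_zero]; omega

theorem count_ofSums_parts (μ : Fin N → ℕ) (j : ℕ) (hj : j ≠ 0) :
    (Nat.Partition.ofSums (∑ i, μ i) (univ.val.map μ) rfl).parts.count j = freq μ j := by
  refine (Nat.Partition.count_ofSums_of_ne_zero (l := univ.val.map μ) rfl hj).trans ?_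
  rw [Multiset.count_map, freq]
  simp only [eq_comm]
  rfl

theorem ofSym_eq_ofSums_iff (μ : Fin N → ℕ) (s : Sym (Fin N) (∑ i, μ i)) :
    Nat.Partition.ofSym s = Nat.Partition.ofSums (∑ i, μ i) (univ.val.map μ) rfl ↔
      ∃ τ : Equiv.Perm (Fin N), (fun i => s.1.count i) = μ ∘ τ := by
  constructor
  · intro h
    refine exists_perm_of_freq_eq fun j hj => ?_
    rw [← count_ofSym_parts s j hj, h, count_ofSums_parts μ j hj]
  · rintro ⟨τ, hτ⟩
    ext j
    rcases eq_or_ne j 0 with rfl | hj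
    · rw [Multiset.count_eq_zero_of_notMem, Multiset.count_eq_zero_of_notMem] <;>
        exact fun h => absurd (Nat.Partition.parts_pos _ h) (lt_irrefl 0)
    · rw [count_ofSym_parts s j hj, hτ, freq_comp_perm, count_ofSums_parts μ j hj]

theorem prod_map_X (s : Multiset (Fin N)) :
    (s.map (X : Fin N → MvPolynomial (Fin N) ℂ)).prod = mon fun i => s.count i := by
  induction s using Multiset.induction_on with
  | empty => simp only [Multiset.map_zero, Multiset.prod_zero, Multiset.count_zero]; exact mon_zero.symm
  | cons a s ih =>
    rw [Multiset.map_cons, Multiset.prod_cons, ih, X_mul_mon]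
    congr 1
    ext i
    rcases eq_or_ne i a with rfl | h
    · simp
    · simp [h]

theorem co_monoSymm (ν μ : Fin N → ℕ) [Decidable (∃ τ : Equiv.Perm (Fin N), ν = μ ∘ τ)] :
    co ν (monoSymm μ) = if ∃ τ : Equiv.Perm (Fin N), ν = μ ∘ τ then 1 else 0 := by
  rw [monoSymm, msymm, map_sum]
  simp only [prod_map_X, co_mon]
  split_ifs with h
  · obtain ⟨τ, hτ⟩ := h
    have hc : ∀ i, Multiset.count i (∑ i, ν i • {i}) = ν i := fun i => by
      simp [Multiset.count_sum', Multiset.count_nsmul, Multiset.count_singleton]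
    let s : Sym (Fin N) (∑ i, μ i) := ⟨∑ i, ν i • {i}, by
      rw [Multiset.card_sum]
      simp only [Multiset.card_nsmul, Multiset.card_singleton, mul_one, hτ]
      exact Equiv.sum_comp τ μ⟩
    have hs : (fun i => s.1.count i) = ν := funext hc
    rw [sum_eq_single ⟨s, (ofSym_eq_ofSums_iff μ s).mpr ⟨τ, hs.trans hτ⟩⟩]
    · exact if_pos hs
    · intro t _ ht
      refine if_neg fun h => ht (Subtype.ext (Subtype.ext (Multiset.ext.mpr fun i => ?_)))
      exact (congrFun h i).trans (congrFun hs i).symm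
    · simp
  · refine sum_eq_zero fun t _ => if_neg fun ht => h ?_
    obtain ⟨τ, hτ⟩ := (ofSym_eq_ofSums_iff μ t.1).mp t.2
    exact ⟨τ, ht.symm.trans hτ⟩

end JackTorus

end

noncomputable section

namespace JackTorus

open Finset MvPolynomial

variable {N : ℕ}

/-! ### Symmetric Jack polynomials -/

theorem co_comp_perm {f : MvPolynomial (Fin N) ℂ} (hf : f.IsSymmetric) (ν : Fin N → ℕ)
    (τ : Equiv.Perm (Fin N)) : co (ν ∘ τ) f = co ν f := by
  rw [← co_rename, hf]

theorem mem_span_monoSymm {f : MvPolynomial (Fin N) ℂ} (hf : f.IsSymmetric)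
    {q : (Fin N → ℕ) → Prop} (hq : ∀ μ, Antitone μ → co μ f ≠ 0 → q μ) :
    f ∈ Submodule.span ℂ {m | ∃ μ : Fin N → ℕ, Antitone μ ∧ q μ ∧ m = monoSymm μ} := by
  classical
  let S : Finset (Fin N → ℕ) := (f.support.image fun m i => m i).filter Antitone
  have hS : ∀ μ, μ ∈ S ↔ co μ f ≠ 0 ∧ Antitone μ := fun μ => by
    simp only [S, mem_filter, mem_image, mem_support_iff]
    refine and_congr_left fun _ => ⟨?_, fun h => ⟨Finsupp.equivFunOnFinite.symm μ, h, rfl⟩⟩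
    rintro ⟨m, hm, rfl⟩
    simpa [co] using hm
  have hsum : f = ∑ μ ∈ S, co μ f • monoSymm μ := by
    rw [← sub_eq_zero]
    refine eq_zero_of_co fun ν => ?_
    obtain ⟨τ, hτ⟩ := exists_antitone_perm ν
    have hν : ν = plus ν ∘ τ.symm := by rw [hτ]; ext i; simp
    simp only [map_sub, map_sum, map_smul, co_monoSymm, smul_eq_mul]
    rw [sub_eq_zero, sum_eq_single (plus ν)]
    · rw [if_pos ⟨τ.symm, hν⟩, mul_one, hτ, co_comp_perm hf]
    · intro μ hμ hne
      rw [if_neg, mul_zero]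
      rintro ⟨σ, hσ⟩
      refine hne (antitone_eq_of_perm (plus_antitone ν) ((hS μ).mp hμ).2 (σ.symm.trans τ.symm) ?_)
      ext i
      have := congrFun hσ (σ.symm i)
      have h₂ := congrFun hν (σ.symm i)
      simp only [Function.comp_apply, Equiv.apply_symm_apply, Equiv.trans_apply] at this h₂ ⊢
      rw [← this, ← h₂]
    · intro h
      rw [hS, not_and] at h
      by_contra h'
      exact h (left_ne_zero_of_mul h') (plus_antitone ν)
  rw [hsum]
  refine Submodule.sum_mem _ fun μ hμ => Submodule.smul_mem _ _ (Submodule.subset_span ?_)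
  obtain ⟨h₁, h₂⟩ := (hS μ).mp hμ
  exact ⟨μ, h₂, hq μ h₂ h₁, rfl⟩

theorem exists_of_mem_span_monoSymm {f : MvPolynomial (Fin N) ℂ} {q : (Fin N → ℕ) → Prop}
    (hf : f ∈ Submodule.span ℂ {m | ∃ μ : Fin N → ℕ, Antitone μ ∧ q μ ∧ m = monoSymm μ})
    {ν : Fin N → ℕ} (hν : co ν f ≠ 0) :
    ∃ μ, Antitone μ ∧ q μ ∧ ∃ τ : Equiv.Perm (Fin N), ν = μ ∘ τ := by
  classical
  by_contra hc
  refine hν (?_ : f ∈ LinearMap.ker (co ν))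
  refine Submodule.span_le.mpr ?_ hf
  rintro _ ⟨μ, h₁, h₂, rfl⟩
  rw [SetLike.mem_coe, LinearMap.mem_ker, co_monoSymm, if_neg fun h => hc ⟨μ, h₁, h₂, h⟩]

/-! #### The eigenvalue equation -/

theorem co_theta (ν : Fin N → ℕ) (i : Fin N) (f : MvPolynomial (Fin N) ℂ) :
    co ν (theta i f) = ν i * co ν f := by
  have : co ν ∘ₗ theta i = (ν i : ℂ) • co ν := by
    refine linearMap_ext_mon fun η => ?_
    simp only [LinearMap.comp_apply, theta_mon, map_smul, LinearMap.smul_apply, co_mon]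
    split_ifs with h
    · rw [h]
    · simp
  exact LinearMap.congr_fun this f

theorem sum_theta {f : MvPolynomial (Fin N) ℂ} {n : ℕ} (hf : ∀ ν, co ν f ≠ 0 → ∑ i, ν i = n) :
    ∑ i, theta i f = (n : ℂ) • f := by
  rw [← sub_eq_zero]
  refine eq_zero_of_co fun ν => ?_
  simp only [map_sub, map_sum, map_smul, co_theta, ← sum_mul, smul_eq_mul, ← sub_mul]
  by_cases h : co ν f = 0
  · rw [h, mul_zero]
  · rw [← hf ν h]; simp

/-- The shift between the eigenvalues of `α² D₂(α)` and of `cherSq α` in degree `n`. -/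
def eigenShift (N : ℕ) (α : ℝ) (n : ℕ) : ℂ :=
  ((α : ℂ) ^ 2 - 2 * α * (N - 1)) * n + ∑ i : Fin N, ((i : ℕ) : ℂ) ^ 2

theorem D₂_eq_iff {α : ℝ} (hα : 0 < α) {f : MvPolynomial (Fin N) ℂ} (hf : f.IsSymmetric) {n : ℕ}
    (hn : ∀ ν, co ν f ≠ 0 → ∑ i, ν i = n) (E : ℂ) :
    D₂ α f = algebraMap _ _ (C E * f) ↔
      cherSq α f = ((α : ℂ) ^ 2 * E + eigenShift N α n) • f := by
  have hinj := IsFractionRing.injective (MvPolynomial (Fin N) ℂ)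
    (FractionRing (MvPolynomial (Fin N) ℂ))
  have hα' : (C ((α : ℂ) ^ 2) : MvPolynomial (Fin N) ℂ) ≠ 0 := by
    rw [Ne, C_eq_zero]
    exact pow_ne_zero _ (by exact_mod_cast hα.ne')
  have h₁ : (((α : ℂ) ^ 2 - 2 * α * (N - 1)) • ∑ i, theta i f +
      (∑ i : Fin N, ((i : ℕ) : ℂ) ^ 2) • f) = eigenShift N α n • f := by
    rw [sum_theta hn, smul_smul, ← add_smul, eigenShift]
  have h₂ := algebraMap_cherSq hα hf
  rw [h₁] at h₂
  rw [← hinj.eq_iff, h₂, add_smul, map_add, add_left_inj, mul_smul, smul_eq_C_mul, smul_eq_C_mul,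
    map_mul _ (C ((α : ℂ) ^ 2)), mul_right_inj']
  exact (map_ne_zero_iff _ hinj).mpr hα'

theorem exists_D₂_iff {α : ℝ} (hα : 0 < α) {f : MvPolynomial (Fin N) ℂ} (hf : f.IsSymmetric) {n : ℕ}
    (hn : ∀ ν, co ν f ≠ 0 → ∑ i, ν i = n) :
    (∃ E : ℂ, D₂ α f = algebraMap _ _ (C E * f)) ↔ ∃ c : ℂ, cherSq α f = c • f := by
  simp only [D₂_eq_iff hα hf hn]
  refine ⟨fun ⟨E, h⟩ => ⟨_, h⟩, fun ⟨c, h⟩ => ⟨(c - eigenShift N α n) / (α : ℂ) ^ 2, ?_⟩⟩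
  have hα' : (α : ℂ) ≠ 0 := by exact_mod_cast hα.ne'
  rw [h]
  congr 1
  field_simp
  ring

/-! #### Uniqueness -/

theorem IsSymmetricJack.support {α : ℝ} {κ ν : Fin N → ℕ} {P : MvPolynomial (Fin N) ℂ}
    (hP : IsSymmetricJack α κ P) (hν : co ν P ≠ 0) :
    ∃ μ, (μ = κ ∨ Antitone μ ∧ DominatedBy μ κ) ∧ ∃ τ : Equiv.Perm (Fin N), ν = μ ∘ τ := by
  classical
  by_cases h : ∃ τ : Equiv.Perm (Fin N), ν = κ ∘ τ
  · exact ⟨κ, Or.inl rfl, h⟩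
  · have h₁ : co ν (P - monoSymm κ) ≠ 0 := by
      rwa [map_sub, co_monoSymm, if_neg h, sub_zero]
    obtain ⟨μ, h₂, h₃, h₄⟩ := exists_of_mem_span_monoSymm hP.triangular h₁
    exact ⟨μ, Or.inr ⟨h₂, h₃⟩, h₄⟩

theorem IsSymmetricJack.co_self {α : ℝ} {κ : Fin N → ℕ} (hκ : Antitone κ)
    {P : MvPolynomial (Fin N) ℂ} (hP : IsSymmetricJack α κ P) : co κ P = 1 := by
  classical
  have h₁ : co κ (P - monoSymm κ) = 0 := by
    by_contra h
    obtain ⟨μ, h₂, h₃, τ, h₄⟩ := exists_of_mem_span_monoSymm hP.triangular h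
    exact h₃.2.2 (antitone_eq_of_perm h₂ hκ τ h₄).symm
  rw [map_sub, co_monoSymm, if_pos ⟨1, rfl⟩, sub_eq_zero] at h₁
  exact h₁

theorem IsSymmetricJack.sum_eq {α : ℝ} {κ ν : Fin N → ℕ} {P : MvPolynomial (Fin N) ℂ}
    (hP : IsSymmetricJack α κ P) (hν : co ν P ≠ 0) : ∑ i, ν i = ∑ i, κ i := by
  obtain ⟨μ, h, τ, rfl⟩ := hP.support hν
  refine (Equiv.sum_comp τ μ).trans ?_
  rcases h with rfl | h
  · rfl
  · exact h.2.1

theorem IsSymmetricJack.not_below {α : ℝ} {κ ν : Fin N → ℕ} (hκ : Antitone κ)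
    {P : MvPolynomial (Fin N) ℂ} (hP : IsSymmetricJack α κ P) (hν : co ν P ≠ 0) : ¬ Below κ ν := by
  obtain ⟨μ, h, τ, rfl⟩ := hP.support hν
  rcases h with rfl | ⟨h₁, h₂⟩
  · exact not_below_antitone hκ τ
  · rintro ⟨_, h₃⟩
    rw [rank_lt_iff] at h₃
    have h₄ : ∑ i, (μ ∘ τ) i ^ 2 = ∑ i, μ i ^ 2 := Equiv.sum_comp τ fun i => μ i ^ 2
    have h₅ : ∑ i, μ i ^ 2 < ∑ i, κ i ^ 2 := by exact_mod_cast h₂.sum_sq_lt h₁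
    omega

theorem IsSymmetricJack.cherSq {α : ℝ} (hα : 0 < α) {κ : Fin N → ℕ} (hκ : Antitone κ)
    {P : MvPolynomial (Fin N) ℂ} (hP : IsSymmetricJack α κ P) :
    cherSq α P = ((∑ i, bar α κ i ^ 2 : ℝ) : ℂ) • P := by
  obtain ⟨c, hc⟩ := (exists_D₂_iff hα hP.symmetric fun ν => hP.sum_eq).mp hP.eigenfunction
  have h₁ := (isTriangular_cherSq α).co_apply (f := P) (ν := κ) fun μ hμ => hP.not_below hκ hμ
  rw [hc, map_smul, hP.co_self hκ, smul_eq_mul, mul_one, mul_one] at h₁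
  rw [hc, h₁]

theorem IsSymmetricJack.unique {α : ℝ} (hα : 0 < α) {κ : Fin N → ℕ} (hκ : Antitone κ)
    {P Q : MvPolynomial (Fin N) ℂ} (hP : IsSymmetricJack α κ P) (hQ : IsSymmetricJack α κ Q) :
    P = Q := by
  rw [← sub_eq_zero]
  by_contra hR
  obtain ⟨ν₀, hν₀⟩ : ∃ ν, co ν (P - Q) ≠ 0 := by
    by_contra! h
    exact hR (eq_zero_of_co h)
  obtain ⟨ν, h₁, -, h₂⟩ := exists_max_rank (p := fun _ => True) ⟨ν₀, hν₀, trivial⟩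
  have h₃ := (isTriangular_cherSq α).co_apply (f := P - Q) (ν := ν) fun μ hμ => h₂ μ hμ trivial
  rw [map_sub, hP.cherSq hα hκ, hQ.cherSq hα hκ, ← smul_sub, map_smul, smul_eq_mul] at h₃
  have h₄ : ∑ i, bar α κ i ^ 2 = ∑ i, bar α ν i ^ 2 := by exact_mod_cast mul_right_cancel₀ h₁ h₃
  have h₅ : ∃ μ, (μ = κ ∨ Antitone μ ∧ DominatedBy μ κ) ∧
      ∃ τ : Equiv.Perm (Fin N), ν = μ ∘ τ := by
    by_cases h : co ν P = 0
    · refine hQ.support fun h' => h₁ ?_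
      rw [map_sub, h, h', sub_zero]
    · exact hP.support h
  obtain ⟨μ, h₆, τ, rfl⟩ := h₅
  rcases h₆ with rfl | ⟨h₆, h₇⟩
  · rw [map_sub, co_comp_perm hP.symmetric, co_comp_perm hQ.symmetric, hP.co_self hκ,
      hQ.co_self hκ, sub_self] at h₁
    exact h₁ rfl
  · rw [sum_bar_sq_comp_perm] at h₄
    exact (h₇.sum_bar_sq_lt hα h₆ hκ).ne h₄.symm

/-! #### Existence -/

theorem maj_of_mem_orbitSpan {α : ℝ} {hα : 0 < α} {κ ν : Fin N → ℕ} {f : MvPolynomial (Fin N) ℂ}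
    (hf : f ∈ orbitSpan hα κ) (hν : co ν f ≠ 0) : Maj ν κ := by
  by_contra hc
  refine hν (?_ : f ∈ LinearMap.ker (co ν))
  refine Submodule.span_le.mpr ?_ hf
  rintro _ ⟨τ, rfl⟩
  rw [SetLike.mem_coe, LinearMap.mem_ker]
  by_contra h
  have hs := nsJack_spec hα (κ ∘ τ)
  rcases IsJoint.support hα hs.joint h with h | h
  · exact hc (h ▸ Maj.comp_perm κ τ)
  · exact hc (h.1.trans (Maj.comp_perm κ τ))

theorem cherSq_of_mem_orbitSpan {α : ℝ} {hα : 0 < α} {κ : Fin N → ℕ} {f : MvPolynomial (Fin N) ℂ}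
    (hf : f ∈ orbitSpan hα κ) : cherSq α f = ((∑ i, bar α κ i ^ 2 : ℝ) : ℂ) • f := by
  have : f ∈ LinearMap.ker (cherSq α - ((∑ i, bar α κ i ^ 2 : ℝ) : ℂ) • LinearMap.id) := by
    refine Submodule.span_le.mpr ?_ hf
    rintro _ ⟨τ, rfl⟩
    rw [SetLike.mem_coe, LinearMap.mem_ker, LinearMap.sub_apply, LinearMap.smul_apply,
      LinearMap.id_apply, (nsJack_spec hα (κ ∘ τ)).joint.cherSq, sum_bar_sq_comp_perm, sub_self]
  rwa [LinearMap.mem_ker, LinearMap.sub_apply, LinearMap.smul_apply, LinearMap.id_apply,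
    sub_eq_zero] at this

/-- The monic symmetrization of the nonsymmetric Jack polynomial `E_κ`. -/
def monicSym {α : ℝ} (hα : 0 < α) (κ : Fin N → ℕ) : MvPolynomial (Fin N) ℂ :=
  ((leadProd α κ)⁻¹ : ℂ) • symmetrize (nsJack hα κ)

theorem monicSym_mem_orbitSpan {α : ℝ} (hα : 0 < α) (κ : Fin N → ℕ) :
    monicSym hα κ ∈ orbitSpan hα κ :=
  Submodule.smul_mem _ _ (symmetrize_mem_orbitSpan hα κ)

theorem leadProd_ne_zero {α : ℝ} (hα : 0 < α) (κ : Fin N → ℕ) : (leadProd α κ : ℂ) ≠ 0 := by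
  exact_mod_cast (leadProd_pos hα κ).ne'

theorem co_monicSym {α : ℝ} (hα : 0 < α) (κ : Fin N → ℕ) : co κ (monicSym hα κ) = 1 := by
  rw [monicSym, map_smul, co_symmetrize, leadCoeff_eq, smul_eq_mul,
    inv_mul_cancel₀ (leadProd_ne_zero hα κ)]

theorem isSymmetricJack_monicSym {α : ℝ} (hα : 0 < α) {κ : Fin N → ℕ} (hκ : Antitone κ) :
    IsSymmetricJack α κ (monicSym hα κ) := by
  classical
  have hsymm : (monicSym hα κ).IsSymmetric := (symmetrize_isSymmetric _).smul _
  have hmono : (monoSymm κ).IsSymmetric := msymm_isSymmetric _ _ _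
  refine ⟨hsymm, mem_span_monoSymm (hsymm.sub hmono) fun μ hμ hco => ?_,
    (exists_D₂_iff hα hsymm fun ν hν => (maj_of_mem_orbitSpan (monicSym_mem_orbitSpan hα κ) hν).1).mpr
      ⟨_, cherSq_of_mem_orbitSpan (monicSym_mem_orbitSpan hα κ)⟩⟩
  rcases eq_or_ne μ κ with rfl | hne
  · rw [map_sub, co_monicSym, co_monoSymm, if_pos ⟨1, rfl⟩, sub_self] at hco
    exact absurd rfl hco
  · rw [map_sub, co_monoSymm, if_neg, sub_zero] at hco
    · exact (maj_of_mem_orbitSpan (monicSym_mem_orbitSpan hα κ) hco).dominatedBy hκ hne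
    · rintro ⟨τ, h⟩
      exact hne (antitone_eq_of_perm hκ hμ τ h)

theorem existsUnique_isSymmetricJack {α : ℝ} (hα : 0 < α) {κ : Fin N → ℕ} (hκ : Antitone κ) :
    ∃! P, IsSymmetricJack α κ P :=
  ⟨_, isSymmetricJack_monicSym hα hκ, fun _ h => h.unique hα hκ (isSymmetricJack_monicSym hα hκ)⟩

theorem jackP_eq {α : ℝ} (hα : 0 < α) {κ : Fin N → ℕ} (hκ : Antitone κ) :
    jackP α κ = monicSym hα κ :=
  IsSymmetricJack.unique hα hκ
    (Classical.epsilon_spec (p := IsSymmetricJack α κ) ⟨_, isSymmetricJack_monicSym hα hκ⟩)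
    (isSymmetricJack_monicSym hα hκ)

theorem torusForm_smul_smul {α : ℝ} (hα : 0 < α) (c : ℝ) (f : MvPolynomial (Fin N) ℂ) :
    torusForm hα ((c : ℂ) • f) ((c : ℂ) • f) = (c : ℂ) ^ 2 * torusForm hα f f := by
  simp only [map_smul, LinearMap.smul_apply, smul_eq_mul]
  ring

theorem one_le_bar_sub {α : ℝ} (hα : 0 < α) {κ : Fin N → ℕ} (hκ : Antitone κ) {a b : Fin N}
    (hab : a < b) : 1 ≤ bar α κ a - bar α κ b := by
  have h₁ := bar_sub_of_beats α ((beats_antitone hκ a b).mpr hab)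
  have h₂ : (κ b : ℝ) ≤ κ a := Nat.cast_le.mpr (hκ hab.le)
  nlinarith

theorem normProd_pos {α : ℝ} (hα : 0 < α) {κ : Fin N → ℕ} (hκ : Antitone κ) :
    0 < normProd α κ := by
  rw [normProd, pairProd_antitone _ _ _ hκ]
  refine prod_pos fun p _ => ?_
  split_ifs with h
  · refine gammaQuot_pos (one_div_pos.mpr hα) ?_
    have := div_le_div_of_nonneg_right (one_le_bar_sub hα hκ h) hα.le
    linarith
  · exact one_pos

/-- The quotient `⟨P_κ, P_κ⟩ / ⟨P_0, P_0⟩` as a quotient of products over pairs of rows. -/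
theorem normP_div {α : ℝ} (hα : 0 < α) {κ : Fin N → ℕ} (hκ : Antitone κ) :
    normP α κ / normP α (0 : Fin N → ℕ) =
      (((normProd α κ / leadProd α κ) / (normProd α (0 : Fin N → ℕ) / leadProd α (0 : Fin N → ℕ)) : ℝ) : ℂ) := by
  have h₀ : ∀ {κ : Fin N → ℕ}, Antitone κ → normP α κ * (leadProd α κ * normProd α (0 : Fin N → ℕ)) =
      N ! * (torusForm hα (1 : MvPolynomial (Fin N) ℂ) 1 * normProd α κ) := by
    intro κ hκ
    have h₁ : normP α κ * leadProd α κ = N ! * torusForm hα (nsJack hα κ) (nsJack hα κ) := by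
      rw [normP, ← torusForm_apply hα, jackP_eq hα hκ, monicSym, ← Complex.ofReal_inv,
        torusForm_smul_smul, torusForm_symmetrize hα hκ, co_symmetrize, leadCoeff_eq,
        Complex.ofReal_inv]
      have := leadProd_ne_zero hα κ
      field_simp
    rw [← mul_assoc, h₁, mul_assoc, (nsJack_spec hα κ).norm]
  have hz : (normProd α (0 : Fin N → ℕ) : ℂ) ≠ 0 := by
    exact_mod_cast (normProd_pos hα fun _ _ _ => le_rfl).ne'
  have h₁ := h₀ hκ
  have h₂ := h₀ (κ := (0 : Fin N → ℕ)) fun _ _ _ => le_rfl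
  have h₃ := leadProd_ne_zero hα κ
  have h₄ := leadProd_ne_zero hα (0 : Fin N → ℕ)
  have h₅ := torusForm_one_ne_zero (N := N) hα
  have h₆ : ((N ! : ℕ) : ℂ) ≠ 0 := Nat.cast_ne_zero.mpr (Nat.factorial_ne_zero N)
  have h₇ : normP α (0 : Fin N → ℕ) = N ! * torusForm hα (1 : MvPolynomial (Fin N) ℂ) 1 / leadProd α (0 : Fin N → ℕ) := by
    field_simp
    refine mul_right_cancel₀ hz ?_
    linear_combination h₂
  have h₈ : normP α κ = N ! * (torusForm hα (1 : MvPolynomial (Fin N) ℂ) 1 * normProd α κ) /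
      (leadProd α κ * normProd α (0 : Fin N → ℕ)) := by
    rw [← h₁]; field_simp
  rw [h₇, h₈]
  push_cast
  field_simp

end JackTorus

end

noncomputable section

namespace JackTorus

open Finset MvPolynomial

variable {N : ℕ}

/-! ### Products over the nodes of a diagram -/

theorem prod_Ioc_mul_gamma (α : ℝ) (n : ℕ) {a : ℕ} {c : ℝ} (hc : 0 < c) {b : ℕ}
    (hab : a ≤ b) (hb : b ≤ n) :
    (∏ j ∈ Ioc a b, (α * ((n : ℝ) - j + c))) * Real.Gamma (n - b + c) =
      α ^ (b - a) * Real.Gamma (n - a + c) := by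
  induction b, hab using Nat.le_induction with
  | base => simp
  | succ b hab ih =>
    have h₁ : ((b + 1 : ℕ) : ℝ) ≤ n := Nat.cast_le.mpr hb
    have h₂ : (0 : ℝ) < n - ((b + 1 : ℕ) : ℝ) + c := by linarith
    have h₃ : (n : ℝ) - b + c = n - ((b + 1 : ℕ) : ℝ) + c + 1 := by push_cast; ring
    have h₄ := ih (by omega)
    rw [h₃, Real.Gamma_add_one h₂.ne'] at h₄
    rw [prod_Ioc_succ_top hab, Nat.succ_sub hab, pow_succ]
    linear_combination α * h₄

theorem prod_Icc_mul_gamma (α : ℝ) (n : ℕ) {c : ℝ} (hc : 0 < c) :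
    (∏ j ∈ Icc 1 n, (α * ((j : ℝ) - 1 + c))) * Real.Gamma c = α ^ n * Real.Gamma (n + c) := by
  induction n with
  | zero => simp
  | succ n ih =>
    rw [prod_Icc_succ_top (by omega), mul_right_comm, ih, pow_succ]
    push_cast
    rw [show (n : ℝ) + 1 + c = (n + c) + 1 by ring, Real.Gamma_add_one (by positivity)]
    ring

/-- The number of rows among the first `n` rows below row `0` that reach column `j`. -/
def rowsBelow (K : ℕ → ℕ) (n j : ℕ) : ℕ := ((range n).filter fun t => j ≤ K (t + 1)).card

theorem rowsBelow_eq {K : ℕ → ℕ} (hK : Antitone K) {n r j : ℕ} (hr : r ≤ n) (h₁ : K (r + 1) < j)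
    (h₂ : j ≤ K r) : rowsBelow K n j = r := by
  have : (range n).filter (fun t => j ≤ K (t + 1)) = range r := by
    ext t
    simp only [mem_filter, mem_range]
    constructor
    · rintro ⟨-, h⟩
      by_contra ht
      exact absurd (h.trans (hK (by omega : r + 1 ≤ t + 1))) (by omega)
    · exact fun ht => ⟨by omega, h₂.trans (hK (by omega))⟩
  rw [rowsBelow, this, card_range]

theorem prod_row {α : ℝ} (hα : 0 < α) {K : ℕ → ℕ} (hK : Antitone K) {n : ℕ} {c : ℝ} (hc : 0 < c)
    {r : ℕ} (hr : r ≤ n) :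
    ∏ j ∈ Ioc (K r) (K 0), (α * ((K 0 : ℝ) - j + c) + rowsBelow K n j) =
      α ^ (K 0 - K r) * ∏ t ∈ range r, Real.Gamma (K 0 - K (t + 1) + (c + t * (1 / α))) /
        Real.Gamma (K 0 - K t + (c + t * (1 / α))) := by
  induction r with
  | zero => simp
  | succ r ih =>
    have hle : K (r + 1) ≤ K r := hK (Nat.le_succ r)
    have hle' : K r ≤ K 0 := hK (Nat.zero_le r)
    have hc' : 0 < c + r * (1 / α) := by positivity
    have h₁ : ∏ j ∈ Ioc (K (r + 1)) (K r), (α * ((K 0 : ℝ) - j + c) + rowsBelow K n j) =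
        ∏ j ∈ Ioc (K (r + 1)) (K r), (α * ((K 0 : ℝ) - j + (c + r * (1 / α)))) := by
      refine prod_congr rfl fun j hj => ?_
      obtain ⟨h₁, h₂⟩ := mem_Ioc.mp hj
      rw [rowsBelow_eq hK (by omega) h₁ h₂]
      field_simp
      ring
    have h₂ := prod_Ioc_mul_gamma α (K 0) hc' hle hle'
    have h₃ : Real.Gamma (K 0 - K r + (c + r * (1 / α))) ≠ 0 := by
      have : (K r : ℝ) ≤ K 0 := Nat.cast_le.mpr hle'
      exact (Real.Gamma_pos_of_pos (by linarith)).ne'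
    rw [← prod_Ioc_consecutive _ hle hle', ih (by omega), h₁, prod_range_succ,
      eq_div_of_mul_eq h₃ h₂, show K 0 - K (r + 1) = (K r - K (r + 1)) + (K 0 - K r) by omega,
      pow_add]
    ring

/-- The factor of a pair of rows in the norm of the symmetric Jack polynomials. -/
def rowQuot (k x : ℝ) : ℝ :=
  Real.Gamma (x + k) * Real.Gamma (x + 1 - k) / (Real.Gamma x * Real.Gamma (x + 1))

/-- The quotient of the factors of `d'` and `h` that come from row `0`. -/
theorem prod_row_div {α : ℝ} (hα : 0 < α) {K : ℕ → ℕ} (hK : Antitone K) {n : ℕ}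
    (hn : K (n + 1) = 0) :
    (∏ j ∈ Icc 1 (K 0), (α * ((K 0 : ℝ) - j + 1) + rowsBelow K (n + 1) j)) /
      (∏ j ∈ Icc 1 (K 0), (α * ((K 0 : ℝ) - j + 1 / α) + rowsBelow K (n + 1) j)) =
    Real.Gamma (1 / α) * (Real.Gamma (K 0 + (1 + n * (1 / α))) /
      Real.Gamma (K 0 + (n + 1) * (1 / α))) *
      ∏ t ∈ range n, rowQuot (1 / α) (K 0 - K (t + 1) + (t + 1 : ℕ) * (1 / α)) := by
  have hk : 0 < 1 / α := one_div_pos.mpr hα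
  have h₁ := prod_row hα hK (n := n + 1) one_pos le_rfl
  have h₂ := prod_row hα hK (n := n + 1) hk le_rfl
  rw [hn] at h₁ h₂
  set D : ℕ → ℝ := fun t => K 0 - K t + t * (1 / α) with hD
  set k := 1 / α with hk'
  have e₁ : ∏ t ∈ range (n + 1), Real.Gamma (K 0 - K (t + 1) + (1 + t * k)) /
        Real.Gamma (K 0 - K t + (1 + t * k)) =
      ∏ t ∈ range (n + 1), Real.Gamma (D (t + 1) + 1 - k) / Real.Gamma (D t + 1) := by
    refine prod_congr rfl fun t _ => ?_
    simp only [hD]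
    push_cast
    congr 2 <;> ring
  have e₂ : ∏ t ∈ range (n + 1), Real.Gamma (K 0 - K (t + 1) + (k + t * k)) /
        Real.Gamma (K 0 - K t + (k + t * k)) =
      ∏ t ∈ range (n + 1), Real.Gamma (D (t + 1)) / Real.Gamma (D t + k) := by
    refine prod_congr rfl fun t _ => ?_
    simp only [hD]
    push_cast
    congr 2 <;> ring
  have hα' : α ^ (K 0) ≠ 0 := (pow_pos hα _).ne'
  change (∏ j ∈ Ioc 0 (K 0), _) / (∏ j ∈ Ioc 0 (K 0), _) = _
  rw [h₁, h₂, e₁, e₂, Nat.sub_zero, mul_div_mul_left _ _ hα', ← prod_div_distrib]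
  have e₃ : ∀ t, Real.Gamma (D (t + 1) + 1 - k) / Real.Gamma (D t + 1) /
      (Real.Gamma (D (t + 1)) / Real.Gamma (D t + k)) =
      (Real.Gamma (D (t + 1) + 1 - k) / Real.Gamma (D (t + 1))) *
        (Real.Gamma (D t + k) / Real.Gamma (D t + 1)) := fun t => by
    rw [div_div_div_eq, div_mul_div_comm]
    ring
  simp only [e₃, prod_mul_distrib]
  rw [prod_range_succ, prod_range_succ' (fun t => Real.Gamma (D t + k) / Real.Gamma (D t + 1))]
  have e₄ : ∀ t, rowQuot k (K 0 - K (t + 1) + (t + 1 : ℕ) * k) =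
      (Real.Gamma (D (t + 1) + 1 - k) / Real.Gamma (D (t + 1))) *
        (Real.Gamma (D (t + 1) + k) / Real.Gamma (D (t + 1) + 1)) := fun t => by
    rw [rowQuot, div_mul_div_comm, mul_comm (Real.Gamma (_ + k))]
  simp only [e₄, prod_mul_distrib]
  have e₅ : D 0 = 0 := by simp [hD]
  have e₆ : D (n + 1) = K 0 + (n + 1) * k := by simp [hD, hn]
  rw [e₅, e₆, zero_add, zero_add, Real.Gamma_one, div_one,
    show (K 0 : ℝ) + (n + 1) * k + 1 - k = K 0 + (1 + n * k) by ring]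
  ring

/-- The factors of `b`, `d'`, `e'`, `h` that come from row `0`. -/
theorem prod_row_quot {α : ℝ} (hα : 0 < α) {K : ℕ → ℕ} (hK : Antitone K) {n : ℕ}
    (hn : K (n + 1) = 0) :
    (∏ j ∈ Icc 1 (K 0), (α * ((j : ℝ) - 1 + (n + 1) * (1 / α)))) *
      (∏ j ∈ Icc 1 (K 0), (α * ((K 0 : ℝ) - j + 1) + rowsBelow K (n + 1) j)) /
      ((∏ j ∈ Icc 1 (K 0), (α * ((j : ℝ) - 1 + (1 + n * (1 / α))))) *
      (∏ j ∈ Icc 1 (K 0), (α * ((K 0 : ℝ) - j + 1 / α) + rowsBelow K (n + 1) j))) =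
    Real.Gamma (1 / α) * Real.Gamma (1 + n * (1 / α)) / Real.Gamma ((n + 1) * (1 / α)) *
      ∏ t ∈ range n, rowQuot (1 / α) (K 0 - K (t + 1) + (t + 1 : ℕ) * (1 / α)) := by
  have hk : 0 < 1 / α := one_div_pos.mpr hα
  have h₁ : 0 < (n + 1) * (1 / α) := by positivity
  have h₂ : 0 < 1 + n * (1 / α) := by positivity
  have g₁ := (Real.Gamma_pos_of_pos h₁).ne'
  have g₂ := (Real.Gamma_pos_of_pos h₂).ne'
  have g₃ : Real.Gamma (K 0 + (n + 1) * (1 / α)) ≠ 0 := (Real.Gamma_pos_of_pos (by positivity)).ne'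
  have g₄ : Real.Gamma (K 0 + (1 + n * (1 / α))) ≠ 0 := (Real.Gamma_pos_of_pos (by positivity)).ne'
  have hα' : α ^ (K 0) ≠ 0 := (pow_pos hα _).ne'
  rw [mul_div_mul_comm, prod_row_div hα hK hn,
    eq_div_of_mul_eq g₁ (prod_Icc_mul_gamma α (K 0) h₁),
    eq_div_of_mul_eq g₂ (prod_Icc_mul_gamma α (K 0) h₂)]
  set p := ∏ t ∈ range n, rowQuot (1 / α) (K 0 - K (t + 1) + (t + 1 : ℕ) * (1 / α))
  field_simp

end JackTorus

end

noncomputable section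

namespace JackTorus

open Finset MvPolynomial

variable {N : ℕ}

/-- The rows of `κ` from row `i` on, continued by zeros. -/
def rowsFrom (κ : Fin N → ℕ) (i : Fin N) (t : ℕ) : ℕ :=
  if h : i + t < N then κ ⟨i + t, h⟩ else 0

theorem rowsFrom_zero (κ : Fin N → ℕ) (i : Fin N) : rowsFrom κ i 0 = κ i := by
  rw [rowsFrom, dif_pos (by simp)]
  rfl

theorem rowsFrom_last (κ : Fin N → ℕ) (i : Fin N) : rowsFrom κ i (i.rev + 1) = 0 := by
  rw [rowsFrom, dif_neg]
  rw [Fin.val_rev]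
  omega

theorem rowsFrom_sub (κ : Fin N → ℕ) {i k : Fin N} (h : i < k) :
    rowsFrom κ i ((k : ℕ) - i - 1 + 1) = κ k := by
  have h' : (i : ℕ) < k := h
  have : (i : ℕ) + ((k : ℕ) - i - 1 + 1) = k := by omega
  rw [rowsFrom, dif_pos (by rw [this]; exact k.isLt)]
  congr 1
  exact Fin.ext this

theorem rowsFrom_antitone {κ : Fin N → ℕ} (hκ : Antitone κ) (i : Fin N) :
    Antitone (rowsFrom κ i) := by
  intro s t hst
  unfold rowsFrom
  split_ifs with h₁ h₂ h₃
  · exact hκ (Fin.mk_le_mk.mpr (by omega))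
  · omega
  · exact Nat.zero_le _
  · exact le_rfl

theorem prod_Ioi_eq_range {M : Type*} [CommMonoid M] (i : Fin N) (F : Fin N → M) (G : ℕ → M)
    (h : ∀ k, i < k → F k = G ((k : ℕ) - i - 1)) :
    ∏ k ∈ Ioi i, F k = ∏ t ∈ range (i.rev : ℕ), G t := by
  refine prod_bij' (fun k _ => (k : ℕ) - i - 1)
    (fun t ht => ⟨i + t + 1, by rw [mem_range, Fin.val_rev] at ht; omega⟩) ?_ ?_ ?_ ?_ ?_
  · intro k hk
    have : i < k := mem_Ioi.mp hk
    rw [Fin.lt_def] at this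
    rw [mem_range, Fin.val_rev]
    omega
  · intro t ht
    rw [mem_Ioi, Fin.lt_def]
    simp only
    omega
  · intro k hk
    have : i < k := mem_Ioi.mp hk
    rw [Fin.lt_def] at this
    refine Fin.ext ?_
    simp only
    omega
  · intro t ht
    simp only
    omega
  · exact fun k hk => h k (mem_Ioi.mp hk)

theorem leg_antitone {κ : Fin N → ℕ} (hκ : Antitone κ) (i : Fin N) (j : ℕ) :
    leg κ i j = (univ.filter fun k => i < k ∧ j ≤ κ k).card := by
  have h₂ : (univ.filter fun k => k < i ∧ j ≤ κ k + 1 ∧ κ k + 1 ≤ κ i) = ∅ := by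
    refine filter_eq_empty_iff.mpr fun k _ h => ?_
    have := hκ h.1.le
    omega
  rw [leg, h₂, card_empty, add_zero]
  congr 1
  ext k
  simp only [mem_filter, mem_univ, true_and]
  exact ⟨fun h => ⟨h.1, h.2.1⟩, fun h => ⟨h.1, h.2, hκ h.1.le⟩⟩

theorem leg_eq_rowsBelow {κ : Fin N → ℕ} (hκ : Antitone κ) (i : Fin N) {j : ℕ} (hj : 1 ≤ j) :
    leg κ i j = rowsBelow (rowsFrom κ i) (i.rev + 1) j := by
  rw [leg_antitone hκ, rowsBelow, card_filter, card_filter, sum_range_succ, rowsFrom_last,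
    if_neg (by omega), add_zero, ← sum_filter_add_sum_filter_not univ (fun k => i < k)]
  rw [sum_eq_zero (s := univ.filter fun k => ¬ i < k) fun k hk => if_neg fun h => (mem_filter.mp hk).2 h.1,
    add_zero]
  have := prod_Ioi_eq_range (M := Multiplicative ℕ) i
    (fun k => Multiplicative.ofAdd (if i < k ∧ j ≤ κ k then 1 else 0))
    (fun t => Multiplicative.ofAdd (if j ≤ rowsFrom κ i (t + 1) then 1 else 0)) fun k hk => by
      rw [rowsFrom_sub κ hk]; simp only [hk, true_and]
  rw [filter_lt_eq_Ioi]
  exact this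

theorem prod_pairs {M : Type*} [CommMonoid M] (κ : Fin N → ℕ) (Q : Fin N → ℕ → ℕ → M) :
    (∏ p : Fin N × Fin N, if p.1 < p.2 then Q p.1 (κ p.2) (p.2 - p.1) else 1) =
      ∏ i, ∏ t ∈ range (i.rev : ℕ), Q i (rowsFrom κ i (t + 1)) (t + 1) := by
  rw [Fintype.prod_prod_type]
  refine prod_congr rfl fun i _ => ?_
  simp only
  rw [prod_ite, prod_const_one, mul_one, filter_lt_eq_Ioi]
  refine prod_Ioi_eq_range i _ _ fun k hk => ?_
  have hk' : (i : ℕ) < k := hk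
  rw [rowsFrom_sub κ hk, show (k : ℕ) - i - 1 + 1 = k - i by omega]

theorem gammaQuot_div {α y : ℝ} (hα : 0 < α) (hy : 1 ≤ y) :
    gammaQuot (1 / α) (y / α) / (1 + 1 / y) = rowQuot (1 / α) (y / α) := by
  have hk : 0 < 1 / α := one_div_pos.mpr hα
  have hy₀ : 0 < y := by linarith
  have hx : 0 < y / α := div_pos hy₀ hα
  have h₁ : y / α + 1 + 1 / α = (y / α + 1 / α) + 1 := by ring
  have g₁ := (Real.Gamma_pos_of_pos hx).ne'
  rw [gammaQuot, rowQuot, h₁, Real.Gamma_add_one (by positivity), Real.Gamma_add_one hx.ne']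
  field_simp

theorem normProd_div_leadProd {α : ℝ} (hα : 0 < α) {κ : Fin N → ℕ} (hκ : Antitone κ) :
    normProd α κ / leadProd α κ = ∏ i, ∏ t ∈ range (i.rev : ℕ),
      rowQuot (1 / α) (κ i - rowsFrom κ i (t + 1) + (t + 1 : ℕ) * (1 / α)) := by
  rw [normProd, leadProd, pairProd_antitone _ _ _ hκ, pairProd_antitone _ _ _ hκ,
    ← prod_div_distrib, ← prod_pairs κ fun i m t => rowQuot (1 / α) (κ i - m + t * (1 / α))]
  refine prod_congr rfl fun p _ => ?_
  split_ifs with h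
  · rw [gammaQuot_div hα (one_le_bar_sub hα hκ h)]
    congr 1
    rw [bar, bar, coleg_antitone hκ, coleg_antitone hκ,
      Nat.cast_sub (Fin.lt_def.mp h).le]
    field_simp
    ring
  · exact div_one _

theorem cast_rev (i : Fin N) : ((i.rev : ℕ) : ℝ) = (N : ℝ) - 1 - (i : ℕ) := by
  rw [Fin.val_rev, Nat.cast_sub (by omega)]
  push_cast; ring

theorem b_mul_d'_div {α : ℝ} (hα : 0 < α) {κ : Fin N → ℕ} (hκ : Antitone κ) :
    b α κ * d' α κ / (e' α κ * h α κ) =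
      (∏ i : Fin N, Real.Gamma (1 / α) * Real.Gamma (1 + (i.rev : ℕ) * (1 / α)) /
        Real.Gamma (((i.rev : ℕ) + 1) * (1 / α))) * (normProd α κ / leadProd α κ) := by
  rw [normProd_div_leadProd hα hκ, b, d', e', h, ← prod_mul_distrib, ← prod_mul_distrib,
    ← prod_div_distrib, ← prod_mul_distrib]
  refine prod_congr rfl fun i _ => ?_
  have := prod_row_quot hα (rowsFrom_antitone hκ i) (rowsFrom_last κ i)
  rw [rowsFrom_zero] at this
  rw [← this]
  refine congrArg₂ _ (congrArg₂ _ (prod_congr rfl fun j hj => ?_) (prod_congr rfl fun j hj => ?_))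
    (congrArg₂ _ (prod_congr rfl fun j hj => ?_) (prod_congr rfl fun j hj => ?_))
  · rw [coarm, coleg_antitone hκ, cast_rev]
    field_simp
    ring
  · rw [arm, leg_eq_rowsBelow hκ i (mem_Icc.mp hj).1]
  · rw [coarm, coleg_antitone hκ, cast_rev]
    field_simp
    ring
  · rw [arm, leg_eq_rowsBelow hκ i (mem_Icc.mp hj).1]
    field_simp
    ring

theorem normProd_div_eq {α : ℝ} (hα : 0 < α) {κ : Fin N → ℕ} (hκ : Antitone κ) :
    (normProd α κ / leadProd α κ) / (normProd α (0 : Fin N → ℕ) / leadProd α (0 : Fin N → ℕ)) =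
      b α κ * d' α κ / (e' α κ * h α κ) := by
  have h₀ := b_mul_d'_div (N := N) hα (κ := 0) fun _ _ _ => le_rfl
  have h₁ : b α (0 : Fin N → ℕ) * d' α (0 : Fin N → ℕ) /
      (e' α (0 : Fin N → ℕ) * h α (0 : Fin N → ℕ)) = 1 := by
    simp [b, d', e', h]
  rw [h₁] at h₀
  have h₂ := right_ne_zero_of_mul (h₀ ▸ one_ne_zero)
  rw [b_mul_d'_div hα hκ, div_eq_iff h₂, mul_right_comm, ← h₀, one_mul]

/-! ### The reversed partition -/

theorem prod_diagram_rev {M : Type*} [CommMonoid M] (F : ℕ → ℕ → M) (κ : Fin N → ℕ) :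
    ∏ i, F (κ (Fin.rev i)) (coleg (fun i => κ (Fin.rev i)) i) = ∏ i, F (κ i) (coleg κ i) :=
  prod_coleg_comp_perm F κ Fin.revPerm

theorem e_rev (α : ℝ) (κ : Fin N → ℕ) : e α (fun i => κ (Fin.rev i)) = e α κ :=
  prod_diagram_rev (fun v l => ∏ j ∈ Icc 1 v, (α * (coarm j + 1) + N - l)) κ

theorem e'_rev (α : ℝ) (κ : Fin N → ℕ) : e' α (fun i => κ (Fin.rev i)) = e' α κ :=
  prod_diagram_rev (fun v l => ∏ j ∈ Icc 1 v, (α * (coarm j + 1) + N - 1 - l)) κ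

/-- The number of rows of length at least `j - 1` and less than `v`. -/
def rowsBetween (κ : Fin N → ℕ) (v j : ℕ) : ℕ :=
  (univ.filter fun k => j ≤ κ k + 1 ∧ κ k < v).card

theorem leg_of_monotone {η : Fin N → ℕ} (hη : Monotone η) (i : Fin N) {j : ℕ} (hj : j ≤ η i) :
    leg η i j = (univ.filter fun k => i < k ∧ η k = η i).card + rowsBetween η (η i) j := by
  unfold leg rowsBetween
  congr 2 <;> ext k <;> simp only [mem_filter, mem_univ, true_and]
  · refine and_congr_right fun h => ?_
    have := hη h.le
    omega
  · refine ⟨fun h => ⟨h.2.1, h.2.2⟩, fun h => ⟨?_, h.1, h.2⟩⟩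
    by_contra h'
    have := hη (not_lt.mp h')
    omega

theorem leg_of_antitone {κ : Fin N → ℕ} (hκ : Antitone κ) (i : Fin N) {j : ℕ} (hj : j ≤ κ i) :
    leg κ i j = (univ.filter fun k => i < k ∧ κ k = κ i).card + rowsBetween κ (κ i) (j + 1) := by
  rw [leg_antitone hκ, rowsBetween, ← card_union_of_disjoint]
  · congr 1
    ext k
    simp only [mem_filter, mem_univ, true_and, mem_union]
    constructor
    · rintro ⟨h₁, h₂⟩
      have := hκ h₁.le
      rcases this.lt_or_eq with h | h
      · exact Or.inr ⟨by omega, h⟩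
      · exact Or.inl ⟨h₁, h⟩
    · rintro (⟨h₁, h₂⟩ | ⟨h₁, h₂⟩)
      · exact ⟨h₁, by omega⟩
      · refine ⟨?_, by omega⟩
        by_contra h'
        have := hκ (not_lt.mp h')
        omega
  · rw [disjoint_left]
    intro k h₁ h₂
    simp only [mem_filter, mem_univ, true_and] at h₁ h₂
    omega

theorem rowsBetween_rev (κ : Fin N → ℕ) (v j : ℕ) :
    rowsBetween (fun i => κ (Fin.rev i)) v j = rowsBetween κ v j :=
  card_equiv Fin.revPerm fun k => by simp

theorem prod_Icc_one_eq_range {M : Type*} [CommMonoid M] (f : ℕ → M) (n : ℕ) :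
    ∏ j ∈ Icc 1 n, f j = ∏ j ∈ range n, f (j + 1) := by
  induction n with
  | zero => simp
  | succ n ih => rw [prod_Icc_succ_top (by omega), ih, prod_range_succ]

theorem d_rev (α : ℝ) {κ : Fin N → ℕ} (hκ : Antitone κ) :
    d α (fun i => κ (Fin.rev i)) = ∏ i, ∏ j ∈ range (κ i), (α * ((κ i : ℝ) - j) + leg κ i j + 1) := by
  set F : ℕ → ℕ → ℝ := fun v t => ∏ j ∈ Icc 1 v, (α * ((v : ℝ) - j + 1) + (t + rowsBetween κ v j : ℕ) + 1)
    with hF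
  have h₁ : d α (fun i => κ (Fin.rev i)) = ∏ i, F (κ (Fin.rev i))
      (univ.filter fun k => i < k ∧ κ (Fin.rev k) = κ (Fin.rev i)).card := by
    refine prod_congr rfl fun i _ => prod_congr rfl fun j hj => ?_
    rw [leg_of_monotone (fun a b hab => hκ (Fin.rev_le_rev.mpr hab)) i (mem_Icc.mp hj).2,
      rowsBetween_rev, arm]
  have h₂ : ∏ i, F (κ (Fin.rev i)) (univ.filter fun k => i < k ∧ κ (Fin.rev k) = κ (Fin.rev i)).card =
      ∏ i, F (κ i) (univ.filter fun k => i < k ∧ κ k = κ i).card := by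
    rw [prod_ties_gt F κ, prod_ties_gt F fun i => κ (Fin.rev i)]
    have h₃ : univ.sup (fun i => κ (Fin.rev i)) = univ.sup κ := by
      refine le_antisymm (Finset.sup_le fun a _ => le_sup (f := κ) (mem_univ (Fin.rev a)))
        (Finset.sup_le fun a _ => ?_)
      have := le_sup (f := fun i => κ (Fin.rev i)) (mem_univ (Fin.rev a))
      simpa using this
    rw [h₃]
    refine prod_congr rfl fun v _ => ?_
    rw [show freq (fun i => κ (Fin.rev i)) v = freq κ v from freq_comp_perm κ Fin.revPerm v]
  rw [h₁, h₂]
  refine prod_congr rfl fun i _ => ?_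
  simp only [hF]
  rw [prod_Icc_one_eq_range]
  refine prod_congr rfl fun j hj => ?_
  rw [leg_of_antitone hκ i (mem_range.mp hj).le]
  push_cast
  ring

theorem h_eq (α : ℝ) (κ : Fin N → ℕ) :
    h α κ = ∏ i, ∏ j ∈ range (κ i), (α * ((κ i : ℝ) - (j + 1 : ℕ)) + leg κ i (j + 1) + 1) := by
  unfold h arm
  simp only [prod_Icc_one_eq_range]

theorem d_rev_mul {α : ℝ} {κ : Fin N → ℕ} (hκ : Antitone κ) :
    d α (fun i => κ (Fin.rev i)) * freqFactorial κ =
      h α κ * ∏ i : Fin N, (α * κ i + N - (i : ℕ)) := by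
  have h₁ : (freqFactorial κ : ℝ) =
      ∏ i, (α * ((κ i : ℝ) - (κ i : ℕ)) + leg κ i (κ i) + 1) := by
    rw [← prod_ties_gt_succ, Nat.cast_prod]
    refine prod_congr rfl fun i _ => ?_
    have : rowsBetween κ (κ i) (κ i + 1) = 0 :=
      card_eq_zero.mpr (filter_eq_empty_iff.mpr fun k _ => by omega)
    rw [leg_of_antitone hκ i le_rfl, this]
    push_cast
    ring
  have h₂ : ∏ i : Fin N, (α * κ i + N - (i : ℕ)) =
      ∏ i, (α * ((κ i : ℝ) - (0 : ℕ)) + leg κ i 0 + 1) := by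
    refine prod_congr rfl fun i _ => ?_
    have : leg κ i 0 = i.rev := by
      rw [leg_antitone hκ]
      simp only [Nat.zero_le, and_true]
      rw [filter_lt_eq_Ioi, Fin.card_Ioi, Fin.val_rev]
      omega
    rw [this, cast_rev]
    push_cast
    ring
  rw [d_rev α hκ, h_eq, h₁, h₂, ← prod_mul_distrib, ← prod_mul_distrib]
  refine prod_congr rfl fun i _ => ?_
  rw [← prod_range_succ (fun j : ℕ => α * ((κ i : ℝ) - j) + leg κ i j + 1),
    ← prod_range_succ' (fun j : ℕ => α * ((κ i : ℝ) - j) + leg κ i j + 1)]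

theorem prod_sub_val : ∏ i : Fin N, ((N : ℝ) - (i : ℕ)) = (N ! : ℕ) := by
  rw [← Equiv.prod_comp Fin.revPerm, ← prod_range_add_one_eq_factorial, Nat.cast_prod,
    ← Fin.prod_univ_eq_prod_range fun i => ((i + 1 : ℕ) : ℝ)]
  refine prod_congr rfl fun i _ => ?_
  rw [Fin.revPerm_apply, cast_rev]
  push_cast
  ring

theorem e_mul_factorial {α : ℝ} {κ : Fin N → ℕ} (hκ : Antitone κ) :
    e α κ * (N ! : ℕ) = b α κ * ∏ i : Fin N, (α * κ i + N - (i : ℕ)) := by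
  rw [e, b, ← prod_sub_val, ← prod_mul_distrib, ← prod_mul_distrib]
  refine prod_congr rfl fun i _ => ?_
  simp only [prod_Icc_one_eq_range, coarm, coleg_antitone hκ]
  have h₁ := prod_range_succ (fun j : ℕ => α * (j : ℝ) + N - (i : ℕ)) (κ i)
  rw [prod_range_succ'] at h₁
  simp only [Nat.cast_zero, mul_zero, zero_add] at h₁
  calc _ = _ := ?_
    _ = _ := h₁
    _ = _ := ?_
  · congr 1
    refine prod_congr rfl fun j _ => ?_
    push_cast; ring
  · congr 1
    refine prod_congr rfl fun j _ => ?_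
    push_cast; ring

theorem rev_quotient_eq {α : ℝ} (hα : 0 < α) {κ : Fin N → ℕ} (hκ : Antitone κ) :
    (N ! : ℝ) / freqFactorial κ * (d' α κ * e α (fun i => κ (Fin.rev i)) /
      (d α (fun i => κ (Fin.rev i)) * e' α (fun i => κ (Fin.rev i)))) =
      b α κ * d' α κ / (e' α κ * h α κ) := by
  have hA : ∏ i : Fin N, (α * κ i + N - (i : ℕ)) ≠ 0 := by
    refine prod_ne_zero_iff.mpr fun i _ => ?_
    have h₁ : ((i : ℕ) : ℝ) < N := Nat.cast_lt.mpr i.isLt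
    have h₂ : 0 ≤ α * κ i := by positivity
    exact (by linarith : 0 < α * κ i + N - (i : ℕ)).ne'
  have h₁ := e_mul_factorial (α := α) hκ
  have h₂ := d_rev_mul (α := α) hκ
  rw [e_rev, e'_rev]
  calc _ = (e α κ * (N ! : ℕ)) * d' α κ /
        ((d α (fun i => κ (Fin.rev i)) * freqFactorial κ) * e' α κ) := by
        rw [div_mul_div_comm]; congr 1 <;> ring
    _ = _ := by
        rw [h₁, h₂, mul_right_comm, mul_right_comm (h α κ), mul_div_mul_right _ _ hA,
          mul_comm (h α κ)]

end JackTorus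

end
theorem proposition3p4 (N : ℕ) (α : ℝ) (hα : 0 < α) (η : Fin N → ℕ) :
    (∃! P, JackTorus.IsSymmetricJack α (JackTorus.plus η) P) ∧
    JackTorus.normP α (JackTorus.plus η) / JackTorus.normP α (0 : Fin N → ℕ) =
      (((N ! : ℝ) / JackTorus.freqFactorial (JackTorus.plus η) *
        (JackTorus.d' α (JackTorus.plus η) * JackTorus.e α (JackTorus.revPlus η) /
          (JackTorus.d α (JackTorus.revPlus η) * JackTorus.e' α (JackTorus.revPlus η))) : ℝ) : ℂ) ∧
    (N ! : ℝ) / JackTorus.freqFactorial (JackTorus.plus η) *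
        (JackTorus.d' α (JackTorus.plus η) * JackTorus.e α (JackTorus.revPlus η) /
          (JackTorus.d α (JackTorus.revPlus η) * JackTorus.e' α (JackTorus.revPlus η))) =
      JackTorus.b α (JackTorus.plus η) * JackTorus.d' α (JackTorus.plus η) /
        (JackTorus.e' α (JackTorus.plus η) * JackTorus.h α (JackTorus.plus η)) := by
  have hκ := JackTorus.plus_antitone η
  have h₁ := JackTorus.rev_quotient_eq hα hκ
  refine ⟨JackTorus.existsUnique_isSymmetricJack hα hκ, ?_, h₁⟩
  rw [JackTorus.normP_div hα hκ, JackTorus.normProd_div_eq hα hκ]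
  exact congrArg _ h₁.symm
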